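/- Let $(p,q)$ be a pair of coprime integers with $0\le p<q$, put $N=p+q$ and $m=\left[\frac{N}{2}\right]+2$, and let $$c_l(i)=\frac{\cos\frac{\pi}{12}\,N^2\left(4+\pi^2(2i+1)^2\right)}{(N-i-1)^2},\qquad c_\alpha(j)=4\left(8\pi N^2\cos\frac{\pi}{12}\,\tan^2\frac{\pi j}{2N}+1\right),$$ $$c_0=\frac{3-\dfrac{N+2}{\pi\cos\frac{\pi}{12}\,N^2}-16\sum_{i=0}^{m}\tan^2\frac{\pi i}{2N}} {1-\dfrac{N+2}{2\pi\cos\frac{\pi}{12}\,N^2}-8\sum_{i=0}^{m}\tan^2\frac{\pi i}{2N}}.$$ (The terms that are undefined, namely $c_l(N-1)$ and $\tan^2\frac{\pi N}{2N}$, which occur in the sums only if $N\le 6$ and $N\le 4$ respectively, are read as $0$.) Suppose that $$0<\varepsilon<\min\left\{\frac{\sqrt3}{4c_0\sqrt{p^2+q^2+pq}\,\sum_{i=0}^{m}\left(c_l(i)+\sum_{j=0}^{i}c_\alpha(j)\right)},\ \frac{1}{8\cos\frac{\pi}{12}\,N^2}\right\}.$$ Then on the regular tetrahedron in the unit sphere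 $\mathbb S^3$ whose faces are regular spherical triangles with angle $\alpha=\frac{\pi}{3}+\varepsilon$ there exists a simple closed geodesic of type $(p,q)$, and it is unique up to isometries of $\mathbb S^3$ (possibly orientation-reversing) that map the tetrahedron onto itself. Here the tetrahedron is regarded as a closed surface. A closed geodesic on it is a closed curve that consists of great-circle arcs on the faces, avoids the vertices of the tetrahedron, and forms equal (vertical) angles with the edge on the two adjacent faces whenever it crosses an edge; it is simple if it neither intersects itself nor runs along itself. It has type $(p,q)$ if it has $p$ points on each of two opposite edges, $q$ points on each of two other opposite edges, and $p+q$ points on each of the remaining two opposite edges. -/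

import Mathlib

/-- Four-dimensional Euclidean space; `S³` is its unit sphere. -/
abbrev E4 : Type := EuclideanSpace ℝ (Fin 4)

/-- The vector tangent to the unit sphere at the unit vector `x` that points from `x` towards `y`
along the great circle through `x` and `y`. -/
noncomputable def tangentTowards (x y : E4) : E4 := y - (inner ℝ x y : ℝ) • x

/-- The angle at `x` between the great arcs from `x` to `y` and from `x` to `z`. -/
noncomputable def sphericalAngle (x y z : E4) : ℝ :=
  InnerProductGeometry.angle (tangentTowards x y) (tangentTowards x z)

/-- The closed shortest great arc joining two non-antipodal unit vectors. -/
def greatArc (x y : E4) : Set E4 :=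
  {z | ‖z‖ = 1 ∧ ∃ s t : ℝ, 0 ≤ s ∧ 0 ≤ t ∧ z = s • x + t • y}

/-- The same arc without its endpoints. -/
def openGreatArc (x y : E4) : Set E4 :=
  {z | ‖z‖ = 1 ∧ ∃ s t : ℝ, 0 < s ∧ 0 < t ∧ z = s • x + t • y}

/-- `A 0, A 1, A 2, A 3` are the vertices of a regular tetrahedron in `S³` with planar angle `α`:
all edges have the same length, and all angles of the faces are equal to `α`. -/
structure IsRegularTetrahedron (A : Fin 4 → E4) (α : ℝ) : Prop where
  norm_eq_one : ∀ i, ‖A i‖ = 1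
  linearIndependent : LinearIndependent ℝ A
  edges_equal : ∀ i j k l, i ≠ j → k ≠ l →
    InnerProductGeometry.angle (A i) (A j) = InnerProductGeometry.angle (A k) (A l)
  planar_angle : ∀ i j k, i ≠ j → i ≠ k → j ≠ k → sphericalAngle (A i) (A j) (A k) = α

/-- The face opposite to the vertex `A k`: the spherical triangle whose vertices are the
other three. -/
def tetraFace (A : Fin 4 → E4) (k : Fin 4) : Set E4 :=
  {z | ‖z‖ = 1 ∧ ∃ w : Fin 4 → ℝ, (∀ i, 0 ≤ w i) ∧ w k = 0 ∧ z = ∑ i, w i • A i}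

/-- The tetrahedron as a closed surface: the union of its four faces. -/
def tetraSurface (A : Fin 4 → E4) : Set E4 := ⋃ k, tetraFace A k

/-- `k, l` are the labels of the endpoints of the common edge of the two different faces
opposite to the vertices labelled `f` and `g`. -/
def IsCommonEdge (f g k l : Fin 4) : Prop :=
  f ≠ g ∧ k ≠ l ∧ k ≠ f ∧ k ≠ g ∧ l ≠ f ∧ l ≠ g

/-- A closed geodesic on the tetrahedron, given by its cyclic sequence of vertices `X i` (its
points on the edges) and the faces that it crosses: the great arc from `X i` to `X (i + 1)` lies on
the face opposite to `A (F i)`.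

It consists of great arcs on the faces, it crosses from a face to another one at interior points of
edges (so it avoids the vertices of the tetrahedron), and at each crossing it forms equal angles
with the edge on the two sides. -/
structure IsClosedGeodesic (A : Fin 4 → E4) {n : ℕ} (X : ZMod n → E4) (F : ZMod n → Fin 4) :
    Prop where
  face_ne : ∀ i, F (i - 1) ≠ F i
  /-- Both ends of the arc on the face `F i` lie on edges of that face, and on different ones. -/
  edge_ne : ∀ i, F (i - 1) ≠ F (i + 1)
  mem_edge : ∀ i k l, IsCommonEdge (F (i - 1)) (F i) k l → X i ∈ openGreatArc (A k) (A l)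
  equal_angles : ∀ i k l, IsCommonEdge (F (i - 1)) (F i) k l →
    sphericalAngle (X i) (A k) (X (i + 1)) = sphericalAngle (X i) (A l) (X (i - 1))

/-- `γ` is (the point set of) a simple closed geodesic on the tetrahedron: a closed geodesic
without self-intersections, passed once. The half-open arcs `[X i, X (i + 1))` being pairwise
disjoint means that the closed curve is injective on a period. -/
def IsSimpleClosedGeodesic (A : Fin 4 → E4) (γ : Set E4) : Prop :=
  ∃ (n : ℕ) (X : ZMod n → E4) (F : ZMod n → Fin 4), 0 < n ∧ IsClosedGeodesic A X F ∧
    (∀ i j, i ≠ j → Disjoint (greatArc (X i) (X (i + 1)) \ {X (i + 1)})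
      (greatArc (X j) (X (j + 1)) \ {X (j + 1)})) ∧
    γ = ⋃ i, greatArc (X i) (X (i + 1))

/-- The number of points of `γ` on the edge with endpoints `A k` and `A l`. -/
noncomputable def edgeCount (A : Fin 4 → E4) (γ : Set E4) (k l : Fin 4) : ℕ :=
  (γ ∩ greatArc (A k) (A l)).ncard

/-- `γ` has type `(p, q)`: it has `p` vertices on each of two opposite edges, `q` vertices on each
of other two opposite edges, and `p + q` vertices on each of the remaining two opposite edges. -/
def HasType (A : Fin 4 → E4) (γ : Set E4) (p q : ℕ) : Prop :=
  ∃ σ : Equiv.Perm (Fin 4),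
    edgeCount A γ (σ 0) (σ 1) = p ∧ edgeCount A γ (σ 2) (σ 3) = p ∧
    edgeCount A γ (σ 0) (σ 2) = q ∧ edgeCount A γ (σ 1) (σ 3) = q ∧
    edgeCount A γ (σ 0) (σ 3) = p + q ∧ edgeCount A γ (σ 1) (σ 2) = p + q

/-- The sum of `tan² (π i / (2 (p + q)))` over `0 ≤ i ≤ [(p + q) / 2] + 2`. The value at
`i = p + q`, which occurs only for `p + q ≤ 4`, is undefined and is read as `0`, in accordance
with `Real.tan (π / 2) = 0`. -/
noncomputable def tanSum (p q : ℕ) : ℝ :=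
  ∑ i ∈ Finset.range ((p + q) / 2 + 3), Real.tan (Real.pi * i / (2 * (p + q))) ^ 2

/-- The constant `c₀`. -/
noncomputable def cZero (p q : ℕ) : ℝ :=
  (3 - (p + q + 2) / (Real.pi * Real.cos (Real.pi / 12) * (p + q) ^ 2) - 16 * tanSum p q) /
  (1 - (p + q + 2) / (2 * Real.pi * Real.cos (Real.pi / 12) * (p + q) ^ 2) - 8 * tanSum p q)

/-- The constant `c_l(i)`. For `i = p + q - 1`, which occurs in the bound only for `p + q ≤ 6`, the
denominator is zero and the term is read as `0`. -/
noncomputable def cLen (p q i : ℕ) : ℝ :=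
  Real.cos (Real.pi / 12) * (p + q) ^ 2 * (4 + Real.pi ^ 2 * (2 * i + 1) ^ 2) /
    ((p : ℝ) + q - i - 1) ^ 2

/-- The constant `c_α(j)`. For `j = p + q` the square of the tangent is read as `0`. -/
noncomputable def cAngle (p q j : ℕ) : ℝ :=
  4 * (8 * Real.pi * (p + q) ^ 2 * Real.cos (Real.pi / 12) *
    Real.tan (Real.pi * j / (2 * (p + q))) ^ 2 + 1)

/-- The upper bound for `ε`. -/
noncomputable def epsBound (p q : ℕ) : ℝ :=
  min
    (Real.sqrt 3 / (4 * cZero p q * Real.sqrt (p ^ 2 + q ^ 2 + p * q) *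
      ∑ i ∈ Finset.range ((p + q) / 2 + 3),
        (cLen p q i + ∑ j ∈ Finset.range (i + 1), cAngle p q j)))
    (1 / (8 * Real.cos (Real.pi / 12) * (p + q) ^ 2))

/-! Points of the surface are written as nonnegative combinations of the four vertices, whose Gram
matrix depends on one number `c`, with cos α = c / (1 + c). Equality of angles at an edge becomes a
polynomial relation between weights (`equal_angles_iff`): the path is a great circle once the two
adjacent faces are unfolded into one sphere S². A linear functional φ on a face g₁ extends to a
functional ψ on the next face g₂ across the edge kl by φ(g₂) + ψ(g₁) = κ (φ(k) + φ(l)), where κ = 2c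
/ (1 + c) = 2 cos α. The Euclidean case is κ = 1.

Uniqueness. Along a geodesic a developed functional has the form a cos s + b sin s (`devValue_eq`).
The functional cutting out the great circle of one closed geodesic is multiplied by a number after
one turn. On another geodesic with the same faces and length in (0, π) it must vanish, because a
rotation by such an angle has no real eigenvector; so the two coincide (`eq_zero_first`). No arc is
longer than an edge and there are 4(p + q) arcs, so for small ε the length is below π. The sequence
of faces is determined by the numbers of points on the edges, as for normal curves on a triangulated
surface: arcs around a corner are nested, and their number follows from the edge counts
(`faces_eq_step`, `trace_eq`). Finally, every relabelling of the vertices is induced by an isometry.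

Existence. The flat tetrahedron is the plane modulo doubled lattice translations and half-turns, and
the geodesic is the zero line of the affine function p a - q b + 1/2 of a lattice point (a, b). Its
values on the lattice are y(k) = k + 1/2 at the level k = p a - q b. For κ near 1 the same pattern
is kept with an unknown function y, odd about -1/2. Compatibility across the edges is a homogeneous
linear system with fewer equations than unknowns (`exists_odd_solution`), and its solutions are
nearly linear (`exists_profile`). The signs of y then show which edges are crossed, and its
monotonicity keeps the arcs on a face disjoint. The curve closes up by construction.

The bound on ε enters only through 64 (p + q)³ (1 - 2 cos α) < 1 (`small_of_lt_epsBound`). -/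

/-! ### Regular frames and the balance form of equal angles -/

namespace SphericalTetrahedron

open Real InnerProductGeometry

/-- The combination of the vertices with given weights. -/
noncomputable def comb (A : Fin 4 → E4) (w : Fin 4 → ℝ) : E4 := ∑ v, w v • A v

/-- The vertices of a regular tetrahedron with edges of length `arccos c < π / 2`. -/
structure IsRegularFrame (A : Fin 4 → E4) (c : ℝ) : Prop where
  linearIndependent : LinearIndependent ℝ A
  inner_self : ∀ i, inner ℝ (A i) (A i) = 1
  inner_of_ne : ∀ i j, i ≠ j → inner ℝ (A i) (A j) = c
  pos : 0 < c
  lt_one : c < 1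

/-! ### Labels and weights on a common edge of two faces. -/

theorem sum_fin_four {M : Type*} [AddCommMonoid M] {f g k l : Fin 4} (h : IsCommonEdge f g k l)
    (φ : Fin 4 → M) : ∑ v, φ v = φ k + φ l + φ f + φ g := by
  obtain ⟨h1, h2, h3, h4, h5, h6⟩ := h
  have : (Finset.univ : Finset (Fin 4)) = {k, l, f, g} := by
    symm
    apply Finset.eq_univ_of_card
    rw [Finset.card_insert_of_notMem, Finset.card_insert_of_notMem, Finset.card_insert_of_notMem,
      Finset.card_singleton, Fintype.card_fin] <;> simp [*]
  rw [this, Finset.sum_insert, Finset.sum_insert, Finset.sum_insert, Finset.sum_singleton]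
  · simp only [add_assoc]
  all_goals simp [*]

theorem forall_fin_four {f g k l : Fin 4} (h : IsCommonEdge f g k l) (v : Fin 4) :
    v = k ∨ v = l ∨ v = f ∨ v = g := by
  revert f g k l v; unfold IsCommonEdge; decide

theorem exists_commonEdge {f g : Fin 4} (h : f ≠ g) : ∃ k l, IsCommonEdge f g k l := by
  revert f g; unfold IsCommonEdge; decide

theorem comb_single (A : Fin 4 → E4) (k : Fin 4) : comb A (Pi.single k 1) = A k := by
  simp [comb, Pi.single_apply]

theorem comb_add (A : Fin 4 → E4) (w w' : Fin 4 → ℝ) :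
    comb A (w + w') = comb A w + comb A w' := by
  simp [comb, add_smul, Finset.sum_add_distrib]

theorem comb_smul (A : Fin 4 → E4) (s : ℝ) (w : Fin 4 → ℝ) :
    comb A (s • w) = s • comb A w := by
  simp [comb, Finset.smul_sum, mul_smul]

theorem comb_eq_of_support {A : Fin 4 → E4} {f g k l : Fin 4} (h : IsCommonEdge f g k l)
    {w : Fin 4 → ℝ} (hf : w f = 0) (hg : w g = 0) : comb A w = w k • A k + w l • A l := by
  rw [comb, sum_fin_four h]; simp [hf, hg]

namespace IsRegularFrame

variable {A : Fin 4 → E4} {c : ℝ}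

theorem comb_injective (hA : IsRegularFrame A c) : Function.Injective (comb A) := by
  intro w w' h
  have h1 : ∑ v, (w v - w' v) • A v = 0 := by
    simpa [comb, sub_smul, Finset.sum_sub_distrib, sub_eq_zero] using h
  funext v
  exact sub_eq_zero.1 (Fintype.linearIndependent_iff.1 hA.linearIndependent _ h1 v)

theorem inner_comb (hA : IsRegularFrame A c) (w w' : Fin 4 → ℝ) :
    inner ℝ (comb A w) (comb A w') =
      (1 - c) * (w ⬝ᵥ w') + c * ((∑ v, w v) * ∑ v, w' v) := by
  have h01 := hA.inner_of_ne 0 1 (by decide)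
  have h02 := hA.inner_of_ne 0 2 (by decide)
  have h03 := hA.inner_of_ne 0 3 (by decide)
  have h12 := hA.inner_of_ne 1 2 (by decide)
  have h13 := hA.inner_of_ne 1 3 (by decide)
  have h23 := hA.inner_of_ne 2 3 (by decide)
  have h10 := hA.inner_of_ne 1 0 (by decide)
  have h20 := hA.inner_of_ne 2 0 (by decide)
  have h30 := hA.inner_of_ne 3 0 (by decide)
  have h21 := hA.inner_of_ne 2 1 (by decide)
  have h31 := hA.inner_of_ne 3 1 (by decide)
  have h32 := hA.inner_of_ne 3 2 (by decide)
  simp only [comb, Fin.sum_univ_four, inner_add_left, inner_add_right, real_inner_smul_left,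
    real_inner_smul_right, hA.inner_self, h01, h02, h03, h12, h13, h23, h10, h20, h30, h21, h31,
    h32, dotProduct]
  ring

theorem comb_sq (hA : IsRegularFrame A c) (w : Fin 4 → ℝ) :
    ‖comb A w‖ ^ 2 = (1 - c) * (w ⬝ᵥ w) + c * (∑ v, w v) ^ 2 := by
  rw [← real_inner_self_eq_norm_sq, hA.inner_comb]; ring

/-- The scalar form of the equality of angles. -/
theorem div_sqrt_eq_iff {P H μ ν a b : ℝ} (hP : 0 < P) (hH : 0 < H) (ha : 0 < a) (hb : 0 < b) :
    μ / √(μ ^ 2 * P + b ^ 2 * H) = -ν / √(ν ^ 2 * P + a ^ 2 * H) ↔ μ * a + ν * b = 0 := by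
  have h1 : 0 < μ ^ 2 * P + b ^ 2 * H := by positivity
  have h2 : 0 < ν ^ 2 * P + a ^ 2 * H := by positivity
  have s1 := Real.sqrt_pos.2 h1
  have s2 := Real.sqrt_pos.2 h2
  have q1 := Real.sq_sqrt h1.le
  have q2 := Real.sq_sqrt h2.le
  rw [div_eq_div_iff s1.ne' s2.ne']
  set S := √(μ ^ 2 * P + b ^ 2 * H)
  set T := √(ν ^ 2 * P + a ^ 2 * H)
  constructor
  · intro h
    have h3 : (μ * a + ν * b) * (μ * a - ν * b) = 0 := by
      have : (μ * T) ^ 2 = (-ν * S) ^ 2 := by rw [h]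
      rw [mul_pow, mul_pow, q1, q2] at this
      have h4 : H * ((μ * a + ν * b) * (μ * a - ν * b)) = 0 := by linear_combination this
      exact (mul_eq_zero.1 h4).resolve_left hH.ne'
    rcases mul_eq_zero.1 h3 with h4 | h4
    · exact h4
    -- Squaring admits the spurious case μa = νb; positivity of `a`, `b` and the roots then forces μ
    -- = ν = 0.
    · have e1 : μ * a = ν * b := sub_eq_zero.1 h4
      have e2 : μ * (T * b + S * a) = 0 := by linear_combination b * h + S * e1
      have e3 : μ = 0 := (mul_eq_zero.1 e2).resolve_right (by positivity)
      have e4 : ν = 0 := by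
        rw [e3, zero_mul] at e1
        exact (mul_eq_zero.1 e1.symm).resolve_right hb.ne'
      simp [e3, e4]
  · intro h
    have e1 : S * a = T * b := by
      apply (sq_eq_sq₀ (by positivity) (by positivity)).1
      rw [mul_pow, mul_pow, q1, q2]
      linear_combination P * (μ * a - ν * b) * h
    have : (μ * T + ν * S) * a * b = 0 := by
      linear_combination ν * b * e1 + T * b * h
    have h5 : μ * T + ν * S = 0 := by
      rcases mul_eq_zero.1 this with h6 | h6
      · exact (mul_eq_zero.1 h6).resolve_right ha.ne'
      · exact absurd h6 hb.ne'
    linear_combination h5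

/-- The condition on the weights of three consecutive vertices `z`, `x`, `y` of a broken geodesic
which says that it unfolds to a great arc at the vertex `x` on the edge `k l`. -/
def Balanced (c : ℝ) (f g k l : Fin 4) (x y z : Fin 4 → ℝ) : Prop :=
  (x l * y k - x k * y l + c / (1 + c) * (x l - x k) * y f) * z g +
    (x l * z k - x k * z l + c / (1 + c) * (x l - x k) * z g) * y f = 0

/-- The part of the vertex `A f` orthogonal to the edge `k l`. -/
noncomputable def height (A : Fin 4 → E4) (c : ℝ) (f k l : Fin 4) : E4 :=
  A f - (c / (1 + c)) • (A k + A l)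

/-- A vector along the edge `k l`, orthogonal to the point of the edge with weights `x`. -/
noncomputable def edgeTangent (A : Fin 4 → E4) (c : ℝ) (k l : Fin 4) (x : Fin 4 → ℝ) : E4 :=
  (x l + c * x k) • A k - (x k + c * x l) • A l


/-! ### The orthogonal frame at a point of an edge. -/

theorem norm_height_sq (hA : IsRegularFrame A c) {f k l : Fin 4} (h1 : k ≠ l) (h2 : k ≠ f)
    (h3 : l ≠ f) : inner ℝ (height A c f k l) (height A c f k l) = 1 - 2 * c ^ 2 / (1 + c) := by
  have := hA.pos
  simp only [height, inner_add_left, inner_add_right, inner_sub_left, inner_sub_right,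
    real_inner_smul_left, real_inner_smul_right, hA.inner_self, hA.inner_of_ne _ _ h1,
    hA.inner_of_ne _ _ h2, hA.inner_of_ne _ _ h3, hA.inner_of_ne _ _ h1.symm,
    hA.inner_of_ne _ _ h2.symm, hA.inner_of_ne _ _ h3.symm]
  field_simp
  ring

theorem inner_edgeTangent_height (hA : IsRegularFrame A c) {f k l : Fin 4} (h1 : k ≠ l)
    (h2 : k ≠ f) (h3 : l ≠ f) (x : Fin 4 → ℝ) :
    inner ℝ (edgeTangent A c k l x) (height A c f k l) = 0 := by
  have := hA.pos
  simp only [height, edgeTangent, inner_add_right, inner_sub_left, inner_sub_right,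
    real_inner_smul_left, real_inner_smul_right, hA.inner_self, hA.inner_of_ne _ _ h1,
    hA.inner_of_ne _ _ h2, hA.inner_of_ne _ _ h3, hA.inner_of_ne _ _ h1.symm]
  field_simp
  ring

theorem norm_edge_sq (hA : IsRegularFrame A c) {f g k l : Fin 4} (h : IsCommonEdge f g k l)
    {x : Fin 4 → ℝ} (xf : x f = 0) (xg : x g = 0) (hx : ‖comb A x‖ = 1) :
    x k ^ 2 + x l ^ 2 + 2 * c * x k * x l = 1 := by
  have := hA.comb_sq x
  rw [hx, dotProduct, sum_fin_four h, sum_fin_four h, xf, xg] at this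
  linear_combination -this

theorem inner_edgeTangent_self (hA : IsRegularFrame A c) {f g k l : Fin 4}
    (h : IsCommonEdge f g k l) {x : Fin 4 → ℝ} (xf : x f = 0) (xg : x g = 0)
    (hx : ‖comb A x‖ = 1) :
    inner ℝ (edgeTangent A c k l x) (edgeTangent A c k l x) = 1 - c ^ 2 := by
  have h0 := hA.norm_edge_sq h xf xg hx
  simp only [edgeTangent, inner_sub_left, inner_sub_right,
    real_inner_smul_left, real_inner_smul_right, hA.inner_self, hA.inner_of_ne _ _ h.2.1,
    hA.inner_of_ne _ _ h.2.1.symm]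
  linear_combination (1 - c ^ 2) * h0

theorem inner_edge (hA : IsRegularFrame A c) {f g k l : Fin 4} (h : IsCommonEdge f g k l)
    {x y : Fin 4 → ℝ} (xf : x f = 0) (xg : x g = 0) (yg : y g = 0) :
    inner ℝ (comb A x) (comb A y) =
      y k * (x k + c * x l) + y l * (x l + c * x k) + y f * c * (x k + x l) := by
  rw [hA.inner_comb, dotProduct, sum_fin_four h, sum_fin_four h, sum_fin_four h, xf, xg, yg]
  ring

/-- These are the coefficients of the tangent vector at `A k` and `A l`; the remaining one, at `A
f`, is `y f`. `three_term` uses them in this scalar form. -/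
theorem tangent_weights (hA : IsRegularFrame A c) {f g k l : Fin 4} (h : IsCommonEdge f g k l)
    {x y : Fin 4 → ℝ} (xf : x f = 0) (xg : x g = 0) (hx : ‖comb A x‖ = 1) (yg : y g = 0) :
    y k - inner ℝ (comb A x) (comb A y) * x k =
        (x l * y k - x k * y l + c / (1 + c) * (x l - x k) * y f) * (x l + c * x k) -
          y f * (c / (1 + c)) ∧
      y l - inner ℝ (comb A x) (comb A y) * x l =
        -(x l * y k - x k * y l + c / (1 + c) * (x l - x k) * y f) * (x k + c * x l) -
          y f * (c / (1 + c)) := by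
  have h0 := hA.norm_edge_sq h xf xg hx
  have hc : 1 + c ≠ 0 := by have := hA.pos; positivity
  rw [hA.inner_edge h xf xg yg]
  constructor <;> field_simp
  · linear_combination (-(1 + c) * y k - y f * c) * h0
  · linear_combination (-(1 + c) * y l - y f * c) * h0

/-- Decomposition of the direction of an arc along and across the edge; the two components are
orthogonal. -/
theorem tangentTowards_comb (hA : IsRegularFrame A c) {f g k l : Fin 4} (h : IsCommonEdge f g k l)
    {x y : Fin 4 → ℝ} (xf : x f = 0) (xg : x g = 0) (hx : ‖comb A x‖ = 1) (yg : y g = 0) :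
    tangentTowards (comb A x) (comb A y) =
      (x l * y k - x k * y l + c / (1 + c) * (x l - x k) * y f) • edgeTangent A c k l x +
        y f • height A c f k l := by
  obtain ⟨hk, hl⟩ := hA.tangent_weights h xf xg hx yg
  rw [tangentTowards]
  set I : ℝ := inner ℝ (comb A x) (comb A y)
  rw [comb_eq_of_support h xf xg,
    show comb A y = y k • A k + y l • A l + y f • A f by rw [comb, sum_fin_four h, yg]; simp]
  calc _ = (y k - I * x k) • A k + (y l - I * x l) • A l + y f • A f := by module
    _ = _ := by rw [hk, hl, edgeTangent, height]; module

theorem norm_tangentTowards_sq (hA : IsRegularFrame A c) {f g k l : Fin 4}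
    (h : IsCommonEdge f g k l) {x y : Fin 4 → ℝ} (xf : x f = 0) (xg : x g = 0)
    (hx : ‖comb A x‖ = 1) (yg : y g = 0) :
    ‖tangentTowards (comb A x) (comb A y)‖ ^ 2 =
      (x l * y k - x k * y l + c / (1 + c) * (x l - x k) * y f) ^ 2 * (1 - c ^ 2) +
        y f ^ 2 * (1 - 2 * c ^ 2 / (1 + c)) := by
  obtain ⟨h1, h2, h3, h4, h5, h6⟩ := id h
  rw [hA.tangentTowards_comb h xf xg hx yg, ← real_inner_self_eq_norm_sq]
  simp only [inner_add_left, inner_add_right, real_inner_smul_left, real_inner_smul_right,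
    hA.inner_edgeTangent_self h xf xg hx, hA.norm_height_sq h2 h3 h5,
    hA.inner_edgeTangent_height h2 h3 h5, real_inner_comm (edgeTangent A c k l x)]
  ring

theorem height_sq_pos (hA : IsRegularFrame A c) : 0 < 1 - 2 * c ^ 2 / (1 + c) := by
  have h1 := hA.pos
  have h2 := hA.lt_one
  rw [sub_pos, div_lt_one (by positivity)]
  nlinarith

/-- The angle equation in scalar form. -/
theorem equal_angles_iff (hA : IsRegularFrame A c) {f g k l : Fin 4} (h : IsCommonEdge f g k l)
    {x y z : Fin 4 → ℝ} (xf : x f = 0) (xg : x g = 0) (xk : 0 < x k) (xl : 0 < x l)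
    (hx : ‖comb A x‖ = 1) (yg : y g = 0) (yf : 0 < y f) (zf : z f = 0) (zg : 0 < z g) :
    sphericalAngle (comb A x) (A k) (comb A y) = sphericalAngle (comb A x) (A l) (comb A z) ↔
      Balanced c f g k l x y z := by
  obtain ⟨h1, h2, h3, h4, h5, h6⟩ := id h
  have h' : IsCommonEdge g f k l := ⟨h1.symm, h2, h4, h3, h6, h5⟩
  have hP : 0 < 1 - c ^ 2 := by nlinarith [hA.pos, hA.lt_one]
  -- Seen from a point of the edge, `A k` and `A l` lie in opposite directions; hence the minus sign
  -- in the angle equation.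
  have tk : tangentTowards (comb A x) (A k) = x l • edgeTangent A c k l x := by
    rw [← comb_single A k, hA.tangentTowards_comb h xf xg hx (by simp [h4.symm])]
    simp [h2.symm, h3.symm]
  have tl : tangentTowards (comb A x) (A l) = x k • (-edgeTangent A c k l x) := by
    rw [← comb_single A l, hA.tangentTowards_comb h xf xg hx (by simp [h6.symm])]
    simp [h2, h5.symm]
  have ny := hA.norm_tangentTowards_sq h xf xg hx yg
  have nz := hA.norm_tangentTowards_sq h' xg xf hx zf
  have ty := hA.tangentTowards_comb h xf xg hx yg
  have tz := hA.tangentTowards_comb h' xg xf hx zf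
  have nE := hA.inner_edgeTangent_self h xf xg hx
  unfold sphericalAngle Balanced
  have iy : inner ℝ (edgeTangent A c k l x) (tangentTowards (comb A x) (comb A y)) =
      (x l * y k - x k * y l + c / (1 + c) * (x l - x k) * y f) * (1 - c ^ 2) := by
    rw [ty, inner_add_right, real_inner_smul_right, real_inner_smul_right, nE,
      hA.inner_edgeTangent_height h2 h3 h5]
    ring
  have iz : inner ℝ (edgeTangent A c k l x) (tangentTowards (comb A x) (comb A z)) =
      (x l * z k - x k * z l + c / (1 + c) * (x l - x k) * z g) * (1 - c ^ 2) := by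
    rw [tz, inner_add_right, real_inner_smul_right, real_inner_smul_right, nE,
      hA.inner_edgeTangent_height h2 h4 h6]
    ring
  rw [← div_sqrt_eq_iff hP hA.height_sq_pos zg yf, ← ny, ← nz, Real.sqrt_sq (norm_nonneg _),
    Real.sqrt_sq (norm_nonneg _), tk, tl, angle_smul_left_of_pos _ _ xl,
    angle_smul_left_of_pos _ _ xk, angle, angle, Real.arccos_inj
      (abs_le.1 (abs_real_inner_div_norm_mul_norm_le_one _ _)).1
      (abs_le.1 (abs_real_inner_div_norm_mul_norm_le_one _ _)).2
      (abs_le.1 (abs_real_inner_div_norm_mul_norm_le_one _ _)).1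
      (abs_le.1 (abs_real_inner_div_norm_mul_norm_le_one _ _)).2, inner_neg_left, iy, iz, norm_neg]
  have hE : 0 < ‖edgeTangent A c k l x‖ := by
    rw [norm_pos_iff, ← inner_self_ne_zero (𝕜 := ℝ), nE]
    exact hP.ne'
  rw [← nE, real_inner_self_eq_norm_sq]
  set E := ‖edgeTangent A c k l x‖
  have key : ∀ m n : ℝ, m * E ^ 2 / (E * n) = E * (m / n) := fun m n => by
    rw [mul_div_assoc', show m * E ^ 2 = E * (E * m) by ring, mul_div_mul_left _ _ hE.ne']
  rw [← neg_mul, key, key]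
  exact mul_right_inj' hE.ne'

end IsRegularFrame
end SphericalTetrahedron

/-! ### Closed geodesics in barycentric weights -/

namespace SphericalTetrahedron

open Real InnerProductGeometry

/-- The weights of the vertices of a closed geodesic. -/
structure IsGeodesicWeights (A : Fin 4 → E4) (c : ℝ) {n : ℕ} (F : ZMod n → Fin 4)
    (w : ZMod n → Fin 4 → ℝ) : Prop where
  face_ne : ∀ i, F (i - 1) ≠ F i
  edge_ne : ∀ i, F (i - 1) ≠ F (i + 1)
  left : ∀ i, w i (F (i - 1)) = 0
  right : ∀ i, w i (F i) = 0
  weight_pos : ∀ i v, v ≠ F (i - 1) → v ≠ F i → 0 < w i v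
  norm : ∀ i, ‖comb A (w i)‖ = 1
  balanced : ∀ i k l, IsCommonEdge (F (i - 1)) (F i) k l →
    IsRegularFrame.Balanced c (F (i - 1)) (F i) k l (w i) (w (i + 1)) (w (i - 1))

theorem openGreatArc_comb {A : Fin 4 → E4} {f g k l : Fin 4} (h : IsCommonEdge f g k l) {z : E4}
    (hz : z ∈ openGreatArc (A k) (A l)) : ∃ w : Fin 4 → ℝ, comb A w = z ∧ w f = 0 ∧ w g = 0 ∧
      (∀ v, v ≠ f → v ≠ g → 0 < w v) ∧ ‖comb A w‖ = 1 := by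
  obtain ⟨hz1, s, t, hs, ht, rfl⟩ := hz
  obtain ⟨h1, h2, h3, h4, h5, h6⟩ := id h
  have e : comb A (fun v => if v = k then s else if v = l then t else 0) = s • A k + t • A l := by
    rw [comb_eq_of_support h] <;> simp [h2.symm, h3.symm, h4.symm, h5.symm, h6.symm]
  refine ⟨_, e, by simp [h3.symm, h5.symm], by simp [h4.symm, h6.symm], ?_, by rw [e, hz1]⟩
  intro v hf hg
  rcases forall_fin_four h v with rfl | rfl | rfl | rfl
  · simpa
  · simpa [h2.symm]
  · exact absurd rfl hf
  · exact absurd rfl hg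

variable {A : Fin 4 → E4} {c : ℝ} {n : ℕ} {F : ZMod n → Fin 4} {w : ZMod n → Fin 4 → ℝ}

theorem IsRegularFrame.exists_weights (hA : IsRegularFrame A c) {X : ZMod n → E4}
    (h : IsClosedGeodesic A X F) :
    ∃ w, IsGeodesicWeights A c F w ∧ ∀ i, comb A (w i) = X i := by
  have : ∀ i, ∃ w : Fin 4 → ℝ, comb A w = X i ∧ w (F (i - 1)) = 0 ∧ w (F i) = 0 ∧
      (∀ v, v ≠ F (i - 1) → v ≠ F i → 0 < w v) ∧ ‖comb A w‖ = 1 := fun i => by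
    obtain ⟨k, l, hkl⟩ := exists_commonEdge (h.face_ne i)
    exact openGreatArc_comb hkl (h.mem_edge i k l hkl)
  choose w h1 h2 h3 h4 h5 using this
  refine ⟨w, ⟨h.face_ne, h.edge_ne, h2, h3, h4, h5, fun i k l hkl => ?_⟩, h1⟩
  have e1 := h.edge_ne i
  have e2 := h.edge_ne (i - 1)
  have e3 := h.face_ne (i - 1)
  have l1 := h2 (i + 1)
  have p1 := h4 (i + 1) (F (i - 1))
  have p2 := h4 (i - 1) (F i)
  simp only [add_sub_cancel_right, sub_add_cancel] at *
  refine (hA.equal_angles_iff hkl (h2 i) (h3 i) (h4 i k hkl.2.2.1 hkl.2.2.2.1)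
    (h4 i l hkl.2.2.2.2.1 hkl.2.2.2.2.2) (h5 i) l1 (p1 (h.face_ne i) e1) (h3 (i - 1))
    (p2 e2.symm (h.face_ne i).symm)).1 ?_
  simp only [h1]
  exact h.equal_angles i k l hkl

namespace IsGeodesicWeights

theorem next_left (h : IsGeodesicWeights A c F w) (i : ZMod n) : w (i + 1) (F i) = 0 := by
  simpa using h.left (i + 1)

theorem next_pos (h : IsGeodesicWeights A c F w) (i : ZMod n) : 0 < w (i + 1) (F (i - 1)) :=
  h.weight_pos _ _ (by simpa using h.face_ne i) (h.edge_ne i)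

theorem prev_pos (h : IsGeodesicWeights A c F w) (i : ZMod n) : 0 < w (i - 1) (F i) :=
  h.weight_pos _ _ (by simpa using (h.edge_ne (i - 1)).symm) (h.face_ne i).symm

theorem weight_nonneg (h : IsGeodesicWeights A c F w) (i : ZMod n) (v : Fin 4) : 0 ≤ w i v := by
  by_cases h1 : v = F (i - 1)
  · rw [h1, h.left]
  by_cases h2 : v = F i
  · rw [h2, h.right]
  exact (h.weight_pos i v h1 h2).le

theorem isClosedGeodesic (hA : IsRegularFrame A c) (h : IsGeodesicWeights A c F w) :
    IsClosedGeodesic A (fun i => comb A (w i)) F where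
  face_ne := h.face_ne
  edge_ne := h.edge_ne
  mem_edge i k l hkl := ⟨h.norm i, w i k, w i l, h.weight_pos i k hkl.2.2.1 hkl.2.2.2.1,
    h.weight_pos i l hkl.2.2.2.2.1 hkl.2.2.2.2.2, comb_eq_of_support hkl (h.left i) (h.right i)⟩
  equal_angles i k l hkl :=
    (hA.equal_angles_iff hkl (h.left i) (h.right i) (h.weight_pos i k hkl.2.2.1 hkl.2.2.2.1)
      (h.weight_pos i l hkl.2.2.2.2.1 hkl.2.2.2.2.2) (h.norm i) (h.next_left i) (h.next_pos i)
      (h.right (i - 1)) (h.prev_pos i)).2 (h.balanced i k l hkl)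

/-! ### Lengths of arcs. -/

/-- The cosine of the length of the arc from the vertex `i` to the next vertex. -/
noncomputable def arcCos (A : Fin 4 → E4) (w : ZMod n → Fin 4 → ℝ) (i : ZMod n) : ℝ :=
  inner ℝ (comb A (w i)) (comb A (w (i + 1)))

theorem norm_tangentTowards_sq_of_norm {x y : E4} (hx : ‖x‖ = 1) (hy : ‖y‖ = 1) :
    ‖tangentTowards x y‖ ^ 2 = 1 - (inner ℝ x y : ℝ) ^ 2 := by
  rw [tangentTowards, norm_sub_sq_real, norm_smul, hx, hy, real_inner_smul_right,
    real_inner_comm x y, mul_one, Real.norm_eq_abs, sq_abs]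
  ring

theorem one_sub_arcCos_sq_pos (hA : IsRegularFrame A c) (h : IsGeodesicWeights A c F w)
    (i : ZMod n) : 0 < 1 - arcCos A w i ^ 2 := by
  obtain ⟨k, l, hkl⟩ := exists_commonEdge (h.face_ne i)
  rw [arcCos, ← norm_tangentTowards_sq_of_norm (h.norm i) (h.norm _),
    hA.norm_tangentTowards_sq hkl (h.left i) (h.right i) (h.norm i) (h.next_left i)]
  have h1 : 0 < 1 - c ^ 2 := by nlinarith [hA.pos, hA.lt_one]
  have h2 := h.next_pos i
  have h3 := hA.height_sq_pos
  positivity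

/-- Nonnegative weights satisfy w·w ≤ (∑ w)², so the Gram formula for the norm gives 1 ≤ (∑ w)². -/
theorem one_le_sum (hA : IsRegularFrame A c) {x : Fin 4 → ℝ} (h0 : ∀ v, 0 ≤ x v)
    (h1 : ‖comb A x‖ = 1) : 1 ≤ ∑ v, x v := by
  have h := hA.comb_sq x
  rw [h1] at h
  have h2 : x ⬝ᵥ x ≤ (∑ v, x v) ^ 2 := by
    rw [sq, Finset.sum_mul]
    exact Finset.sum_le_sum fun v _ =>
      mul_le_mul_of_nonneg_left (Finset.single_le_sum (fun i _ => h0 i) (Finset.mem_univ v)) (h0 v)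
  have h3 : 0 ≤ ∑ v, x v := Finset.sum_nonneg fun v _ => h0 v
  nlinarith [hA.pos, hA.lt_one, mul_le_mul_of_nonneg_left h2 (sub_nonneg.2 hA.lt_one.le)]

/-- In the Gram formula the dot product is nonnegative and both weight sums are at least 1. Thus no
arc is longer than an edge. -/
theorem le_arcCos (hA : IsRegularFrame A c) (h : IsGeodesicWeights A c F w) (i : ZMod n) :
    c ≤ arcCos A w i := by
  rw [arcCos, hA.inner_comb]
  have h1 := one_le_sum hA (h.weight_nonneg i) (h.norm i)
  have h2 := one_le_sum hA (h.weight_nonneg (i + 1)) (h.norm (i + 1))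
  have h3 : 0 ≤ w i ⬝ᵥ w (i + 1) :=
    Finset.sum_nonneg fun v _ => mul_nonneg (h.weight_nonneg i v) (h.weight_nonneg (i + 1) v)
  have h4 : 1 ≤ (∑ v, w i v) * ∑ v, w (i + 1) v := one_le_mul_of_one_le_of_one_le h1 h2
  nlinarith [hA.pos, hA.lt_one, mul_nonneg (sub_nonneg.2 hA.lt_one.le) h3]

/-- Values of two linear functionals that correspond under unfolding, along a geodesic. -/
theorem three_term (hA : IsRegularFrame A c) (h : IsGeodesicWeights A c F w) (i : ZMod n)
    {k l : Fin 4} (hkl : IsCommonEdge (F (i - 1)) (F i) k l) {φ ψ : Fin 4 → ℝ} (hk : φ k = ψ k)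
    (hl : φ l = ψ l)
    (hfg : φ (F i) + ψ (F (i - 1)) = 2 * (c / (1 + c)) * (φ k + φ l)) :
    (ψ ⬝ᵥ w (i + 1) - arcCos A w i * ψ ⬝ᵥ w i) / √(1 - arcCos A w i ^ 2) =
      -((φ ⬝ᵥ w (i - 1) - arcCos A w (i - 1) * φ ⬝ᵥ w i) / √(1 - arcCos A w (i - 1) ^ 2)) := by
  have hlk : IsCommonEdge (F i) (F (i - 1)) k l :=
    ⟨hkl.1.symm, hkl.2.1, hkl.2.2.2.1, hkl.2.2.1, hkl.2.2.2.2.2, hkl.2.2.2.2.1⟩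
  have s1 := Real.sqrt_pos.2 (h.one_sub_arcCos_sq_pos hA i)
  have s2 := Real.sqrt_pos.2 (h.one_sub_arcCos_sq_pos hA (i - 1))
  have q1 := Real.sq_sqrt (h.one_sub_arcCos_sq_pos hA i).le
  have q2 := Real.sq_sqrt (h.one_sub_arcCos_sq_pos hA (i - 1)).le
  have e2 : arcCos A w (i - 1) = inner ℝ (comb A (w i)) (comb A (w (i - 1))) := by
    rw [arcCos, sub_add_cancel, real_inner_comm]
  have b := h.balanced i k l hkl
  have ha := h.prev_pos i
  have hb := h.next_pos i
  obtain ⟨k1, l1⟩ := hA.tangent_weights hkl (h.left i) (h.right i) (h.norm i) (h.next_left i)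
  obtain ⟨k2, l2⟩ := hA.tangent_weights hlk (h.right i) (h.left i) (h.norm i) (h.right (i - 1))
  have n1 := hA.norm_tangentTowards_sq hkl (h.left i) (h.right i) (h.norm i) (h.next_left i)
  have n2 := hA.norm_tangentTowards_sq hlk (h.right i) (h.left i) (h.norm i) (h.right (i - 1))
  rw [norm_tangentTowards_sq_of_norm (h.norm i) (h.norm _)] at n1 n2
  rw [← e2] at k2 l2 n2
  rw [← arcCos] at k1 l1 n1
  unfold IsRegularFrame.Balanced at b
  have g1 := h.left i
  have g2 := h.right i
  have g3 := h.next_left i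
  have g4 := h.right (i - 1)
  set S := √(1 - arcCos A w i ^ 2)
  set T := √(1 - arcCos A w (i - 1) ^ 2)
  set C := arcCos A w i
  set D := arcCos A w (i - 1)
  simp only [dotProduct]
  rw [sum_fin_four hkl, sum_fin_four hkl, sum_fin_four hkl, sum_fin_four hkl, ← hk, ← hl, g1, g2,
    g3, g4]
  set a := w (i - 1) (F i)
  set b' := w (i + 1) (F (i - 1))
  set μ := w i l * w (i + 1) k - w i k * w (i + 1) l + c / (1 + c) * (w i l - w i k) * b'
  set ν := w i l * w (i - 1) k - w i k * w (i - 1) l + c / (1 + c) * (w i l - w i k) * a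
  -- The tangent vectors towards the next and the previous vertex have lengths `S`, `T` and
  -- components (μ, b'), (ν, a) along and across the edge. Balance makes them opposite after
  -- unfolding, so S : T = b' : a.
  have r1 : S * a = T * b' := by
    apply (sq_eq_sq₀ (by positivity) (by positivity)).1
    rw [mul_pow, mul_pow, q1, q2, n1, n2]
    linear_combination (1 - c ^ 2) * (μ * a - ν * b') * b
  -- The combination of the two tangent vectors that cancels after unfolding is evaluated on the
  -- functionals; `hfg` says where the apex of the second face lands.
  have r2 : a * (φ k * w (i + 1) k + φ l * w (i + 1) l + ψ (F (i - 1)) * b' -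
      C * (φ k * w i k + φ l * w i l)) + b' * (φ k * w (i - 1) k + φ l * w (i - 1) l +
      φ (F i) * a - D * (φ k * w i k + φ l * w i l)) = 0 := by
    linear_combination a * φ k * k1 + a * φ l * l1 + b' * φ k * k2 + b' * φ l * l2 +
      a * b' * hfg + (φ k * (w i l + c * w i k) - φ l * (w i k + c * w i l)) * b
  rw [← neg_div, div_eq_div_iff s1.ne' s2.ne']
  apply mul_left_cancel₀ hb.ne'
  linear_combination S * r2 - (φ k * w (i + 1) k + φ l * w (i + 1) l + ψ (F (i - 1)) * b' -
      C * (φ k * w i k + φ l * w i l)) * r1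

end IsGeodesicWeights

/-! ### Developing a linear functional along the faces. -/

/-- The values at the vertices of the next face `g` of the functional that corresponds under
unfolding to the functional with the values `φ` at the vertices of the face `f`. -/
noncomputable def unfoldStep (c : ℝ) (f g : Fin 4) (φ : Fin 4 → ℝ) : Fin 4 → ℝ := fun v =>
  -- The face `g` does not contain `A g`, so the value there is a convention; `0` is used when
  -- developed functionals are compared after a full turn.
  if v = g then 0 else if v = f then 2 * (c / (1 + c)) * (∑ u, φ u - φ f - φ g) - φ g else φ v

/-- A functional on the face `F 0` developed along the sequence of faces. -/
noncomputable def develop (c : ℝ) (F : ZMod n → Fin 4) (φ : Fin 4 → ℝ) : ℕ → Fin 4 → ℝ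
  | 0 => φ
  | m + 1 => unfoldStep c (F m) (F (m + 1 : ℕ)) (develop c F φ m)

namespace IsGeodesicWeights

theorem dotProduct_eq_of_edge {f g k l : Fin 4} (hkl : IsCommonEdge f g k l) {x φ ψ : Fin 4 → ℝ}
    (hf : x f = 0) (hg : x g = 0) (hk : φ k = ψ k) (hl : φ l = ψ l) : φ ⬝ᵥ x = ψ ⬝ᵥ x := by
  simp only [dotProduct]
  rw [sum_fin_four hkl, sum_fin_four hkl, hf, hg, hk, hl]
  ring

/-- The value of the developed functional at the vertex `m`. -/
noncomputable def devValue (c : ℝ) (F : ZMod n → Fin 4) (w : ZMod n → Fin 4 → ℝ) (φ : Fin 4 → ℝ)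
    (m : ℕ) : ℝ := develop c F φ m ⬝ᵥ w m

/-- The derivative of the developed functional along the geodesic at the vertex `m`. -/
noncomputable def devSlope (A : Fin 4 → E4) (c : ℝ) (F : ZMod n → Fin 4) (w : ZMod n → Fin 4 → ℝ)
    (φ : Fin 4 → ℝ) (m : ℕ) : ℝ :=
  (devValue c F w φ (m + 1) - arcCos A w m * devValue c F w φ m) / √(1 - arcCos A w m ^ 2)

theorem unfoldStep_edge {f g k l : Fin 4} (hkl : IsCommonEdge f g k l) (φ : Fin 4 → ℝ) :
    unfoldStep c f g φ k = φ k ∧ unfoldStep c f g φ l = φ l ∧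
      φ g + unfoldStep c f g φ f = 2 * (c / (1 + c)) * (φ k + φ l) := by
  obtain ⟨h1, h2, h3, h4, h5, h6⟩ := id hkl
  refine ⟨by simp [unfoldStep, h3, h4], by simp [unfoldStep, h5, h6], ?_⟩
  simp only [unfoldStep, h1, if_false, if_true, sum_fin_four hkl]
  ring

/-- The vertex `m + 1` lies on the common edge, where the unfolding does not change the functional.
-/
theorem devValue_succ (h : IsGeodesicWeights A c F w) (φ : Fin 4 → ℝ) (m : ℕ) :
    devValue c F w φ (m + 1) = develop c F φ m ⬝ᵥ w (m + 1) := by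
  have hm : ((m + 1 : ℕ) : ZMod n) - 1 = m := by push_cast; ring
  obtain ⟨k, l, hkl⟩ := exists_commonEdge (h.face_ne (m + 1 : ℕ))
  have h1 := h.left (m + 1 : ℕ)
  have h2 := h.right (m + 1 : ℕ)
  rw [hm] at hkl h1
  obtain ⟨e1, e2, e3⟩ := unfoldStep_edge (c := c) hkl (develop c F φ m)
  rw [devValue, develop, dotProduct_eq_of_edge hkl h1 h2 e1 e2]
  push_cast
  rfl

/-- The derivative along the geodesic is the same before and after an edge, by `three_term`; here it
is expressed through the preceding arc. -/
theorem devSlope_succ (hA : IsRegularFrame A c) (h : IsGeodesicWeights A c F w) (φ : Fin 4 → ℝ)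
    (m : ℕ) : devSlope A c F w φ (m + 1) =
      -((devValue c F w φ m - arcCos A w m * devValue c F w φ (m + 1)) /
        √(1 - arcCos A w m ^ 2)) := by
  have hm : ((m + 1 : ℕ) : ZMod n) - 1 = m := by push_cast; ring
  obtain ⟨k, l, hkl⟩ := exists_commonEdge (h.face_ne (m + 1 : ℕ))
  have hkl' := hkl
  rw [hm] at hkl'
  obtain ⟨e1, e2, e3⟩ := unfoldStep_edge (c := c) hkl' (develop c F φ m)
  have key := h.three_term hA (m + 1 : ℕ) hkl (φ := develop c F φ m)
    (ψ := develop c F φ (m + 1)) e1.symm e2.symm (by rw [hm]; exact e3)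
  rw [hm] at key
  have a1 := h.devValue_succ φ (m + 1)
  have a2 := h.devValue_succ φ m
  rw [← Nat.cast_succ] at a2
  rw [← a1, ← a2] at key
  exact key

/-- The length of the geodesic from the vertex `0` to the vertex `m`. -/
noncomputable def arcLength (A : Fin 4 → E4) (w : ZMod n → Fin 4 → ℝ) (m : ℕ) : ℝ :=
  ∑ j ∈ Finset.range m, arccos (arcCos A w j)

/-- A linear functional restricted to a great circle is a cos s + b sin s; the induction is the
addition formulas. -/
theorem devValue_eq (hA : IsRegularFrame A c) (h : IsGeodesicWeights A c F w) (φ : Fin 4 → ℝ)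
    (m : ℕ) :
    devValue c F w φ m = devValue c F w φ 0 * cos (arcLength A w m) +
        devSlope A c F w φ 0 * sin (arcLength A w m) ∧
      devSlope A c F w φ m = -devValue c F w φ 0 * sin (arcLength A w m) +
        devSlope A c F w φ 0 * cos (arcLength A w m) := by
  induction m with
  | zero => simp [arcLength]
  | succ m ih =>
    obtain ⟨i1, i2⟩ := ih
    have hp := h.one_sub_arcCos_sq_pos hA m
    have hs := Real.sqrt_pos.2 hp
    have hq := Real.sq_sqrt hp.le
    have b1 : -1 ≤ arcCos A w m := by nlinarith
    have b2 : arcCos A w m ≤ 1 := by nlinarith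
    have e1 : devValue c F w φ (m + 1) = arcCos A w m * devValue c F w φ m +
        √(1 - arcCos A w m ^ 2) * devSlope A c F w φ m := by
      rw [devSlope]; field_simp; ring
    have e2 : devSlope A c F w φ (m + 1) = -√(1 - arcCos A w m ^ 2) * devValue c F w φ m +
        arcCos A w m * devSlope A c F w φ m := by
      rw [h.devSlope_succ hA, ← neg_div, div_eq_iff hs.ne', e1]
      linear_combination devValue c F w φ m * hq
    have e3 : arcLength A w (m + 1) = arcLength A w m + arccos (arcCos A w m) := by
      simp [arcLength, Finset.sum_range_succ]
    rw [e1, e2, e3, cos_add, sin_add, Real.cos_arccos b1 b2, Real.sin_arccos, i1, i2]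
    constructor <;> ring

theorem arcLength_pos (hA : IsRegularFrame A c) (h : IsGeodesicWeights A c F w) {m : ℕ}
    (hm : 0 < m) : 0 < arcLength A w m := by
  refine Finset.sum_pos (fun j _ => Real.arccos_pos.2 ?_) (by simpa using hm.ne')
  nlinarith [h.one_sub_arcCos_sq_pos hA j]

theorem arcLength_le (hA : IsRegularFrame A c) (h : IsGeodesicWeights A c F w) (m : ℕ) :
    arcLength A w m ≤ m * arccos c := by
  refine (Finset.sum_le_card_nsmul _ _ (arccos c) fun j _ => ?_).trans_eq (by simp)
  exact Real.antitone_arccos (h.le_arcCos hA j)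

/-- A functional that is multiplied by a number when it is developed along a short closed geodesic
vanishes on the geodesic. -/
theorem devValue_eq_zero (hA : IsRegularFrame A c) (h : IsGeodesicWeights A c F w) (hn : 0 < n)
    (hc : n * arccos c < π) {φ : Fin 4 → ℝ} {lam : ℝ} (hφ : develop c F φ n = lam • φ) :
    devValue c F w φ 0 = 0 := by
  obtain ⟨e1, e2⟩ := h.devValue_eq hA φ n
  have hs : 0 < sin (arcLength A w n) :=
    Real.sin_pos_of_pos_of_lt_pi (h.arcLength_pos hA hn) ((h.arcLength_le hA n).trans_lt hc)
  have f1 : devValue c F w φ n = lam * devValue c F w φ 0 := by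
    simp [devValue, hφ, develop]
  have f2 : devValue c F w φ (n + 1) = lam * devValue c F w φ 1 := by
    have := h.devValue_succ φ 0
    rw [zero_add] at this
    rw [h.devValue_succ, this, hφ]
    simp [develop]
  have f3 : devSlope A c F w φ n = lam * devSlope A c F w φ 0 := by
    rw [devSlope, f1, f2, devSlope]
    simp
    ring
  rw [f1] at e1
  rw [f3] at e2
  -- A rotation by an angle in (0, π) has no real eigenvector.
  have : sin (arcLength A w n) * (devValue c F w φ 0 ^ 2 + devSlope A c F w φ 0 ^ 2) = 0 := by
    linear_combination devValue c F w φ 0 * e2 - devSlope A c F w φ 0 * e1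
  have h0 := (mul_eq_zero.1 this).resolve_left hs.ne'
  nlinarith [sq_nonneg (devValue c F w φ 0), sq_nonneg (devSlope A c F w φ 0)]

/-- If the developed functional vanishes on the first arc, then it vanishes on the geodesic. -/
theorem devValue_eq_zero_of_zero (hA : IsRegularFrame A c) (h : IsGeodesicWeights A c F w)
    {φ : Fin 4 → ℝ} (h0 : devValue c F w φ 0 = 0) (h1 : devValue c F w φ 1 = 0) (m : ℕ) :
    devValue c F w φ m = 0 := by
  rw [(h.devValue_eq hA φ m).1, devSlope, h0, zero_add, h1]
  simp

/-! ### A short closed geodesic is determined by its sequence of faces. -/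

theorem exists_fourth {f g k : Fin 4} (h1 : f ≠ g) (h2 : f ≠ k) (h3 : g ≠ k) :
    ∃ l, IsCommonEdge f g k l := by
  revert f g k; unfold IsCommonEdge; decide

theorem develop_face (φ : Fin 4 → ℝ) (m : ℕ) : develop c F φ (m + 1) (F (m + 1 : ℕ)) = 0 := by
  simp [develop, unfoldStep]

/-- The functional φ cutting out the great circle of `y` still vanishes on the first arc of `y`
after one turn, so it has only been multiplied by a number. Then `devValue_eq_zero`, applied to `w`,
puts `w 0` on the zero set of φ, which meets the edge in one point. -/
theorem eq_zero_first (hA : IsRegularFrame A c) {y : ZMod n → Fin 4 → ℝ}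
    (h : IsGeodesicWeights A c F w) (h' : IsGeodesicWeights A c F y) (hn : 0 < n)
    (hc : n * arccos c < π) : w 0 = y 0 := by
  have n1 := h.face_ne 0
  have n2 := h.face_ne 1
  have n3 := h.edge_ne 0
  simp only [zero_add, zero_sub, sub_self] at n1 n2 n3
  obtain ⟨k, hk⟩ := exists_fourth n1 n3 n2
  obtain ⟨-, k1, k2, k3, k4, k5⟩ := id hk
  have p0 := h'.weight_pos 0 (F 1) (by simpa using n3.symm) n2.symm
  have p0k := h'.weight_pos 0 k (by simpa using k4) k5
  have p1 := h'.weight_pos 1 (F (-1)) (by simpa using n1) n3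
  have z1 := h'.left 0
  have z2 := h'.right 0
  have z3 := h'.left 1
  have z4 := h'.right 1
  have x1 := h.left 0
  have x2 := h.right 0
  simp only [zero_sub, sub_self] at z1 z2 z3 z4 x1 x2
  have q0 := h.weight_pos 0 (F 1) (by simpa using n3.symm) n2.symm
  -- The edges through the vertices 0 and 1 share the end `k`; the value -1 there is a
  -- normalisation.
  obtain ⟨φ, fk, f1, f2, f3⟩ : ∃ φ : Fin 4 → ℝ, φ k = -1 ∧ φ (F 1) = y 0 k / y 0 (F 1) ∧
      φ (F (-1)) = y 1 k / y 1 (F (-1)) ∧ φ (F 0) = 0 := by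
    refine ⟨fun v => if v = k then -1 else if v = F 1 then y 0 k / y 0 (F 1) else
      if v = F (-1) then y 1 k / y 1 (F (-1)) else 0, ?_, ?_, ?_, ?_⟩
    · simp
    · simp [k1]
    · simp [k4.symm, n3]
    · simp [k5.symm, n2, n1.symm]
  have d0 : devValue c F y φ 0 = 0 := by
    simp only [devValue, develop, dotProduct, Nat.cast_zero]
    rw [sum_fin_four hk, fk, f1, f2, f3, z1, z2]
    field_simp
    ring
  have d1 : devValue c F y φ 1 = 0 := by
    have := h'.devValue_succ φ 0
    simp only [Nat.cast_zero, zero_add] at this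
    rw [this]
    simp only [develop, dotProduct]
    rw [sum_fin_four hk, fk, f1, f2, f3, z3, z4]
    field_simp
    ring
  have dn : devValue c F y φ n = 0 := h'.devValue_eq_zero_of_zero hA d0 d1 n
  have dn1 : devValue c F y φ (n + 1) = 0 := h'.devValue_eq_zero_of_zero hA d0 d1 (n + 1)
  have dz : develop c F φ n (F 0) = 0 := by
    obtain ⟨m, rfl⟩ := Nat.exists_eq_succ_of_ne_zero hn.ne'
    have := develop_face (c := c) (F := F) φ m
    rwa [ZMod.natCast_self] at this
  have hφ : develop c F φ n = (-develop c F φ n k) • φ := by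
    rw [h'.devValue_succ] at dn1
    rw [devValue] at dn
    simp only [dotProduct, ZMod.natCast_self, zero_add] at dn dn1
    rw [sum_fin_four hk, z1, z2] at dn
    rw [sum_fin_four hk, z3, z4] at dn1
    funext v
    rcases forall_fin_four hk v with rfl | rfl | rfl | rfl
    · rw [Pi.smul_apply, f1, smul_eq_mul]
      field_simp
      linear_combination dn
    · rw [Pi.smul_apply, fk]; simp
    · rw [Pi.smul_apply, f2, smul_eq_mul]
      field_simp
      linear_combination dn1
    · rw [Pi.smul_apply, f3, dz]; simp
  have e := h.devValue_eq_zero hA hn hc hφ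
  simp only [devValue, develop, dotProduct, Nat.cast_zero] at e
  rw [sum_fin_four hk, fk, f1, f2, f3, x1, x2] at e
  have e' : w 0 k = w 0 (F 1) * (y 0 k / y 0 (F 1)) := by linear_combination -e
  have prop : w 0 = (w 0 (F 1) / y 0 (F 1)) • y 0 := by
    funext v
    rcases forall_fin_four hk v with rfl | rfl | rfl | rfl
    · rw [Pi.smul_apply, smul_eq_mul]; field_simp
    · rw [Pi.smul_apply, smul_eq_mul, e']; ring
    · rw [Pi.smul_apply, x1, z1]; simp
    · rw [Pi.smul_apply, x2, z2]; simp
  have hN := h.norm 0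
  rw [prop, comb_smul, norm_smul, h'.norm 0, mul_one, Real.norm_of_nonneg (by positivity)] at hN
  rw [prop, hN, one_smul]

theorem shift (h : IsGeodesicWeights A c F w) (j : ZMod n) :
    IsGeodesicWeights A c (fun i => F (i + j)) (fun i => w (i + j)) where
  face_ne i := by simpa [sub_add_eq_add_sub] using h.face_ne (i + j)
  edge_ne i := by simpa [sub_add_eq_add_sub, add_right_comm] using h.edge_ne (i + j)
  left i := by simpa [sub_add_eq_add_sub] using h.left (i + j)
  right i := h.right (i + j)
  weight_pos i v := by simpa [sub_add_eq_add_sub] using h.weight_pos (i + j) v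
  norm i := h.norm (i + j)
  balanced i k l := by
    simpa [sub_add_eq_add_sub, add_right_comm] using h.balanced (i + j) k l

/-- Two short closed geodesics that cross the same faces in the same order coincide. -/
theorem eq_of_faces_eq (hA : IsRegularFrame A c) {y : ZMod n → Fin 4 → ℝ}
    (h : IsGeodesicWeights A c F w) (h' : IsGeodesicWeights A c F y) (hn : 0 < n)
    (hc : n * arccos c < π) : w = y := by
  funext i
  simpa using eq_zero_first hA (h.shift i) (h'.shift i) hn hc

end IsGeodesicWeights

end SphericalTetrahedron

/-! ### Simple closed geodesics and the order of their points on an edge -/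

namespace SphericalTetrahedron

open Real InnerProductGeometry

/-- The weights of the vertices of a closed geodesic without self-intersections. -/
structure IsSimpleWeights (A : Fin 4 → E4) (c : ℝ) {n : ℕ} (F : ZMod n → Fin 4)
    (w : ZMod n → Fin 4 → ℝ) : Prop extends IsGeodesicWeights A c F w where
  injective : Function.Injective w
  noncrossing : ∀ i j, i ≠ j → ∀ s t s' t' : ℝ, 0 < s → 0 < t → 0 < s' → 0 < t' →
    s • w i + t • w (i + 1) ≠ s' • w j + t' • w (j + 1)

/-- The other end of the arc on the face `g` that starts at the vertex `i`. -/
def partner {n : ℕ} (F : ZMod n → Fin 4) (g : Fin 4) (i : ZMod n) : ZMod n :=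
  if F i = g then i + 1 else i - 1

/-- The position of the vertex `i` on the edge `k l`, measured from `k`. -/
noncomputable def edgeRatio {n : ℕ} (w : ZMod n → Fin 4 → ℝ) (k l : Fin 4) (i : ZMod n) : ℝ :=
  w i l / w i k

open Classical in
/-- The vertices on the edge `k l`. -/
noncomputable def edgePoints {n : ℕ} [NeZero n] (w : ZMod n → Fin 4 → ℝ) (k l : Fin 4) :
    Finset (ZMod n) := {i | 0 < w i k ∧ 0 < w i l}

open Classical in
/-- The number of vertices on the edge `k l` between `k` and the vertex `i`. -/
noncomputable def edgeIndex {n : ℕ} [NeZero n] (w : ZMod n → Fin 4 → ℝ) (k l : Fin 4)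
    (i : ZMod n) : ℕ :=
  ((edgePoints w k l).filter fun j => edgeRatio w k l j < edgeRatio w k l i).card

open Classical in
/-- The vertices on the edge `k h` from which an arc on the face `g` goes around the corner `k` to
the edge `k f`. -/
noncomputable def cornerPoints {n : ℕ} [NeZero n] (F : ZMod n → Fin 4) (w : ZMod n → Fin 4 → ℝ)
    (g k h f : Fin 4) : Finset (ZMod n) :=
  (edgePoints w k h).filter fun j => partner F g j ∈ edgePoints w k f

theorem _root_.IsCommonEdge.swap_faces {f g k l : Fin 4} (h : IsCommonEdge f g k l) :
    IsCommonEdge g f k l :=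
  ⟨h.1.symm, h.2.1, h.2.2.2.1, h.2.2.1, h.2.2.2.2.2, h.2.2.2.2.1⟩

theorem _root_.IsCommonEdge.swap_ends {f g k l : Fin 4} (h : IsCommonEdge f g k l) :
    IsCommonEdge f g l k :=
  ⟨h.1, h.2.1.symm, h.2.2.2.2.1, h.2.2.2.2.2, h.2.2.1, h.2.2.2.1⟩

/-- Passes from the edge `k l` of the face `g` to the edge `k f` of the same face. -/
theorem _root_.IsCommonEdge.rotate {f g k l : Fin 4} (h : IsCommonEdge f g k l) :
    IsCommonEdge l g k f :=
  ⟨h.2.2.2.2.2, h.2.2.1, h.2.1, h.2.2.2.1, h.2.2.2.2.1.symm, h.1⟩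

theorem faces_of_notMem {f g k l a b : Fin 4} (h : IsCommonEdge f g k l) (hab : a ≠ b)
    (ka : k ≠ a) (kb : k ≠ b) (la : l ≠ a) (lb : l ≠ b) : a = f ∧ b = g ∨ a = g ∧ b = f := by
  revert f g k l a b; unfold IsCommonEdge; decide

variable {A : Fin 4 → E4} {c : ℝ} {n : ℕ} {F : ZMod n → Fin 4} {w : ZMod n → Fin 4 → ℝ}

namespace IsGeodesicWeights

theorem ne_faces (h : IsGeodesicWeights A c F w) {i : ZMod n} {v : Fin 4} (hv : 0 < w i v) :
    v ≠ F (i - 1) ∧ v ≠ F i :=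
  ⟨by rintro rfl; exact hv.ne' (h.left i), by rintro rfl; exact hv.ne' (h.right i)⟩

variable [NeZero n]

theorem edgePoints_comm (w : ZMod n → Fin 4 → ℝ) (k l : Fin 4) :
    edgePoints w k l = edgePoints w l k := by
  ext i; simp [edgePoints, and_comm]

theorem mem_edgePoints {k l : Fin 4} {i : ZMod n} :
    i ∈ edgePoints w k l ↔ 0 < w i k ∧ 0 < w i l := by simp [edgePoints]

theorem faces (h : IsGeodesicWeights A c F w) {f g k l : Fin 4} (hkl : IsCommonEdge f g k l)
    {i : ZMod n} (hi : i ∈ edgePoints w k l) :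
    F (i - 1) = f ∧ F i = g ∨ F (i - 1) = g ∧ F i = f := by
  rw [mem_edgePoints] at hi
  exact faces_of_notMem hkl (h.face_ne i) (h.ne_faces hi.1).1 (h.ne_faces hi.1).2
    (h.ne_faces hi.2).1 (h.ne_faces hi.2).2

theorem mem_of_faces (h : IsGeodesicWeights A c F w) {i : ZMod n} {k l : Fin 4}
    (hkl : IsCommonEdge (F (i - 1)) (F i) k l) : i ∈ edgePoints w k l :=
  mem_edgePoints.2 ⟨h.weight_pos i k hkl.2.2.1 hkl.2.2.2.1,
    h.weight_pos i l hkl.2.2.2.2.1 hkl.2.2.2.2.2⟩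

theorem zero_of_mem (h : IsGeodesicWeights A c F w) {f g k l : Fin 4} (hkl : IsCommonEdge f g k l)
    {i : ZMod n} (hi : i ∈ edgePoints w k l) : w i f = 0 ∧ w i g = 0 := by
  have h1 := h.left i
  have h2 := h.right i
  rcases h.faces hkl hi with ⟨e1, e2⟩ | ⟨e1, e2⟩ <;> rw [e1] at h1 <;> rw [e2] at h2
  · exact ⟨h1, h2⟩
  · exact ⟨h2, h1⟩

/-- By `edge_ne` an arc never returns to the edge from which it starts, so it ends on one of the two
other edges of the face. -/
theorem partner_spec (h : IsGeodesicWeights A c F w) {f g k l : Fin 4}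
    (hkl : IsCommonEdge f g k l) {i : ZMod n} (hi : i ∈ edgePoints w k l) :
    partner F g (partner F g i) = i ∧
      (partner F g i ∈ edgePoints w k f ∨ partner F g i ∈ edgePoints w l f) := by
  rcases h.faces hkl hi with ⟨e1, e2⟩ | ⟨e1, e2⟩
  · have hp : partner F g i = i + 1 := by simp [partner, e2]
    have f1 := h.face_ne (i + 1)
    have f2 := h.edge_ne i
    rw [add_sub_cancel_right] at f1
    rw [hp]
    refine ⟨by simp [partner, ← e2, f1.symm], ?_⟩
    rw [e1] at f2
    rw [e2] at f1
    have hf := h.weight_pos (i + 1) f (by simpa [e2] using hkl.1) f2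
    rcases forall_fin_four hkl (F (i + 1)) with e | e | e | e
    · right
      exact mem_edgePoints.2 ⟨h.weight_pos _ _ (by simpa [e2] using hkl.2.2.2.2.2)
        (by simpa [e] using hkl.2.1.symm), hf⟩
    · left
      exact mem_edgePoints.2 ⟨h.weight_pos _ _ (by simpa [e2] using hkl.2.2.2.1)
        (by simpa [e] using hkl.2.1), hf⟩
    · exact absurd e.symm f2
    · exact absurd e.symm f1
  · have hne := h.face_ne i
    have hp : partner F g i = i - 1 := by simp [partner, e2, hkl.1]
    have f1 := h.face_ne (i - 1)
    have f2 := h.edge_ne (i - 1)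
    rw [sub_add_cancel] at f2
    rw [hp]
    refine ⟨by simp [partner, e1], ?_⟩
    rw [e1] at f1
    rw [e2] at f2
    have hf := h.weight_pos (i - 1) f f2.symm (by simpa [e1] using hkl.1)
    rcases forall_fin_four hkl (F (i - 1 - 1)) with e | e | e | e
    · right
      exact mem_edgePoints.2 ⟨h.weight_pos _ _ (by simpa [e] using hkl.2.1.symm)
        (by simpa [e1] using hkl.2.2.2.2.2), hf⟩
    · left
      exact mem_edgePoints.2 ⟨h.weight_pos _ _ (by simpa [e] using hkl.2.1)
        (by simpa [e1] using hkl.2.2.2.1), hf⟩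
    · exact absurd e f2
    · exact absurd e f1

end IsGeodesicWeights

namespace IsSimpleWeights

open IsGeodesicWeights

/-- Frees `noncrossing` from the direction in which the arcs on a face are passed. -/
theorem noncrossing_partner (h : IsSimpleWeights A c F w) {g : Fin 4} {i j : ZMod n}
    (hij : i ≠ j) (hij' : partner F g i ≠ j) {s t s' t' : ℝ} (hs : 0 < s) (ht : 0 < t) (hs' : 0 < s')
    (ht' : 0 < t') :
    s • w i + t • w (partner F g i) ≠ s' • w j + t' • w (partner F g j) := by
  unfold partner at hij' ⊢
  by_cases h1 : F i = g <;> by_cases h2 : F j = g <;> simp only [h1, h2, if_true, if_false] at hij' ⊢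
  · exact h.noncrossing i j hij s t s' t' hs ht hs' ht'
  · have := h.noncrossing i (j - 1) (fun e => hij' (by rw [e]; ring)) s t t' s' hs ht ht' hs'
    rwa [sub_add_cancel, add_comm (t' • _)] at this
  · have := h.noncrossing (i - 1) j hij' t s s' t' ht hs hs' ht'
    rwa [sub_add_cancel, add_comm (t • _)] at this
  · have := h.noncrossing (i - 1) (j - 1) (fun e => hij (sub_left_injective e)) t s t' s' ht hs ht' hs'
    rwa [sub_add_cancel, sub_add_cancel, add_comm (t • _), add_comm (t' • _)] at this

variable [NeZero n]

theorem eq_of_edgeRatio_eq (h : IsSimpleWeights A c F w) {f g k l : Fin 4}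
    (hkl : IsCommonEdge f g k l) {i j : ZMod n} (hi : i ∈ edgePoints w k l)
    (hj : j ∈ edgePoints w k l) (e : edgeRatio w k l i = edgeRatio w k l j) : i = j := by
  obtain ⟨i1, i2⟩ := h.zero_of_mem hkl hi
  obtain ⟨j1, j2⟩ := h.zero_of_mem hkl hj
  obtain ⟨i3, i4⟩ := mem_edgePoints.1 hi
  obtain ⟨j3, j4⟩ := mem_edgePoints.1 hj
  have e' : w i l = w j l / w j k * w i k := by
    rw [edgeRatio, edgeRatio, div_eq_iff i3.ne'] at e
    exact e
  have prop : w i = (w i k / w j k) • w j := by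
    funext v
    rcases forall_fin_four hkl v with rfl | rfl | rfl | rfl
    · rw [Pi.smul_apply, smul_eq_mul]; field_simp
    · rw [Pi.smul_apply, smul_eq_mul, e']; ring
    · rw [Pi.smul_apply, i1, j1]; simp
    · rw [Pi.smul_apply, i2, j2]; simp
  have hN := h.norm i
  rw [prop, comb_smul, norm_smul, h.norm j, mul_one, Real.norm_of_nonneg (by positivity)] at hN
  rw [hN, one_smul] at prop
  exact h.injective prop

/-- The arcs around a corner are nested. -/
theorem partner_lt (h : IsSimpleWeights A c F w) {f g k l : Fin 4}
    (hkl : IsCommonEdge f g k l) {i j : ZMod n} (hi : i ∈ edgePoints w k l)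
    (hi' : partner F g i ∈ edgePoints w k f) (hj : j ∈ edgePoints w k l)
    (hji : edgeRatio w k l j < edgeRatio w k l i) :
    partner F g j ∈ edgePoints w k f ∧
      edgeRatio w k f (partner F g j) < edgeRatio w k f (partner F g i) := by
  have hne : i ≠ j := by rintro rfl; exact hji.false
  obtain ⟨pi, -⟩ := h.partner_spec hkl hi
  obtain ⟨pj, hj'⟩ := h.partner_spec hkl hj
  have hne' : partner F g i ≠ j := by
    rintro rfl
    exact (mem_edgePoints.1 hj).2.ne' (h.zero_of_mem hkl.rotate hi').1
  have nc := fun s t s' t' hs ht hs' ht' => h.noncrossing_partner hne hne'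
    (s := s) (t := t) (s' := s') (t' := t') hs ht hs' ht'
  obtain ⟨zi1, zi2⟩ := h.zero_of_mem hkl hi
  obtain ⟨zj1, zj2⟩ := h.zero_of_mem hkl hj
  obtain ⟨zi3, zi4⟩ := h.zero_of_mem hkl.rotate hi'
  obtain ⟨pi1, pi2⟩ := mem_edgePoints.1 hi
  obtain ⟨pj1, pj2⟩ := mem_edgePoints.1 hj
  obtain ⟨pi3, pi4⟩ := mem_edgePoints.1 hi'
  have hlt : 0 < w i l * w j k - w j l * w i k := by
    rw [edgeRatio, edgeRatio, div_lt_div_iff₀ pj1 pi1] at hji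
    exact sub_pos.2 hji
  rcases hj' with hj' | hj'
  · refine ⟨hj', ?_⟩
    obtain ⟨zj3, zj4⟩ := h.zero_of_mem hkl.rotate hj'
    obtain ⟨pj3, pj4⟩ := mem_edgePoints.1 hj'
    by_contra hcon
    rcases (not_lt.1 hcon).lt_or_eq with hlt' | heq
    · rw [edgeRatio, edgeRatio, div_lt_div_iff₀ pi3 pj3] at hlt'
      have hpos := sub_pos.2 hlt'
      set a := w (partner F g i)
      set b := w (partner F g j)
      -- With the opposite order on `k f` the arcs would cross; `τ` comes from equating the
      -- coordinates at `k` of the common point.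
      set τ := (w i l * w j k - w j l * w i k) / (b f * a k - a f * b k) with hτ
      have hτ0 : 0 < τ := by positivity
      refine nc (w j l) (b f * τ) (w i l) (a f * τ) pj2 (by positivity) pi2 (by positivity) ?_
      have key : τ * (b f * a k - a f * b k) = w i l * w j k - w j l * w i k := by
        rw [hτ]; field_simp
      funext v
      simp only [Pi.add_apply, Pi.smul_apply, smul_eq_mul]
      rcases forall_fin_four hkl v with rfl | rfl | rfl | rfl
      · linear_combination key
      · rw [zi3, zj3]; ring
      · rw [zi1, zj1]; ring
      · rw [zi2, zj2, zi4, zj4]; ring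
    · have := h.eq_of_edgeRatio_eq hkl.rotate hi' hj' heq
      rw [← pi, this, pj] at hne
      exact hne rfl
  · exfalso
    have hr : IsCommonEdge k g l f := hkl.swap_ends.rotate
    obtain ⟨zj3, zj4⟩ := h.zero_of_mem hr hj'
    obtain ⟨pj3, pj4⟩ := mem_edgePoints.1 hj'
    set a := w (partner F g i)
    set b := w (partner F g j)
    -- The point `j` is nearer to `k` than `i`, but its arc ends on the edge `l f`, so it would
    -- cross the arc of `i`. The weights of the crossing solve the equations at `k` and `l`.
    set s := (b f * a k * w j l + a f * b l * w j k) / (w i l * w j k - w j l * w i k) with hs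
    have hs0 : 0 < s := by positivity
    have key : s * (w i l * w j k - w j l * w i k) = b f * a k * w j l + a f * b l * w j k := by
      rw [hs]; exact div_mul_cancel₀ _ hlt.ne'
    refine nc s (b f) ((s * w i k + b f * a k) / w j k) (a f) hs0 pj4 (by positivity) pi4 ?_
    funext v
    simp only [Pi.add_apply, Pi.smul_apply, smul_eq_mul]
    rcases forall_fin_four hkl v with rfl | rfl | rfl | rfl
    · rw [zj3]; field_simp; ring
    · rw [zi3]; field_simp; linear_combination key
    · rw [zi1, zj1]; ring
    · rw [zi2, zj2, zi4, zj4]; ring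

/-- By nesting, `partner` matches the points nearer to the corner on the two edges. -/
theorem edgeIndex_partner (h : IsSimpleWeights A c F w) {f g k l : Fin 4}
    (hkl : IsCommonEdge f g k l) {i : ZMod n} (hi : i ∈ edgePoints w k l)
    (hi' : partner F g i ∈ edgePoints w k f) :
    edgeIndex w k f (partner F g i) = edgeIndex w k l i := by
  have pi := (h.partner_spec hkl hi).1
  refine Finset.card_nbij' (partner F g) (partner F g) ?_ ?_ ?_ ?_
  · intro j hj
    simp only [Finset.coe_filter, Set.mem_ofPred_eq] at hj ⊢
    have := h.partner_lt hkl.rotate hi' (by rwa [pi]) hj.1 hj.2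
    rwa [pi] at this
  · intro j hj
    simp only [Finset.coe_filter, Set.mem_ofPred_eq] at hj ⊢
    exact h.partner_lt hkl hi hi' hj.1 hj.2
  · intro j hj
    simp only [Finset.coe_filter, Set.mem_ofPred_eq] at hj
    exact (h.partner_spec hkl.rotate hj.1).1
  · intro j hj
    simp only [Finset.coe_filter, Set.mem_ofPred_eq] at hj
    exact (h.partner_spec hkl hj.1).1

theorem card_cornerPoints_comm (h : IsSimpleWeights A c F w) {f g k l : Fin 4}
    (hkl : IsCommonEdge f g k l) :
    (cornerPoints F w g k l f).card = (cornerPoints F w g k f l).card := by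
  refine Finset.card_nbij' (partner F g) (partner F g) ?_ ?_ ?_ ?_
  · intro j hj
    simp only [cornerPoints, Finset.coe_filter, Set.mem_ofPred_eq] at hj ⊢
    exact ⟨hj.2, by rw [(h.partner_spec hkl hj.1).1]; exact hj.1⟩
  · intro j hj
    simp only [cornerPoints, Finset.coe_filter, Set.mem_ofPred_eq] at hj ⊢
    exact ⟨hj.2, by rw [(h.partner_spec hkl.rotate hj.1).1]; exact hj.1⟩
  · intro j hj
    simp only [cornerPoints, Finset.coe_filter, Set.mem_ofPred_eq] at hj
    exact (h.partner_spec hkl hj.1).1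
  · intro j hj
    simp only [cornerPoints, Finset.coe_filter, Set.mem_ofPred_eq] at hj
    exact (h.partner_spec hkl.rotate hj.1).1

/-- Every arc on `g` from this edge goes around exactly one of its ends. -/
theorem card_edgePoints (h : IsSimpleWeights A c F w) {f g k l : Fin 4}
    (hkl : IsCommonEdge f g k l) :
    (edgePoints w k l).card = (cornerPoints F w g k l f).card + (cornerPoints F w g l k f).card := by
  classical
  rw [cornerPoints, cornerPoints, edgePoints_comm w l k,
    ← Finset.card_filter_add_card_filter_not (s := edgePoints w k l)
      (fun j => partner F g j ∈ edgePoints w k f)]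
  congr 2
  apply Finset.filter_congr
  intro j hj
  rcases (h.partner_spec hkl hj).2 with h1 | h1
  · simp only [h1, not_true_eq_false, false_iff]
    intro h2
    exact (mem_edgePoints.1 h2).1.ne' (h.zero_of_mem hkl.rotate h1).1
  · simp only [h1, iff_true]
    intro h2
    exact (mem_edgePoints.1 h2).1.ne' (h.zero_of_mem hkl.swap_ends.rotate h1).1

/-- The three edges of the face give three linear equations for its three corner numbers, as for
normal curves. -/
theorem two_mul_card_cornerPoints (h : IsSimpleWeights A c F w) {f g k l : Fin 4}
    (hkl : IsCommonEdge f g k l) :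
    2 * (cornerPoints F w g k l f).card + (edgePoints w l f).card =
      (edgePoints w k l).card + (edgePoints w k f).card := by
  have h1 := h.card_edgePoints hkl
  have h2 := h.card_edgePoints hkl.rotate
  have h3 := h.card_edgePoints hkl.swap_ends.rotate
  have c1 := h.card_cornerPoints_comm hkl
  have c2 := h.card_cornerPoints_comm hkl.swap_ends
  have c3 := h.card_cornerPoints_comm hkl.rotate.swap_ends
  omega

/-- By nesting, the points whose arcs turn around `k` form an initial segment of the edge. -/
theorem mem_cornerPoints_iff (h : IsSimpleWeights A c F w) {f g k l : Fin 4}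
    (hkl : IsCommonEdge f g k l) {i : ZMod n} (hi : i ∈ edgePoints w k l) :
    partner F g i ∈ edgePoints w k f ↔ edgeIndex w k l i < (cornerPoints F w g k l f).card := by
  constructor
  · intro hi'
    apply Finset.card_lt_card
    rw [Finset.ssubset_iff_of_subset]
    · exact ⟨i, by simp [cornerPoints, hi, hi'], by simp⟩
    · intro j hj
      simp only [cornerPoints, Finset.mem_filter] at hj ⊢
      exact ⟨hj.1, (h.partner_lt hkl hi hi' hj.1 hj.2).1⟩
  · intro hlt
    by_contra hi'
    refine hlt.not_ge (Finset.card_le_card fun j hj => ?_)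
    simp only [cornerPoints, Finset.mem_filter] at hj ⊢
    refine ⟨hj.1, ?_⟩
    by_contra hcon
    rcases (not_lt.1 hcon).lt_or_eq with hlt' | heq
    · exact hi' (h.partner_lt hkl hj.1 hj.2 hi hlt').1
    · exact hi' (h.eq_of_edgeRatio_eq hkl hi hj.1 heq ▸ hj.2)

/-- Reversing the edge inverts the ratios, which are distinct; the summand 1 counts `i` itself. -/
theorem edgeIndex_add (h : IsSimpleWeights A c F w) {f g k l : Fin 4}
    (hkl : IsCommonEdge f g k l) {i : ZMod n} (hi : i ∈ edgePoints w k l) :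
    edgeIndex w k l i + edgeIndex w l k i + 1 = (edgePoints w k l).card := by
  classical
  have e : edgeIndex w l k i =
      ((edgePoints w k l).filter fun j => edgeRatio w k l i < edgeRatio w k l j).card := by
    rw [edgeIndex, edgePoints_comm w l k]
    congr 1
    apply Finset.filter_congr
    intro j hj
    obtain ⟨j1, j2⟩ := mem_edgePoints.1 hj
    obtain ⟨i1, i2⟩ := mem_edgePoints.1 hi
    rw [edgeRatio, edgeRatio, edgeRatio, edgeRatio, div_lt_div_iff₀ j2 i2, div_lt_div_iff₀ i1 j1,
      mul_comm, mul_comm (w i k)]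
  rw [e, edgeIndex, ← Finset.card_filter_add_card_filter_not (s := edgePoints w k l)
      (fun j => edgeRatio w k l j < edgeRatio w k l i), add_assoc]
  congr 1
  have : ((edgePoints w k l).filter fun j => ¬ edgeRatio w k l j < edgeRatio w k l i) =
      insert i ((edgePoints w k l).filter fun j => edgeRatio w k l i < edgeRatio w k l j) := by
    ext j
    simp only [Finset.mem_filter, Finset.mem_insert, not_lt]
    constructor
    · rintro ⟨h1, h2⟩
      rcases h2.lt_or_eq with h3 | h3
      · exact Or.inr ⟨h1, h3⟩
      · exact Or.inl (h.eq_of_edgeRatio_eq hkl hi h1 h3).symm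
    · rintro (rfl | ⟨h1, h2⟩)
      · exact ⟨hi, le_rfl⟩
      · exact ⟨h1, h2.le⟩
  rw [this, Finset.card_insert_of_notMem (by simp)]

/-- The index is injective on the edge and less than the number of points, hence takes all smaller
values. -/
theorem exists_edgeIndex_eq (h : IsSimpleWeights A c F w) {f g k l : Fin 4}
    (hkl : IsCommonEdge f g k l) {m : ℕ} (hm : m < (edgePoints w k l).card) :
    ∃ i ∈ edgePoints w k l, edgeIndex w k l i = m := by
  classical
  have h1 : (edgePoints w k l).image (edgeIndex w k l) ⊆ Finset.range (edgePoints w k l).card := by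
    intro m hm
    obtain ⟨i, hi, rfl⟩ := Finset.mem_image.1 hm
    have := h.edgeIndex_add hkl hi
    exact Finset.mem_range.2 (by omega)
  have hlt : ∀ i ∈ edgePoints w k l, ∀ j, edgeRatio w k l i < edgeRatio w k l j →
      edgeIndex w k l i < edgeIndex w k l j := by
    intro i hi j hij
    apply Finset.card_lt_card
    rw [Finset.ssubset_iff_of_subset]
    · exact ⟨i, by simp [hi, hij], by simp⟩
    · intro m hm
      simp only [Finset.mem_filter] at hm ⊢
      exact ⟨hm.1, hm.2.trans hij⟩
  have h2 : ((edgePoints w k l).image (edgeIndex w k l)).card = (edgePoints w k l).card := by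
    apply Finset.card_image_of_injOn
    intro i hi j hj hij
    by_contra hne
    rcases lt_trichotomy (edgeRatio w k l i) (edgeRatio w k l j) with h3 | h3 | h3
    · exact (hlt i hi j h3).ne hij
    · exact hne (h.eq_of_edgeRatio_eq hkl hi hj h3)
    · exact (hlt j hj i h3).ne' hij
  have h3 := Finset.eq_of_subset_of_card_le h1 (by simp [h2])
  have h4 : m ∈ (edgePoints w k l).image (edgeIndex w k l) := by
    rw [h3]; exact Finset.mem_range.2 hm
  simpa using h4

end IsSimpleWeights

end SphericalTetrahedron

/-! ### The numbers of points on the edges determine a simple closed geodesic combinatorially -/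

namespace SphericalTetrahedron

open Real InnerProductGeometry

variable {A : Fin 4 → E4} {c : ℝ} {n : ℕ} {F : ZMod n → Fin 4} {w : ZMod n → Fin 4 → ℝ}

theorem _root_.IsCommonEdge.flip {f g k l : Fin 4} (h : IsCommonEdge f g k l) :
    IsCommonEdge k l f g :=
  ⟨h.2.1, h.1, h.2.2.1.symm, h.2.2.2.2.1.symm, h.2.2.2.1.symm, h.2.2.2.2.2.symm⟩

theorem greatArc_comm (x y : E4) : greatArc x y = greatArc y x := by
  ext z
  constructor <;> rintro ⟨h, s, t, hs, ht, rfl⟩ <;> exact ⟨h, t, s, ht, hs, add_comm _ _⟩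

theorem left_mem_greatArc {x : E4} (hx : ‖x‖ = 1) (y : E4) : x ∈ greatArc x y :=
  ⟨hx, 1, 0, zero_le_one, le_rfl, by simp⟩

/-- The closed curve with given weights of the vertices. -/
def trace (A : Fin 4 → E4) (w : ZMod n → Fin 4 → ℝ) : Set E4 :=
  ⋃ i, greatArc (comb A (w i)) (comb A (w (i + 1)))

theorem smul_comb_mem_greatArc {A : Fin 4 → E4} {x y : Fin 4 → ℝ} {s t : ℝ} (hs : 0 ≤ s)
    (ht : 0 ≤ t) (h : comb A (s • x + t • y) ≠ 0) :
    ‖comb A (s • x + t • y)‖⁻¹ • comb A (s • x + t • y) ∈ greatArc (comb A x) (comb A y) := by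
  refine ⟨by rw [norm_smul, norm_inv, norm_norm, inv_mul_cancel₀ (norm_ne_zero_iff.2 h)],
    ‖comb A (s • x + t • y)‖⁻¹ * s, ‖comb A (s • x + t • y)‖⁻¹ * t, by positivity, by positivity, ?_⟩
  rw [comb_add, comb_smul, comb_smul, smul_add, smul_smul, smul_smul]

/-- A half-open arc contains its first vertex and its interior, so disjointness yields both
injectivity and absence of crossings. -/
theorem IsRegularFrame.exists_simpleWeights (hA : IsRegularFrame A c) {γ : Set E4}
    (h : IsSimpleClosedGeodesic A γ) :
    ∃ (n : ℕ) (F : ZMod n → Fin 4) (w : ZMod n → Fin 4 → ℝ), 0 < n ∧ IsSimpleWeights A c F w ∧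
      γ = trace A w := by
  obtain ⟨n, X, F, hn, hX, hd, rfl⟩ := h
  obtain ⟨w, hw, hXw⟩ := hA.exists_weights hX
  simp only [← hXw] at hd
  refine ⟨n, F, w, hn, ⟨hw, ?_, ?_⟩, by simp only [trace, hXw]⟩
  · intro i j hij
    by_contra hne
    have key : ∀ i, comb A (w i) ∈ greatArc (comb A (w i)) (comb A (w (i + 1))) \
        {comb A (w (i + 1))} := by
      intro i
      refine ⟨left_mem_greatArc (hw.norm i) _, fun e => ?_⟩
      have e1 := hA.comb_injective (Set.mem_singleton_iff.1 e)
      exact (hw.next_pos i).ne' (by rw [← e1, hw.left])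
    exact Set.disjoint_left.1 (hd i j hne) (key i) (by rw [hij]; exact key j)
  · intro i j hij s t s' t' hs ht hs' ht' e
    have key : ∀ i (s t : ℝ), 0 < s → 0 < t → ‖comb A (s • w i + t • w (i + 1))‖⁻¹ •
        comb A (s • w i + t • w (i + 1)) ∈ greatArc (comb A (w i)) (comb A (w (i + 1))) \
        {comb A (w (i + 1))} := by
      intro i s t hs ht
      -- The weight at `F (i + 1)` separates the interior of the arc from its last point, where this
      -- weight is zero.
      have hp : 0 < (s • w i + t • w (i + 1)) (F (i + 1)) := by
        have := hw.weight_pos i (F (i + 1)) (hw.edge_ne i).symm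
          (by have := hw.face_ne (i + 1); rw [add_sub_cancel_right] at this; exact this.symm)
        simp only [Pi.add_apply, Pi.smul_apply, smul_eq_mul, hw.right, mul_zero, add_zero]
        positivity
      have h0 : comb A (s • w i + t • w (i + 1)) ≠ 0 := by
        intro h0
        have : comb A (s • w i + t • w (i + 1)) = comb A 0 := by rw [h0]; simp [comb]
        rw [hA.comb_injective this] at hp
        exact hp.false
      refine ⟨smul_comb_mem_greatArc hs.le ht.le h0, fun e => ?_⟩
      rw [Set.mem_singleton_iff, ← comb_smul] at e
      have e1 := congrFun (hA.comb_injective e) (F (i + 1))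
      rw [hw.right, Pi.smul_apply, smul_eq_mul] at e1
      exact (mul_pos (inv_pos.2 (norm_pos_iff.2 h0)) hp).ne' e1
    exact Set.disjoint_left.1 (hd i j hij) (key i s t hs ht) (by rw [e]; exact key j s' t' hs' ht')

theorem trace_shift (A : Fin 4 → E4) (w : ZMod n → Fin 4 → ℝ) (j : ZMod n) :
    trace A (fun i => w (i + j)) = trace A w :=
  Equiv.iSup_congr (Equiv.addRight j) fun i => by
    simp [add_right_comm]

theorem trace_neg (A : Fin 4 → E4) (w : ZMod n → Fin 4 → ℝ) :
    trace A (fun i => w (-i)) = trace A w :=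
  Equiv.iSup_congr ((Equiv.neg (ZMod n)).trans (Equiv.subRight 1)) fun i => by rw [greatArc_comm]; simp [sub_eq_add_neg, add_comm]

namespace IsSimpleWeights

open IsGeodesicWeights

/-- In the reversed order the arc from `-i` runs to `-i - 1`, hence lies on the face `F (-i - 1)`.
-/
theorem neg (h : IsSimpleWeights A c F w) :
    IsSimpleWeights A c (fun i => F (-i - 1)) (fun i => w (-i)) where
  face_ne i := by simpa [add_comm, sub_eq_add_neg] using (h.face_ne (-i)).symm
  edge_ne i := by
    have := (h.edge_ne (-i - 1)).symm
    rw [show -i - 1 + 1 = -i by ring] at this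
    convert this using 2 <;> ring_nf
  left i := by simpa [add_comm, sub_eq_add_neg] using h.right (-i)
  right i := h.left (-i)
  weight_pos i v h1 h2 := h.weight_pos (-i) v h2 (by convert h1 using 2; ring)
  norm i := h.norm (-i)
  balanced i k l hkl := by
    have e1 : -(i - 1) - 1 = -i := by ring
    rw [e1] at hkl ⊢
    have := h.balanced (-i) k l hkl.swap_faces
    have e2 : -(i - 1) = -i + 1 := by ring
    have e3 : -(i + 1) = -i - 1 := by ring
    unfold IsRegularFrame.Balanced at this ⊢
    rw [e2, e3]
    linear_combination this
  injective i j hij := neg_injective (h.injective hij)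
  noncrossing i j hij s t s' t' hs ht hs' ht' e := by
    refine h.noncrossing (-i - 1) (-j - 1) (fun e => hij (by linear_combination -e)) t s t' s' ht hs
      ht' hs' ?_
    rw [show -i - 1 + 1 = -i by ring, show -j - 1 + 1 = -j by ring]
    rw [show -(i + 1) = -i - 1 by ring, show -(j + 1) = -j - 1 by ring] at e
    rw [add_comm, e, add_comm]

theorem shift (h : IsSimpleWeights A c F w) (j : ZMod n) :
    IsSimpleWeights A c (fun i => F (i + j)) (fun i => w (i + j)) where
  toIsGeodesicWeights := h.toIsGeodesicWeights.shift j
  injective i i' e := add_left_injective j (h.injective e)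
  noncrossing i i' hne s t s' t' hs ht hs' ht' := by
    have := h.noncrossing (i + j) (i' + j) (fun e => hne (add_left_injective j e)) s t s' t' hs ht
      hs' ht'
    simpa only [add_right_comm] using this

variable [NeZero n]

theorem card_edgePoints_equiv (w : ZMod n → Fin 4 → ℝ) (e : ZMod n ≃ ZMod n) (k l : Fin 4) :
    (edgePoints (fun i => w (e i)) k l).card = (edgePoints w k l).card :=
  Finset.card_equiv e fun i => by simp [mem_edgePoints]

theorem edgeIndex_equiv (w : ZMod n → Fin 4 → ℝ) (e : ZMod n ≃ ZMod n) (k l : Fin 4)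
    (i : ZMod n) : edgeIndex (fun i => w (e i)) k l i = edgeIndex w k l (e i) := by
  unfold edgeIndex
  refine Finset.card_equiv e fun i => ?_
  rw [Finset.mem_filter, Finset.mem_filter, mem_edgePoints, mem_edgePoints]
  rfl

variable {F' : ZMod n → Fin 4} {w' : ZMod n → Fin 4 → ℝ}

/-- Two simple closed geodesics with the same numbers of points on the edges go the same way from
corresponding vertices. -/
theorem faces_eq_step (h : IsSimpleWeights A c F w) (h' : IsSimpleWeights A c F' w')
    (hcount : ∀ k l, k ≠ l → (edgePoints w k l).card = (edgePoints w' k l).card) {i : ZMod n}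
    (h1 : F (i - 1) = F' (i - 1)) (h2 : F i = F' i)
    (h3 : ∀ k l, IsCommonEdge (F (i - 1)) (F i) k l → edgeIndex w k l i = edgeIndex w' k l i) :
    F (i + 1) = F' (i + 1) ∧ ∀ k l, IsCommonEdge (F i) (F (i + 1)) k l →
      edgeIndex w k l (i + 1) = edgeIndex w' k l (i + 1) := by
  have f2 : F i ≠ F (i + 1) := by simpa using h.face_ne (i + 1)
  obtain ⟨k, hk⟩ := exists_fourth (h.face_ne i) (h.edge_ne i) f2
  have hk := hk.swap_ends
  have hk' : IsCommonEdge (F' (i - 1)) (F' i) k (F (i + 1)) := by rwa [← h1, ← h2]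
  have mi := h.mem_of_faces hk
  have mi' := h'.mem_of_faces hk'
  have pi : partner F (F i) i = i + 1 := by simp [partner]
  have pi' : partner F' (F i) i = i + 1 := by simp [partner, h2]
  have hn : i + 1 ∈ edgePoints w k (F (i - 1)) := by
    have := h.mem_of_faces (i := i + 1) (k := k) (l := F (i - 1))
    rw [add_sub_cancel_right] at this
    exact this hk.rotate.swap_faces
  -- The edge counts fix the corner number, and the index of `i` decides whether its arc turns
  -- around `k`; both agree for the two geodesics.
  have hn' : i + 1 ∈ edgePoints w' k (F (i - 1)) := by
    have h4 := (h.mem_cornerPoints_iff hk mi).1 (by rwa [pi])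
    have c1 := h.two_mul_card_cornerPoints hk
    have c2 := h'.two_mul_card_cornerPoints hk
    rw [hcount _ _ hk.rotate.swap_ends.rotate.2.1.symm, hcount _ _ hk.2.1,
      hcount _ _ hk.rotate.2.1] at c1
    rw [h3 _ _ hk, show (cornerPoints F w (F i) k (F (i + 1)) (F (i - 1))).card =
      (cornerPoints F' w' (F i) k (F (i + 1)) (F (i - 1))).card by omega] at h4
    have := (h'.mem_cornerPoints_iff hk mi').2 h4
    rwa [pi'] at this
  have key : F (i + 1) = F' (i + 1) := by
    have e1 := h'.faces hk.rotate.swap_faces hn'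
    rw [add_sub_cancel_right, ← h2] at e1
    rcases e1 with e1 | e1
    · exact e1.2.symm
    · exact absurd e1.1 f2
  refine ⟨key, ?_⟩
  have q1 := h.edgeIndex_partner hk mi (by rwa [pi])
  have q2 := h'.edgeIndex_partner hk mi' (by rwa [pi'])
  rw [pi] at q1
  rw [pi'] at q2
  have r1 := h.edgeIndex_add hk.rotate hn
  have r2 := h'.edgeIndex_add hk.rotate hn'
  have r3 := hcount _ _ hk.rotate.2.1
  have r4 := h3 _ _ hk
  intro a b hab
  have : a = k ∧ b = F (i - 1) ∨ a = F (i - 1) ∧ b = k :=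
    faces_of_notMem (f := k) (g := F (i - 1)) (k := F i) (l := F (i + 1))
      hk.rotate.flip.swap_ends hab.2.1 hab.2.2.1.symm hab.2.2.2.2.1.symm
        hab.2.2.2.1.symm hab.2.2.2.2.2.symm
  rcases this with ⟨rfl, rfl⟩ | ⟨rfl, rfl⟩ <;> omega

theorem faces_eq (h : IsSimpleWeights A c F w) (h' : IsSimpleWeights A c F' w')
    (hcount : ∀ k l, k ≠ l → (edgePoints w k l).card = (edgePoints w' k l).card)
    (h1 : F (-1) = F' (-1)) (h2 : F 0 = F' 0)
    (h3 : ∀ k l, IsCommonEdge (F (-1)) (F 0) k l → edgeIndex w k l 0 = edgeIndex w' k l 0) :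
    F = F' := by
  have key : ∀ m : ℕ, F ((m : ZMod n) - 1) = F' ((m : ZMod n) - 1) ∧ F m = F' m ∧
      ∀ k l, IsCommonEdge (F ((m : ZMod n) - 1)) (F m) k l →
        edgeIndex w k l m = edgeIndex w' k l m := by
    intro m
    induction m with
    | zero => simpa using ⟨h1, h2, h3⟩
    | succ m ih =>
      obtain ⟨i1, i2, i3⟩ := ih
      have := h.faces_eq_step h' hcount i1 i2 i3
      rw [Nat.cast_succ, add_sub_cancel_right]
      exact ⟨i2, this⟩
  funext i
  simpa using (key i.val).2.1

/-- Two short simple closed geodesics with the same numbers of points on the edges coincide. -/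
theorem trace_eq (hA : IsRegularFrame A c) (h : IsSimpleWeights A c F w)
    (h' : IsSimpleWeights A c F' w')
    (hcount : ∀ k l, k ≠ l → (edgePoints w k l).card = (edgePoints w' k l).card)
    (hc : n * arccos c < π) : trace A w = trace A w' := by
  have hn : 0 < n := Nat.pos_of_ne_zero (NeZero.ne n)
  -- Here the second curve crosses the edge in the same direction as the first; the other direction
  -- reduces to this by reversal.
  have main : ∀ (F' : ZMod n → Fin 4) (w' : ZMod n → Fin 4 → ℝ), IsSimpleWeights A c F' w' →
      (∀ k l, k ≠ l → (edgePoints w k l).card = (edgePoints w' k l).card) →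
      ∀ k l j, IsCommonEdge (F (-1)) (F 0) k l → F (-1) = F' (j - 1) → F 0 = F' j →
        edgeIndex w k l 0 = edgeIndex w' k l j → trace A w = trace A w' := by
    intro F' w' h' hcount k l j hkl e1 e2 e3
    have hs := h'.shift j
    have hcs : ∀ k l, k ≠ l →
        (edgePoints w k l).card = (edgePoints (fun i => w' (i + j)) k l).card := fun k l hkl => by
      rw [hcount k l hkl]; exact (card_edgePoints_equiv w' (Equiv.addRight j) k l).symm
    have hidx : ∀ a b, edgeIndex (fun i => w' (i + j)) a b 0 = edgeIndex w' a b j := fun a b => by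
      have := edgeIndex_equiv w' (Equiv.addRight j) a b 0
      simpa using this
    have m0 : (0 : ZMod n) ∈ edgePoints w k l := h.mem_of_faces (by simpa using hkl)
    have mj : j ∈ edgePoints w' k l := h'.mem_of_faces (by rwa [← e1, ← e2])
    have hF := h.faces_eq hs hcs (by rw [e1]; congr 1; ring) (by simpa using e2) (by
      intro a b hab
      rw [hidx]
      have a1 := h.edgeIndex_add hkl m0
      have a2 := h'.edgeIndex_add hkl mj
      have a3 := hcount k l hkl.2.1
      have : a = k ∧ b = l ∨ a = l ∧ b = k := by
        revert hkl hab; generalize F (-1) = f; generalize F 0 = g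
        clear * -
        revert f g k l a b; unfold IsCommonEdge; decide
      rcases this with ⟨rfl, rfl⟩ | ⟨rfl, rfl⟩ <;> omega)
    rw [← trace_shift A w' j]
    subst hF
    rw [h.toIsGeodesicWeights.eq_of_faces_eq hA hs.toIsGeodesicWeights hn hc]
  obtain ⟨k, l, hkl⟩ := exists_commonEdge (h.face_ne 0)
  rw [zero_sub] at hkl
  have m0 : (0 : ZMod n) ∈ edgePoints w k l := h.mem_of_faces (by simpa using hkl)
  have hlt := h.edgeIndex_add hkl m0
  obtain ⟨j, hj, hidx⟩ := h'.exists_edgeIndex_eq hkl (m := edgeIndex w k l 0) (by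
    rw [← hcount k l hkl.2.1]; omega)
  rcases h'.faces hkl hj with ⟨e1, e2⟩ | ⟨e1, e2⟩
  · exact main F' w' h' hcount k l j hkl e1.symm e2.symm hidx.symm
  · rw [← trace_neg A w']
    refine main _ _ h'.neg (fun a b hab => ?_) k l (-j) hkl ?_ ?_ ?_
    · rw [hcount a b hab]; exact (card_edgePoints_equiv w' (Equiv.neg _) a b).symm
    · rw [← e2]; congr 1; ring
    · rw [← e1]; congr 1; ring
    · rw [← hidx]
      have := edgeIndex_equiv w' (Equiv.neg _) k l (-j)
      simpa using this.symm

end IsSimpleWeights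
end SphericalTetrahedron

/-! ### Uniqueness of short simple closed geodesics -/

namespace SphericalTetrahedron

open Real InnerProductGeometry

variable {A : Fin 4 → E4} {c : ℝ} {n : ℕ} {F : ZMod n → Fin 4} {w : ZMod n → Fin 4 → ℝ}

namespace IsGeodesicWeights

variable [NeZero n]

/-- An interior point of an arc on the edge would force both ends of the arc onto it, by
nonnegativity of the weights, against `edge_ne`. -/
theorem trace_inter_edge (hA : IsRegularFrame A c) (h : IsGeodesicWeights A c F w) {k l : Fin 4}
    (hkl : k ≠ l) :
    trace A w ∩ greatArc (A k) (A l) = (fun i => comb A (w i)) '' (edgePoints w k l : Set (ZMod n)) := by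
  obtain ⟨f, g, hfg⟩ := exists_commonEdge hkl
  have hfg := hfg.flip
  ext z
  constructor
  · rintro ⟨hz, -, s', t', hs', ht', hz2⟩
    obtain ⟨i, hz1, s, t, hs, ht, rfl⟩ := Set.mem_iUnion.1 hz
    rw [← comb_smul, ← comb_smul, ← comb_add] at hz1 hz2 ⊢
    have e : comb A (s' • Pi.single k 1 + t' • Pi.single l 1) = s' • A k + t' • A l := by
      rw [comb_add, comb_smul, comb_smul, comb_single, comb_single]
    rw [← e] at hz2
    have hw := hA.comb_injective hz2
    have hzero : ∀ v, v ≠ k → v ≠ l → s * w i v + t * w (i + 1) v = 0 := fun v h1 h2 => by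
      simpa [h1, h2] using congrFun hw v
    have hpos : ∀ i, (∀ v, v ≠ k → v ≠ l → w i v = 0) → i ∈ edgePoints w k l := by
      intro i hi
      have hf := hi f hfg.2.2.1.symm hfg.2.2.2.2.1.symm
      have hg := hi g hfg.2.2.2.1.symm hfg.2.2.2.2.2.symm
      have h1 : f = F (i - 1) ∨ f = F i := by
        by_contra hcon
        rw [not_or] at hcon
        exact (h.weight_pos i f hcon.1 hcon.2).ne' hf
      have h2 : g = F (i - 1) ∨ g = F i := by
        by_contra hcon
        rw [not_or] at hcon
        exact (h.weight_pos i g hcon.1 hcon.2).ne' hg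
      have hne := hfg.1
      refine h.mem_of_faces ?_
      rcases h1 with h1 | h1 <;> rcases h2 with h2 | h2
      · exact absurd (h1.trans h2.symm) hne
      · rw [← h1, ← h2]; exact hfg
      · rw [← h1, ← h2]; exact hfg.swap_faces
      · exact absurd (h1.trans h2.symm) hne
    have hz0 : ∀ s t v, 0 ≤ s → 0 < t → s * w i v + t * w (i + 1) v = 0 → w (i + 1) v = 0 := by
      intro s t v hs ht h0
      have h1 := mul_nonneg hs (h.weight_nonneg i v)
      have h2 := h.weight_nonneg (i + 1) v
      nlinarith
    rcases hs.eq_or_lt with rfl | hs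
    · have ht : 0 < t := by
        rcases ht.eq_or_lt with rfl | ht
        · simp [comb] at hz1
        · exact ht
      rw [zero_smul, zero_add, comb_smul, norm_smul, h.norm, mul_one, Real.norm_of_nonneg ht.le] at hz1
      subst hz1
      exact ⟨i + 1, hpos _ fun v h1 h2 => hz0 0 1 v le_rfl one_pos (hzero v h1 h2), by simp⟩
    · rcases ht.eq_or_lt with rfl | ht
      · rw [zero_smul, add_zero, comb_smul, norm_smul, h.norm, mul_one, Real.norm_of_nonneg hs.le] at hz1
        subst hz1
        exact ⟨i, hpos _ fun v h1 h2 => by simpa using hzero v h1 h2, by simp⟩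
      · exfalso
        have m1 := hpos (i + 1) fun v h1 h2 => hz0 s t v hs.le ht (hzero v h1 h2)
        have m0 := hpos i fun v h1 h2 => by
          have h3 := hz0 s t v hs.le ht (hzero v h1 h2)
          have h4 := hzero v h1 h2
          rw [h3, mul_zero, add_zero] at h4
          exact (mul_eq_zero.1 h4).resolve_left hs.ne'
        have a1 := h.faces hfg m0
        have a2 := h.faces hfg m1
        rw [add_sub_cancel_right] at a2
        have := h.edge_ne i
        have := h.face_ne i
        rcases a1 with a1 | a1 <;> rcases a2 with a2 | a2 <;> simp_all
  · rintro ⟨i, hi, rfl⟩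
    obtain ⟨h1, h2⟩ := mem_edgePoints.1 (Finset.mem_coe.1 hi)
    obtain ⟨h3, h4⟩ : w i f = 0 ∧ w i g = 0 := by
      have h5 := h.left i
      have h6 := h.right i
      rcases h.faces hfg hi with ⟨e1, e2⟩ | ⟨e1, e2⟩ <;> rw [e1] at h5 <;> rw [e2] at h6
      · exact ⟨h5, h6⟩
      · exact ⟨h6, h5⟩
    exact ⟨Set.mem_iUnion.2 ⟨i, left_mem_greatArc (h.norm i) _⟩, h.norm i, w i k, w i l, h1.le, h2.le,
      comb_eq_of_support hfg h3 h4⟩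

/-- Each vertex lies on one edge, counted in both orientations. So the edge counts determine `n`. -/
theorem sum_card_edgePoints (h : IsGeodesicWeights A c F w) :
    ∑ k, ∑ l, (if k ≠ l then (edgePoints w k l).card else 0) = 2 * n := by
  classical
  have e : ∀ k l, (if k ≠ l then (edgePoints w k l).card else 0) =
      ∑ i, if k ≠ l ∧ 0 < w i k ∧ 0 < w i l then 1 else 0 := by
    intro k l
    by_cases hkl : k = l
    · simp [hkl]
    · simp [hkl, edgePoints]
  simp only [e]
  rw [Finset.sum_congr rfl fun k _ => Finset.sum_comm, Finset.sum_comm]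
  have : ∀ i, ∑ k, ∑ l, (if k ≠ l ∧ 0 < w i k ∧ 0 < w i l then 1 else 0) = 2 := by
    intro i
    obtain ⟨k, l, hkl⟩ := exists_commonEdge (h.face_ne i)
    obtain ⟨h1, h2⟩ := mem_edgePoints.1 (h.mem_of_faces hkl)
    simp only [sum_fin_four hkl, h.left, h.right, h1, h2, lt_irrefl, hkl.2.1, hkl.2.1.symm, ne_eq,
      not_true_eq_false, and_false, false_and, if_false, not_false_eq_true, and_self, if_true]
    rfl
  rw [Finset.sum_congr rfl fun i _ => this i]
  simp [ZMod.card, mul_comm]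

end IsGeodesicWeights

theorem IsSimpleWeights.edgeCount_trace [NeZero n] (hA : IsRegularFrame A c)
    (h : IsSimpleWeights A c F w) {k l : Fin 4} (hkl : k ≠ l) :
    edgeCount A (trace A w) k l = (edgePoints w k l).card := by
  rw [edgeCount, h.trace_inter_edge hA hkl, Set.ncard_image_of_injective _ fun i j e =>
    h.injective (hA.comb_injective e), Set.ncard_coe_finset]

/-- Two short simple closed geodesics with the same numbers of points on the edges coincide. -/
theorem IsRegularFrame.eq_of_edgeCount_eq (hA : IsRegularFrame A c) {γ γ' : Set E4}
    (h : IsSimpleClosedGeodesic A γ) (h' : IsSimpleClosedGeodesic A γ')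
    (hcount : ∀ k l, k ≠ l → edgeCount A γ k l = edgeCount A γ' k l) {M : ℕ}
    (hM : ∑ k, ∑ l, (if k ≠ l then edgeCount A γ k l else 0) = 2 * M) (hc : M * arccos c < π) :
    γ = γ' := by
  obtain ⟨n, F, w, hn, hw, rfl⟩ := hA.exists_simpleWeights h
  obtain ⟨n', F', w', hn', hw', rfl⟩ := hA.exists_simpleWeights h'
  have := NeZero.of_pos hn
  have := NeZero.of_pos hn'
  have e1 := hw.sum_card_edgePoints
  have e2 := hw'.sum_card_edgePoints
  have e3 : ∀ k l, k ≠ l → (edgePoints w k l).card = (edgePoints w' k l).card := fun k l hkl => by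
    rw [← hw.edgeCount_trace hA hkl, ← hw'.edgeCount_trace hA hkl, hcount k l hkl]
  have e4 : ∑ k, ∑ l, (if k ≠ l then (edgePoints w k l).card else 0) =
      ∑ k, ∑ l, (if k ≠ l then (edgePoints w' k l).card else 0) :=
    Finset.sum_congr rfl fun k _ => Finset.sum_congr rfl fun l _ => by
      split_ifs with hkl
      exacts [e3 k l hkl, rfl]
  have e5 : ∑ k, ∑ l, (if k ≠ l then edgeCount A (trace A w) k l else 0) =
      ∑ k, ∑ l, (if k ≠ l then (edgePoints w k l).card else 0) :=
    Finset.sum_congr rfl fun k _ => Finset.sum_congr rfl fun l _ => by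
      split_ifs with hkl
      exacts [hw.edgeCount_trace hA hkl, rfl]
  obtain rfl : n = n' := by omega
  obtain rfl : n = M := by omega
  exact hw.trace_eq hA hw' e3 hc

end SphericalTetrahedron

/-! ### The linear system for a perturbed rotation -/

namespace SphericalTetrahedron

/-- A function on the integers which is odd with respect to `-1 / 2`. -/
def IsOddHalf (y : ℤ → ℝ) : Prop := ∀ k, y (-1 - k) = -y k

/-- The relation between the values of a functional at the vertices of the two faces at an edge, for
all edges of one kind that are crossed by a geodesic. -/
def UnfoldRelation (κ : ℝ) (r a b : ℤ) (y : ℤ → ℝ) : Prop :=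
  ∀ x, 0 ≤ x → x < r → y (x + a) + y (x + b) = κ * (y x + y (x - r))

/-- Oddness exchanges the equations for x and r - 1 - x. For odd r both sides of the middle equation
vanish. -/
theorem UnfoldRelation.of_half {κ : ℝ} {r : ℕ} {a b : ℤ} {y : ℤ → ℝ} (hy : IsOddHalf y)
    (hab : a + b = -r)
    (h : ∀ x : ℕ, x < r / 2 → y (x + a) + y (x + b) = κ * (y x + y (x - r))) :
    UnfoldRelation κ r a b y := by
  intro x hx0 hxr
  lift x to ℕ using hx0
  by_cases h1 : x < r / 2
  · exact h x h1
  have e1 : y (x + a) = -y (((r - 1 - x : ℕ) : ℤ) + b) := by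
    rw [← hy]; congr 1; omega
  have e2 : y (x + b) = -y (((r - 1 - x : ℕ) : ℤ) + a) := by
    rw [← hy]; congr 1; omega
  have e3 : y x = -y (((r - 1 - x : ℕ) : ℤ) - r) := by
    rw [← hy]; congr 1; omega
  have e4 : y (x - r) = -y ((r - 1 - x : ℕ) : ℤ) := by
    rw [← hy]; congr 1; omega
  by_cases h2 : r - 1 - x < r / 2
  · linear_combination e1 + e2 - κ * e3 - κ * e4 - h _ h2
  · have h3 : r - 1 - x = x := by omega
    rw [h3] at e1 e2 e3 e4
    linear_combination e1 - κ * e3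

/-- The evaluation at an integer of the odd extension of a function on `{0, …, N - 1}`. -/
noncomputable def oddEval (N : ℕ) (k : ℤ) : (Fin N → ℝ) →ₗ[ℝ] ℝ :=
  if h : 0 ≤ k ∧ k < N then LinearMap.proj ⟨k.toNat, by omega⟩
  else if h : 0 ≤ -1 - k ∧ -1 - k < N then -LinearMap.proj ⟨(-1 - k).toNat, by omega⟩ else 0

theorem oddEval_odd (N : ℕ) (f : Fin N → ℝ) : IsOddHalf fun k => oddEval N k f := by
  intro k
  simp only [oddEval]
  by_cases h1 : 0 ≤ k ∧ k < N
  · have h2 : ¬ (0 ≤ -1 - k ∧ -1 - k < N) := by omega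
    have e : -1 - (-1 - k) = k := by ring
    simp only [h1, h2, dif_neg, not_false_eq_true, e, and_self, dif_pos]
    simp
  · by_cases h2 : 0 ≤ -1 - k ∧ -1 - k < N
    · simp only [h1, h2, dif_neg, not_false_eq_true, and_self, dif_pos]
      simp
    · have e : -1 - (-1 - k) = k := by ring
      simp only [h1, h2, dif_neg, not_false_eq_true, e]
      simp

/-- With N = p + q there are N unknowns and ⌊N/2⌋ + ⌊p/2⌋ + ⌊q/2⌋ equations, fewer than N since
coprimality makes two of p, q, N odd. -/
theorem exists_odd_solution {p q : ℕ} (hpq : Nat.Coprime p q) (κ : ℝ) :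
    ∃ y : ℤ → ℝ, IsOddHalf y ∧ (∃ k : ℤ, 0 ≤ k ∧ k < (p + q : ℕ) ∧ y k ≠ 0) ∧
      UnfoldRelation κ (p + q : ℕ) (-q) (-p) y ∧ UnfoldRelation κ p q (-(p + q : ℕ)) y ∧
      UnfoldRelation κ q p (-(p + q : ℕ)) y := by
  set N := p + q with hN
  let R (r a b x : ℤ) : (Fin N → ℝ) →ₗ[ℝ] ℝ :=
    oddEval N (x + a) + oddEval N (x + b) - κ • (oddEval N x + oddEval N (x - r))
  let Φ : (Fin N → ℝ) →ₗ[ℝ] (Fin (N / 2) ⊕ Fin (p / 2) ⊕ Fin (q / 2) → ℝ) :=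
    LinearMap.pi (Sum.elim (fun x => R N (-q) (-p) (x : ℕ))
      (Sum.elim (fun x => R p q (-N) (x : ℕ)) fun x => R q p (-N) (x : ℕ)))
  have hpar : p % 2 = 1 ∨ q % 2 = 1 := by
    by_contra hcon
    have := Nat.dvd_gcd (Nat.dvd_of_mod_eq_zero (by omega : p % 2 = 0))
      (Nat.dvd_of_mod_eq_zero (by omega : q % 2 = 0))
    rw [hpq] at this
    omega
  have hker : LinearMap.ker Φ ≠ ⊥ := by
    apply LinearMap.ker_ne_bot_of_finrank_lt
    simp only [Module.finrank_fintype_fun_eq_card, Fintype.card_sum, Fintype.card_fin]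
    omega
  obtain ⟨f, hf, hf0⟩ := Submodule.exists_mem_ne_zero_of_ne_bot hker
  have hΦ : ∀ i, Φ f i = 0 := fun i => by rw [LinearMap.mem_ker.1 hf]; rfl
  refine ⟨fun k => oddEval N k f, oddEval_odd N f, ?_, ?_, ?_, ?_⟩
  · obtain ⟨i, hi⟩ := Function.ne_iff.1 hf0
    refine ⟨i, by omega, by omega, ?_⟩
    have : 0 ≤ (i : ℤ) ∧ (i : ℤ) < N := by omega
    simpa [oddEval, this] using hi
  · refine UnfoldRelation.of_half (oddEval_odd N f) (by omega) fun x hx => ?_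
    have := hΦ (Sum.inl ⟨x, hx⟩)
    simp only [Φ, R, LinearMap.pi_apply, Sum.elim_inl, LinearMap.sub_apply, LinearMap.add_apply,
      LinearMap.smul_apply, smul_eq_mul] at this
    linear_combination this
  · refine UnfoldRelation.of_half (oddEval_odd N f) (by omega) fun x hx => ?_
    have := hΦ (Sum.inr (Sum.inl ⟨x, hx⟩))
    simp only [Φ, R, LinearMap.pi_apply, Sum.elim_inl, Sum.elim_inr, LinearMap.sub_apply,
      LinearMap.add_apply, LinearMap.smul_apply, smul_eq_mul] at this
    linear_combination this
  · refine UnfoldRelation.of_half (oddEval_odd N f) (by omega) fun x hx => ?_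
    have := hΦ (Sum.inr (Sum.inr ⟨x, hx⟩))
    simp only [Φ, R, LinearMap.pi_apply, Sum.elim_inr, LinearMap.sub_apply,
      LinearMap.add_apply, LinearMap.smul_apply, smul_eq_mul] at this
    linear_combination this

/-! ### Solutions are almost linear. -/

/-- The rotation by `p` of `ℤ / (p + q)`. -/
theorem rotation_succ (p q u : ℕ) (hq : 0 < q) :
    (p * u % (p + q) < q ∧ p * (u + 1) % (p + q) = p * u % (p + q) + p ∧
        p * (u + 1) / (p + q) = p * u / (p + q)) ∨
      (q ≤ p * u % (p + q) ∧ p * (u + 1) % (p + q) + q = p * u % (p + q) ∧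
        p * (u + 1) / (p + q) = p * u / (p + q) + 1) := by
  have hN : 0 < p + q := by omega
  have h1 := Nat.div_add_mod (p * u) (p + q)
  have h2 := Nat.mod_lt (p * u) hN
  rcases lt_or_ge (p * u % (p + q)) q with h | h
  · left
    have h3 : p * (u + 1) / (p + q) = p * u / (p + q) ∧
        p * (u + 1) % (p + q) = p * u % (p + q) + p := by
      rw [Nat.div_mod_unique hN]
      constructor
      · linarith
      · omega
    exact ⟨h, h3.2, h3.1⟩
  · right
    have h3 : p * (u + 1) / (p + q) = p * u / (p + q) + 1 ∧
        p * (u + 1) % (p + q) = p * u % (p + q) - q := by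
      rw [Nat.div_mod_unique hN]
      constructor
      · zify [h]; zify at h1; linarith
      · omega
    exact ⟨h, by omega, h3.1⟩

theorem exists_rotation_eq {p q : ℕ} (hpq : Nat.Coprime p q) (hq : 0 < q) {x : ℕ} (hx : x < p + q) :
    ∃ u < p + q, p * u % (p + q) = x := by
  have hN : 0 < p + q := by omega
  have hc : Nat.Coprime p (p + q) := by simpa using hpq
  obtain ⟨m, hm, e⟩ := Nat.exists_mul_mod_eq_of_coprime x hc hN.ne'
  exact ⟨m, hm, by rw [e, Nat.mod_eq_of_lt hx]⟩

/-- A bounded solution of the unfolding relations is almost linear along the strip. -/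
theorem rotation_estimate {p q : ℕ} (hpq : Nat.Coprime p q) (hq : 0 < q) {κ M : ℝ} (hκ : κ ≤ 1)
    {y : ℤ → ℝ} (hM : ∀ k : ℤ, -(p + q : ℕ) ≤ k → k < (p + q : ℕ) → |y k| ≤ M)
    (h11 : UnfoldRelation κ (p + q : ℕ) (-q) (-p) y)
    (h10 : UnfoldRelation κ p q (-(p + q : ℕ)) y)
    (h01 : UnfoldRelation κ q p (-(p + q : ℕ)) y) {x : ℕ} (hx : x < p + q) :
    |y x - y 0 - (y 0 - y (-p) + (y 0 - y (-q))) / (p + q) * x| ≤ 8 * (1 - κ) * M * (p + q) ^ 2 ∧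
      |y 0 - y (-q) - (y 0 - y (-p) + (y 0 - y (-q))) / (p + q) * q| ≤
        4 * (1 - κ) * M * (p + q) := by
  set δ := 1 - κ with hδ
  have hδ0 : 0 ≤ δ := sub_nonneg.2 hκ
  have hM0 : 0 ≤ M := (abs_nonneg _).trans (hM 0 (by omega) (by omega))
  have hb : ∀ a b : ℤ, -(p + q : ℕ) ≤ a → a < (p + q : ℕ) → -(p + q : ℕ) ≤ b → b < (p + q : ℕ) →
      |δ * (y a + y b)| ≤ 2 * δ * M := fun a b h1 h2 h3 h4 => by
    rw [abs_mul, abs_of_nonneg hδ0]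
    nlinarith [abs_add_le (y a) (y b), hM a h1 h2, hM b h3 h4]
  -- Each relation says that a mixed second difference of `y` is δ times two of its values, so `D`
  -- and `G` hardly change along the rotation by `p`.
  let D : ℤ → ℝ := fun x => y x - y (x - p)
  let G : ℤ → ℝ := fun x => y x - y (x - q)
  have f1 : ∀ x : ℤ, 0 ≤ x → x < (p + q : ℕ) → |D x - D (x - q)| ≤ 2 * δ * M := fun x h1 h2 => by
    have e := h11 x h1 h2
    simp only [← sub_eq_add_neg] at e
    rw [show D x - D (x - q) = δ * (y x + y (x - (p + q : ℕ))) by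
      simp only [D]
      rw [show x - q - p = x - (p + q : ℕ) by push_cast; ring, hδ]
      linear_combination -e]
    exact hb _ _ (by omega) (by omega) (by omega) (by omega)
  have f2 : ∀ x : ℤ, 0 ≤ x → x < (p + q : ℕ) → |G x - G (x - p)| ≤ 2 * δ * M := fun x h1 h2 => by
    have e := h11 x h1 h2
    simp only [← sub_eq_add_neg] at e
    rw [show G x - G (x - p) = δ * (y x + y (x - (p + q : ℕ))) by
      simp only [G]
      rw [show x - p - q = x - (p + q : ℕ) by push_cast; ring, hδ]
      linear_combination -e]
    exact hb _ _ (by omega) (by omega) (by omega) (by omega)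
  have f3 : ∀ x : ℤ, 0 ≤ x → x < q → |D (x + p) - D (x - q)| ≤ 2 * δ * M := fun x h1 h2 => by
    have e := h01 x h1 h2
    rw [show D (x + p) - D (x - q) = -(δ * (y x + y (x - q))) by
      simp only [D]
      rw [show x + p - p = x by ring, show x - q - p = x + -(p + q : ℕ) by push_cast; ring, hδ]
      linear_combination e, abs_neg]
    exact hb _ _ (by omega) (by omega) (by omega) (by omega)
  have f4 : ∀ x : ℤ, 0 ≤ x → x < p → |G (x + q) - G (x - p)| ≤ 2 * δ * M := fun x h1 h2 => by
    have e := h10 x h1 h2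
    rw [show G (x + q) - G (x - p) = -(δ * (y x + y (x - p))) by
      simp only [G]
      rw [show x + q - q = x by ring, show x - p - q = x + -(p + q : ℕ) by push_cast; ring, hδ]
      linear_combination e, abs_neg]
    exact hb _ _ (by omega) (by omega) (by omega) (by omega)
  set N := p + q with hN
  have hN0 : 0 < N := by omega
  have hDG : ∀ u : ℕ, |D (p * u % N : ℕ) - D 0| ≤ 4 * δ * M * u ∧
      |G (p * u % N : ℕ) - G 0| ≤ 4 * δ * M * u := by
    intro u
    induction u with
    | zero => simp
    | succ u ih =>
      have hlt := Nat.mod_lt (p * u) hN0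
      have step : |D (p * (u + 1) % N : ℕ) - D (p * u % N : ℕ)| ≤ 4 * δ * M ∧
          |G (p * (u + 1) % N : ℕ) - G (p * u % N : ℕ)| ≤ 4 * δ * M := by
        rcases rotation_succ p q u hq with ⟨h1, h2, -⟩ | ⟨h1, h2, -⟩
        · rw [← hN] at h1 h2
          rw [h2]
          have a1 := f1 (p * u % N : ℕ) (by omega) (by omega)
          have a2 := f3 (p * u % N : ℕ) (by omega) (by omega)
          have a3 := f2 ((p * u % N : ℕ) + p) (by omega) (by omega)
          rw [show ((p * u % N : ℕ) : ℤ) + p - p = (p * u % N : ℕ) by ring] at a3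
          rw [Nat.cast_add]
          simp only [abs_le] at *
          have : 0 ≤ δ * M := by positivity
          constructor <;> constructor <;> linarith
        · rw [← hN] at h1 h2
          rw [← h2]
          have a1 := f1 ((p * (u + 1) % N : ℕ) + q) (by omega) (by omega)
          have a2 := f4 (p * (u + 1) % N : ℕ) (by omega) (by omega)
          have a3 := f2 (p * (u + 1) % N : ℕ) (by omega) (by omega)
          rw [show ((p * (u + 1) % N : ℕ) : ℤ) + q - q = (p * (u + 1) % N : ℕ) by ring] at a1
          rw [Nat.cast_add]
          simp only [abs_le] at *
          have : 0 ≤ δ * M := by positivity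
          constructor <;> constructor <;> linarith
      rw [Nat.cast_add_one]
      simp only [abs_le] at *
      obtain ⟨⟨i1, i2⟩, i3, i4⟩ := ih
      obtain ⟨⟨j1, j2⟩, j3, j4⟩ := step
      constructor <;> constructor <;> linarith
  set Δ := 4 * δ * M * N with hΔ
  have hle : ∀ u : ℕ, u ≤ N → 4 * δ * M * u ≤ Δ := fun u hu => by
    have : (u : ℝ) ≤ N := by exact_mod_cast hu
    have h0 : 0 ≤ 4 * δ * M := by positivity
    exact mul_le_mul_of_nonneg_left this h0
  -- A step of the rotation adds `D` or subtracts `G`; the quotient of `p * u` by `N` counts the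
  -- steps of the second kind.
  have hz : ∀ u : ℕ, u ≤ N → |y (p * u % N : ℕ) - y 0 -
      (u * D 0 - (p * u / N : ℕ) * (D 0 + G 0))| ≤ u * Δ := by
    intro u hu
    induction u with
    | zero => simp
    | succ u ih =>
      have ih := ih (by omega)
      obtain ⟨d1, -⟩ := hDG (u + 1)
      obtain ⟨-, g1⟩ := hDG u
      have hlt := Nat.mod_lt (p * u) hN0
      have d2 := d1.trans (hle (u + 1) hu)
      have g2 := g1.trans (hle u (by omega))
      rcases rotation_succ p q u hq with ⟨h1, h2, h3⟩ | ⟨h1, h2, h3⟩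
      · rw [← hN] at h1 h2 h3
        rw [h2] at d2 ⊢
        rw [h3]
        simp only [D, G] at d2 g2 ih ⊢
        push_cast at d2 g2 ih ⊢
        rw [add_sub_cancel_right] at d2
        rw [abs_le] at *
        constructor <;> linarith
      · rw [← hN] at h1 h2 h3
        rw [h3]
        simp only [D, G] at d2 g2 ih ⊢
        rw [show ((p * u % N : ℕ) : ℤ) - q = (p * (u + 1) % N : ℕ) by omega] at g2
        push_cast at d2 g2 ih ⊢
        rw [abs_le] at *
        constructor <;> linarith
  have hD0 : D 0 = y 0 - y (-p) := by simp [D]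
  have hG0 : G 0 = y 0 - y (-q) := by simp [G]
  rw [← hD0, ← hG0]
  have hNr : (0 : ℝ) < p + q := by exact_mod_cast hN0
  have hNc : (N : ℝ) = p + q := by simp [hN]
  set C := (D 0 + G 0) / (p + q) with hC
  have hCN : D 0 + G 0 = C * (p + q) := by rw [hC]; field_simp
  -- After `N` steps, `p` of which subtract `G`, the rotation is back at 0, so N · D 0 is close to p
  -- (D 0 + G 0).
  have hd : |D 0 - p * C| ≤ Δ := by
    have := hz N le_rfl
    rw [Nat.mul_mod_left, Nat.mul_div_cancel _ hN0, hCN, hNc, Nat.cast_zero, sub_self, zero_sub,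
      abs_neg, show ((p : ℝ) + q) * D 0 - p * (C * (p + q)) = (p + q) * (D 0 - p * C) by ring,
      abs_mul, abs_of_pos hNr] at this
    exact le_of_mul_le_mul_left this hNr
  have hg : |G 0 - C * q| ≤ Δ := by
    rw [← abs_neg, show -(G 0 - C * q) = D 0 - p * C by linear_combination -hCN]
    exact hd
  refine ⟨?_, by rw [hΔ, hNc] at hg; exact hg⟩
  obtain ⟨u, hu, rfl⟩ := exists_rotation_eq hpq hq hx
  have h1 := hz u hu.le
  have h2 : ((p * u % N : ℕ) : ℝ) = p * u - (p + q) * (p * u / N : ℕ) := by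
    have := Nat.div_add_mod (p * u) N
    have h3 : ((N * (p * u / N) + p * u % N : ℕ) : ℝ) = (p * u : ℕ) := by rw [this]
    simp only [Nat.cast_add, Nat.cast_mul] at h3
    rw [hNc] at h3
    linarith
  rw [hCN] at h1
  have huN : (u : ℝ) ≤ p + q := by rw [← hNc]; exact_mod_cast hu.le
  have h3 : |(u : ℝ) * (D 0 - p * C)| ≤ (p + q) * Δ := by
    rw [abs_mul, abs_of_nonneg (Nat.cast_nonneg u)]
    exact mul_le_mul huN hd (abs_nonneg _) hNr.le
  have hΔ0 : 0 ≤ Δ := by positivity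
  have h4 : (u : ℝ) * Δ ≤ (p + q) * Δ := mul_le_mul_of_nonneg_right huN hΔ0
  rw [← hN, h2, show y (p * u % N : ℕ) - y 0 - C * (p * u - (p + q) * (p * u / N : ℕ)) =
    (y (p * u % N : ℕ) - y 0 - (u * D 0 - (p * u / N : ℕ) * (C * (p + q)))) +
      u * (D 0 - p * C) by ring]
  refine (abs_add_le _ _).trans ?_
  rw [hΔ, hNc] at h3 h4 h1
  linarith

/-- For almost flat faces, the unfolding relations have an increasing odd solution. -/
theorem exists_profile {p q : ℕ} (hpq : Nat.Coprime p q) (hq : 0 < q) {κ : ℝ} (hκ : κ ≤ 1)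
    (hsmall : 64 * (p + q : ℝ) ^ 3 * (1 - κ) < 1) :
    ∃ y : ℤ → ℝ, IsOddHalf y ∧ UnfoldRelation κ (p + q : ℕ) (-q) (-p) y ∧
      UnfoldRelation κ p q (-(p + q : ℕ)) y ∧ UnfoldRelation κ q p (-(p + q : ℕ)) y ∧
      ∃ C : ℝ, 0 < C ∧ ∀ k : ℤ, -(p + q : ℕ) ≤ k → k < (p + q : ℕ) →
        |y k - C * (k + 1 / 2)| < C / 2 := by
  obtain ⟨y, hy, ⟨k₀, hk0, hkN, hk⟩, h11, h10, h01⟩ := exists_odd_solution hpq κ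
  have hN0 : 0 < p + q := by omega
  obtain ⟨m, hm, hmax⟩ := Finset.exists_max_image (Finset.range (p + q)) (fun x : ℕ => |y x|)
    ⟨0, by simpa using hN0⟩
  set M := |y m| with hMdef
  have hM1 : ∀ x : ℤ, 0 ≤ x → x < (p + q : ℕ) → |y x| ≤ M := fun x h1 h2 => by
    lift x to ℕ using h1
    exact hmax x (Finset.mem_range.2 (by omega))
  have hM : ∀ k : ℤ, -(p + q : ℕ) ≤ k → k < (p + q : ℕ) → |y k| ≤ M := fun k h1 h2 => by
    rcases le_or_gt 0 k with h | h
    · exact hM1 k h h2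
    · rw [← abs_neg, ← hy]
      exact hM1 _ (by omega) (by omega)
  have hMpos : 0 < M := (abs_pos.2 hk).trans_le (hM1 k₀ hk0 hkN)
  have est := fun (x : ℕ) (hx : x < p + q) => rotation_estimate hpq hq hκ hM h11 h10 h01 hx
  set C := (y 0 - y (-p) + (y 0 - y (-q))) / ((p : ℝ) + q) with hC
  have hN1 : (1 : ℝ) ≤ p + q := by exact_mod_cast hN0
  set P : ℝ := (p : ℝ) + q with hP
  have hδ : 0 ≤ 1 - κ := sub_nonneg.2 hκ
  set E := (1 - κ) * M * P ^ 2 with hE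
  have hE0 : 0 ≤ E := by positivity
  have hsm : (1 - κ) * M * P ≤ E := by
    rw [hE]
    have : 0 ≤ (1 - κ) * M * P := by positivity
    nlinarith
  have hq1 := est (q - 1) (by omega)
  have hneg : y (-q) = -y ((q - 1 : ℕ) : ℤ) := by rw [← hy]; congr 1; omega
  rw [hneg, show ((q - 1 : ℕ) : ℝ) = q - 1 by rw [Nat.cast_sub hq]; simp] at hq1
  obtain ⟨a1, a2⟩ := hq1
  -- By oddness y(-q) = -y(q - 1), so the two estimates determine the constant term.
  have hoff : |y 0 - C / 2| ≤ 6 * E := by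
    rw [abs_le] at *
    constructor <;> linarith
  have hall : ∀ x : ℤ, 0 ≤ x → x < (p + q : ℕ) → |y x - C * (x + 1 / 2)| ≤ 14 * E := by
    intro x h1 h2
    lift x to ℕ using h1
    have a3 := (est x (by omega)).1
    push_cast
    rw [abs_le] at *
    constructor <;> linarith
  -- The maximum `M` is attained at a point where y is within 14E of a linear function, so it is
  -- controlled by the slope.
  have hMC : M ≤ 2 * |C| * P := by
    have b1 := hall m (by omega) (by have := Finset.mem_range.1 hm; omega)
    have b2 : |C * ((m : ℤ) + 1 / 2)| ≤ |C| * P := by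
      rw [abs_mul]
      refine mul_le_mul_of_nonneg_left ?_ (abs_nonneg _)
      have : (m : ℝ) + 1 ≤ p + q := by exact_mod_cast Finset.mem_range.1 hm
      push_cast
      rw [abs_of_nonneg (by positivity)]
      linarith
    have b3 : M ≤ |C| * P + 14 * E := by
      have := abs_add_le (y m - C * ((m : ℤ) + 1 / 2)) (C * ((m : ℤ) + 1 / 2))
      rw [sub_add_cancel] at this
      linarith
    have b4 : 64 * E ≤ M := by
      have : 64 * P ^ 2 * (1 - κ) ≤ 1 := by
        have h5 : 64 * P ^ 2 * (1 - κ) * 1 ≤ 64 * P ^ 2 * (1 - κ) * P :=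
          mul_le_mul_of_nonneg_left hN1 (by positivity)
        nlinarith
      nlinarith
    linarith
  have hC0 : C ≠ 0 := by
    rintro h0
    rw [h0] at hMC
    simp at hMC
    linarith
  have hCpos : 0 < |C| := abs_pos.2 hC0
  -- 14E ≤ 28 (1 - κ) P³ |C|, and 28/64 < 1/2.
  have hfin : 14 * E < |C| / 2 := by
    have : E ≤ (1 - κ) * (2 * |C| * P) * P ^ 2 := by rw [hE]; gcongr
    nlinarith
  have hall' : ∀ k : ℤ, -(p + q : ℕ) ≤ k → k < (p + q : ℕ) → |y k - C * (k + 1 / 2)| < |C| / 2 := by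
    intro k h1 h2
    rcases le_or_gt 0 k with h | h
    · exact (hall k h h2).trans_lt hfin
    · have := hall (-1 - k) (by omega) (by omega)
      rw [hy, ← abs_neg] at this
      push_cast at this
      refine lt_of_eq_of_lt ?_ (this.trans_lt hfin)
      congr 1; ring
  rcases lt_or_gt_of_ne hC0 with hneg | hpos
  · refine ⟨fun k => -y k, fun k => congrArg Neg.neg (hy k), ?_, ?_, ?_, -C, by linarith, fun k h1 h2 => ?_⟩
    · intro x h1 h2; linear_combination -h11 x h1 h2
    · intro x h1 h2; linear_combination -h10 x h1 h2
    · intro x h1 h2; linear_combination -h01 x h1 h2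
    · have := hall' k h1 h2
      rw [abs_of_neg hneg, ← abs_neg] at this
      refine lt_of_eq_of_lt ?_ this
      congr 1; ring
  · refine ⟨y, hy, h11, h10, h01, C, hpos, fun k h1 h2 => ?_⟩
    have := hall' k h1 h2
    rwa [abs_of_pos hpos] at this

end SphericalTetrahedron

/-! ### Geodesics from linear functionals on the faces -/

namespace SphericalTetrahedron

open Real InnerProductGeometry

variable {A : Fin 4 → E4} {c : ℝ} {n : ℕ} {F : ZMod n → Fin 4} {w : ZMod n → Fin 4 → ℝ}

theorem IsGeodesicWeights.pos_iff (h : IsGeodesicWeights A c F w) (i : ZMod n) (v : Fin 4) :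
    0 < w i v ↔ v ≠ F (i - 1) ∧ v ≠ F i :=
  ⟨fun hv => h.ne_faces hv, fun hv => h.weight_pos i v hv.1 hv.2⟩

/-- An interior point of an arc has only one vanishing weight. -/
theorem IsGeodesicWeights.arc_eq_zero_iff (h : IsGeodesicWeights A c F w) (i : ZMod n) {s t : ℝ}
    (hs : 0 < s) (ht : 0 < t) (v : Fin 4) : (s • w i + t • w (i + 1)) v = 0 ↔ v = F i := by
  simp only [Pi.add_apply, Pi.smul_apply, smul_eq_mul]
  constructor
  · intro h0
    by_contra hv
    have a1 := h.weight_nonneg i v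
    have a2 := h.weight_nonneg (i + 1) v
    have e1 : w i v = 0 := by nlinarith [mul_nonneg hs.le a1, mul_nonneg ht.le a2]
    have e2 : w (i + 1) v = 0 := by nlinarith [mul_nonneg hs.le a1, mul_nonneg ht.le a2]
    have b1 := mt (h.pos_iff i v).2 e1.not_gt
    have b2 := mt (h.pos_iff (i + 1) v).2 e2.not_gt
    rw [add_sub_cancel_right] at b2
    have b3 := h.edge_ne i
    have b4 : v = F (i - 1) := by tauto
    have b5 : v = F (i + 1) := by tauto
    exact b3 (b4.symm.trans b5)
  · rintro rfl
    rw [h.right, h.next_left]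
    simp

theorem IsSimpleWeights.isSimpleClosedGeodesic (hA : IsRegularFrame A c) (hn : 0 < n)
    (h : IsSimpleWeights A c F w) : IsSimpleClosedGeodesic A (trace A w) := by
  refine ⟨n, fun i => comb A (w i), F, hn, h.isClosedGeodesic hA, fun i j hij => ?_, rfl⟩
  rw [Set.disjoint_left]
  have key : ∀ i z, z ∈ greatArc (comb A (w i)) (comb A (w (i + 1))) \ {comb A (w (i + 1))} →
      ∃ s t : ℝ, 0 < s ∧ 0 ≤ t ∧ ‖z‖ = 1 ∧ z = comb A (s • w i + t • w (i + 1)) := by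
    rintro i z ⟨⟨hz, s, t, hs, ht, rfl⟩, hne⟩
    refine ⟨s, t, hs.lt_of_ne' ?_, ht, hz, by rw [comb_add, comb_smul, comb_smul]⟩
    rintro rfl
    rw [zero_smul, zero_add, norm_smul, h.norm, mul_one, Real.norm_of_nonneg ht] at hz
    apply hne
    simp [hz]
  -- A vertex has two vanishing weights, an interior point of an arc only one.
  have key2 : ∀ i j, ∀ s s' t' : ℝ, 0 < s → 0 < s' → 0 < t' →
      s • w i ≠ s' • w j + t' • w (j + 1) := by
    intro i j s s' t' hs hs' ht' e
    have e1 := (h.arc_eq_zero_iff j hs' ht' (F (i - 1))).1 (by rw [← e]; simp [h.left])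
    have e2 := (h.arc_eq_zero_iff j hs' ht' (F i)).1 (by rw [← e]; simp [h.right])
    exact h.face_ne i (e1.trans e2.symm)
  intro z hz hz'
  obtain ⟨s, t, hs, ht, hz1, rfl⟩ := key i z hz
  obtain ⟨s', t', hs', ht', -, e⟩ := key j _ hz'
  have e := hA.comb_injective e
  rcases ht.eq_or_lt with rfl | ht <;> rcases ht'.eq_or_lt with rfl | ht'
  · rw [zero_smul, add_zero, zero_smul, add_zero] at e
    have n1 := congrArg (fun w => ‖comb A w‖) e
    simp only [comb_smul, norm_smul, h.norm, mul_one, Real.norm_of_nonneg hs.le,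
      Real.norm_of_nonneg hs'.le] at n1
    rw [n1] at e
    exact hij (h.injective (smul_right_injective _ hs'.ne' e))
  · rw [zero_smul, add_zero] at e
    exact key2 i j s s' t' hs hs' ht' e
  · rw [zero_smul, add_zero] at e
    exact key2 j i s' s t hs' hs ht e.symm
  · exact h.noncrossing i j hij s t s' t' hs ht hs' ht' e

/-- Functionals on the faces `F i` whose zero sets are the arcs of a closed geodesic; the sign
alternates along the geodesic. -/
structure IsGeodesicFunctional (c : ℝ) (F : ZMod n → Fin 4) (φ : ZMod n → Fin 4 → ℝ) : Prop where
  face_ne : ∀ i, F (i - 1) ≠ F i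
  edge_ne : ∀ i, F (i - 1) ≠ F (i + 1)
  crossing : ∀ i, ∃ k l, IsCommonEdge (F (i - 1)) (F i) k l ∧ φ i k = -φ (i - 1) k ∧
    φ i l = -φ (i - 1) l ∧ 0 < φ (i - 1) k ∧ φ (i - 1) l < 0 ∧
    φ (i - 1) (F i) - φ i (F (i - 1)) = 2 * (c / (1 + c)) * (φ (i - 1) k + φ (i - 1) l)

theorem commonEdge_unique {f g k l a b : Fin 4} (h : IsCommonEdge f g k l)
    (h' : IsCommonEdge f g a b) : a = k ∧ b = l ∨ a = l ∧ b = k := by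
  revert f g k l a b; unfold IsCommonEdge; decide

theorem balanced_swap {f g k l : Fin 4} {x y z : Fin 4 → ℝ}
    (h : IsRegularFrame.Balanced c f g k l x y z) : IsRegularFrame.Balanced c f g l k x y z := by
  unfold IsRegularFrame.Balanced at *
  linear_combination -h

/-- After unfolding, ψ becomes -φ, so both arcs lie on one great circle. Eliminating the values of
the functionals gives the balance multiplied by `φ k`. -/
theorem balanced_of_functional {f g k l : Fin 4} (hkl : IsCommonEdge f g k l)
    {x y z φ ψ : Fin 4 → ℝ} (xf : x f = 0) (xg : x g = 0) (yg : y g = 0)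
    (zf : z f = 0) (hk : ψ k = -φ k) (hl : ψ l = -φ l) (hφk : φ k ≠ 0)
    (hfg : φ g - ψ f = 2 * (c / (1 + c)) * (φ k + φ l)) (hx : φ ⬝ᵥ x = 0) (hz : φ ⬝ᵥ z = 0)
    (hy : ψ ⬝ᵥ y = 0) : IsRegularFrame.Balanced c f g k l x y z := by
  simp only [dotProduct] at hx hy hz
  rw [sum_fin_four hkl, xf, xg] at hx
  rw [sum_fin_four hkl, yg, hk, hl] at hy
  rw [sum_fin_four hkl, zf] at hz
  unfold IsRegularFrame.Balanced
  have h0 : φ k * ((x l * y k - x k * y l + c / (1 + c) * (x l - x k) * y f) * z g +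
      (x l * z k - x k * z l + c / (1 + c) * (x l - x k) * z g) * y f) = 0 := by
    linear_combination (-(x l * z g)) * hy + x l * y f * hz - x l * y f * z g * hfg +
      (-(y l * z g) - z l * y f - 2 * (c / (1 + c)) * y f * z g) * hx
  exact (mul_eq_zero.1 h0).resolve_left hφk

theorem IsGeodesicFunctional.exists_weights (hA : IsRegularFrame A c) {φ : ZMod n → Fin 4 → ℝ}
    (h : IsGeodesicFunctional c F φ) : ∃ w : ZMod n → Fin 4 → ℝ, IsGeodesicWeights A c F w ∧
      ∀ i, φ i ⬝ᵥ w i = 0 ∧ φ i ⬝ᵥ w (i + 1) = 0 := by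
  have point : ∀ i, ∃ x : Fin 4 → ℝ, x (F (i - 1)) = 0 ∧ x (F i) = 0 ∧
      (∀ v, v ≠ F (i - 1) → v ≠ F i → 0 < x v) ∧ ‖comb A x‖ = 1 ∧ φ i ⬝ᵥ x = 0 ∧
      φ (i - 1) ⬝ᵥ x = 0 := by
    intro i
    obtain ⟨k, l, hkl, e1, e2, p1, p2, -⟩ := h.crossing i
    obtain ⟨h1, h2, h3, h4, h5, h6⟩ := id hkl
    -- The zero of the functional on the edge; the opposite signs at the ends make both weights
    -- positive.
    obtain ⟨x, xk, xl, xf, xg⟩ : ∃ x : Fin 4 → ℝ, x k = -φ (i - 1) l ∧ x l = φ (i - 1) k ∧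
        x (F (i - 1)) = 0 ∧ x (F i) = 0 :=
      ⟨fun v => if v = k then -φ (i - 1) l else if v = l then φ (i - 1) k else 0, by simp,
        by simp [h2.symm], by simp [h3.symm, h5.symm], by simp [h4.symm, h6.symm]⟩
    have hx0 : 0 < ‖comb A x‖ := by
      rw [norm_pos_iff]
      intro h0
      have : comb A x = comb A 0 := by rw [h0]; simp [comb]
      have := congrFun (hA.comb_injective this) l
      rw [xl, Pi.zero_apply] at this
      exact p1.ne' this
    refine ⟨‖comb A x‖⁻¹ • x, by simp [xf], by simp [xg], fun v hf hg => ?_, ?_, ?_, ?_⟩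
    · have : 0 < x v := by
        rcases forall_fin_four hkl v with rfl | rfl | rfl | rfl
        · rw [xk]; linarith
        · rw [xl]; exact p1
        · exact absurd rfl hf
        · exact absurd rfl hg
      rw [Pi.smul_apply, smul_eq_mul]
      positivity
    · rw [comb_smul, norm_smul, norm_inv, norm_norm, inv_mul_cancel₀ hx0.ne']
    · rw [dotProduct_smul]
      simp only [dotProduct]
      rw [sum_fin_four hkl, xk, xl, xf, xg, e1, e2, smul_eq_mul]
      ring
    · rw [dotProduct_smul]
      simp only [dotProduct]
      rw [sum_fin_four hkl, xk, xl, xf, xg, smul_eq_mul]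
      ring
  choose w wl wr wp wn w1 w2 using point
  have w3 : ∀ i, φ i ⬝ᵥ w (i + 1) = 0 := fun i => by
    have := w2 (i + 1)
    rwa [add_sub_cancel_right] at this
  refine ⟨w, ⟨h.face_ne, h.edge_ne, wl, wr, wp, wn, fun i a b hab => ?_⟩, fun i => ⟨w1 i, w3 i⟩⟩
  obtain ⟨k, l, hkl, e1, e2, p1, p2, e3⟩ := h.crossing i
  have hyg := wl (i + 1)
  rw [add_sub_cancel_right] at hyg
  have bal := balanced_of_functional hkl (wl i) (wr i) hyg
    (wr (i - 1)) e1 e2 p1.ne' e3 (w2 i) (w1 (i - 1)) (w3 i)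
  rcases commonEdge_unique hkl hab with ⟨rfl, rfl⟩ | ⟨rfl, rfl⟩
  · exact bal
  · exact balanced_swap bal

/-- Functionals that are comparable on each face define disjoint arcs. -/
theorem IsGeodesicWeights.isSimpleWeights (h : IsGeodesicWeights A c F w)
    {φ : ZMod n → Fin 4 → ℝ} (hφ : ∀ i, φ i ⬝ᵥ w i = 0 ∧ φ i ⬝ᵥ w (i + 1) = 0)
    (hlt : ∀ i j, i ≠ j → F i = F j →
      (∀ v, v ≠ F i → φ i v < φ j v) ∨ ∀ v, v ≠ F i → φ j v < φ i v) :
    IsSimpleWeights A c F w := by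
  have key : ∀ i j, i ≠ j → F i = F j → ∀ z : Fin 4 → ℝ, (∀ v, 0 ≤ z v) → z (F i) = 0 →
      (∃ v, 0 < z v) → φ i ⬝ᵥ z = 0 → φ j ⬝ᵥ z = 0 → False := by
    intro i j hij hF z hz hzF ⟨v, hv⟩ h1 h2
    have hvF : v ≠ F i := by rintro rfl; exact hv.ne' hzF
    have main : ∀ φ ψ : Fin 4 → ℝ, (∀ v, v ≠ F i → φ v < ψ v) → φ ⬝ᵥ z < ψ ⬝ᵥ z := by
      intro φ ψ hlt
      refine Finset.sum_lt_sum (fun u _ => ?_) ⟨v, Finset.mem_univ v, ?_⟩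
      · by_cases hu : u = F i
        · rw [hu, hzF, mul_zero, mul_zero]
        · exact mul_le_mul_of_nonneg_right (hlt u hu).le (hz u)
      · exact mul_lt_mul_of_pos_right (hlt v hvF) hv
    rcases hlt i j hij hF with h3 | h3
    · exact (main _ _ h3).ne (h1.trans h2.symm)
    · exact (main _ _ h3).ne (h2.trans h1.symm)
  refine ⟨h, fun i j hij => ?_, fun i j hij s t s' t' hs ht hs' ht' e => ?_⟩
  · by_contra hne
    obtain ⟨k, l, hkl⟩ := exists_commonEdge (h.face_ne i)
    have p1 := h.weight_pos i k hkl.2.2.1 hkl.2.2.2.1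
    have p2 := h.weight_pos i l hkl.2.2.2.2.1 hkl.2.2.2.2.2
    have p3 := p1
    have p4 := p2
    rw [hij] at p3 p4
    rcases faces_of_notMem hkl (h.face_ne j) (h.ne_faces p3).1 (h.ne_faces p3).2 (h.ne_faces p4).1
      (h.ne_faces p4).2 with e | e
    · exact key i j hne e.2.symm (w i) (h.weight_nonneg i) (h.right i) ⟨k, p1⟩ (hφ i).1
        (by rw [hij]; exact (hφ j).1)
    · by_cases hji : i = j - 1
      · have := h.next_pos i
        rw [hji, sub_add_cancel, ← hij, hji] at this
        exact this.ne' (by rw [← hji, h.left])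
      · refine key i (j - 1) hji e.1.symm (w i) (h.weight_nonneg i) (h.right i) ⟨k, p1⟩ (hφ i).1 ?_
        have := (hφ (j - 1)).2
        rwa [sub_add_cancel, ← hij] at this
  · have hF : F i = F j := (h.arc_eq_zero_iff j hs' ht' _).1
      (by rw [← e]; exact (h.arc_eq_zero_iff i hs ht _).2 rfl)
    refine key i j hij hF (s • w i + t • w (i + 1)) (fun v => ?_)
      ((h.arc_eq_zero_iff i hs ht _).2 rfl) ⟨F (i - 1), ?_⟩ ?_ ?_
    · have := h.weight_nonneg i v
      have := h.weight_nonneg (i + 1) v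
      simp only [Pi.add_apply, Pi.smul_apply, smul_eq_mul]
      positivity
    · have := h.next_pos i
      simp only [Pi.add_apply, Pi.smul_apply, smul_eq_mul, h.left]
      positivity
    · rw [dotProduct_add, dotProduct_smul, dotProduct_smul, (hφ i).1, (hφ i).2]
      simp
    · rw [e, dotProduct_add, dotProduct_smul, dotProduct_smul, (hφ j).1, (hφ j).2]
      simp

/-- If the arcs on a face are distinguished by numbers and those that touch an edge have numbers in
a set `S`, then there are at most `S.card` points on the edge. -/
theorem IsGeodesicWeights.card_edgePoints_le [NeZero n] (h : IsGeodesicWeights A c F w)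
    {φ : ZMod n → Fin 4 → ℝ} (hφ : ∀ i, φ i ⬝ᵥ w i = 0 ∧ φ i ⬝ᵥ w (i + 1) = 0) {x : ZMod n → ℕ}
    (hinj : ∀ i j, F i = F j → x i = x j → i = j) {f g k l : Fin 4} (hkl : IsCommonEdge f g k l)
    {S : Finset ℕ} (hS : ∀ i, F i = g → ∀ s t, 0 < s → 0 < t → s * φ i k + t * φ i l = 0 → x i ∈ S) :
    (edgePoints w k l).card ≤ S.card := by
  -- `a j` is the arc on the face `g` that has the end `j`.
  let a : ZMod n → ZMod n := fun j => if F j = g then j else j - 1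
  have ha : ∀ j ∈ edgePoints w k l, F (a j) = g ∧ φ (a j) ⬝ᵥ w j = 0 := by
    intro j hj
    have e0 := (hφ (j - 1)).2
    rw [sub_add_cancel] at e0
    rcases h.faces hkl hj with ⟨e1, e2⟩ | ⟨e1, e2⟩
    · simp only [a, e2, if_true, true_and]; exact (hφ j).1
    · simp only [a, e2, hkl.1, if_false, e1, true_and]; exact e0
  refine Finset.card_le_card_of_injOn (fun j => x (a j)) (fun j hj => ?_) fun j hj j' hj' e => ?_
  · obtain ⟨h1, h2⟩ := ha j hj
    obtain ⟨p1, p2⟩ := IsGeodesicWeights.mem_edgePoints.1 hj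
    have z1 : w j f = 0 ∧ w j g = 0 := by
      have h5 := h.left j
      have h6 := h.right j
      rcases h.faces hkl hj with ⟨e1, e2⟩ | ⟨e1, e2⟩ <;> rw [e1] at h5 <;> rw [e2] at h6
      · exact ⟨h5, h6⟩
      · exact ⟨h6, h5⟩
    simp only [dotProduct] at h2
    rw [sum_fin_four hkl, z1.1, z1.2] at h2
    exact hS _ h1 _ _ p1 p2 (by linear_combination h2)
  · obtain ⟨h1, -⟩ := ha j hj
    obtain ⟨h1', -⟩ := ha j' hj'
    have e3 : a j = a j' := hinj _ _ (h1.trans h1'.symm) e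
    have e4 := h.edge_ne j
    have e5 := h.edge_ne j'
    rcases h.faces hkl hj with ⟨e1, e2⟩ | ⟨e1, e2⟩ <;>
      rcases h.faces hkl hj' with ⟨e1', e2'⟩ | ⟨e1', e2'⟩ <;>
      simp only [a, e2, e2', if_true, hkl.1, if_false] at e3
    · exact e3
    · rw [e3, sub_add_cancel, e2', ← e3, e1] at e4
      exact absurd rfl e4
    · rw [← e3, sub_add_cancel, e2, e3, e1'] at e5
      exact absurd rfl e5
    · exact sub_left_injective e3

end SphericalTetrahedron

/-! ### The sequence of faces of a line on the unfolded tetrahedron -/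

namespace SphericalTetrahedron

open Real InnerProductGeometry

/-- The label of a lattice point modulo `2`. -/
def lab (v : ZMod 2 × ZMod 2) : Fin 4 :=
  if v.2 = 0 then if v.1 = 0 then 0 else 1 else if v.1 = 0 then 2 else 3

/-- The lattice point modulo `2` with a given label. -/
def unlab (k : Fin 4) : ZMod 2 × ZMod 2 := (if k = 1 ∨ k = 3 then 1 else 0, if k = 2 ∨ k = 3 then 1 else 0)

theorem unlab_lab (v : ZMod 2 × ZMod 2) : unlab (lab v) = v := by revert v; decide

theorem lab_injective : Function.Injective lab := Function.LeftInverse.injective unlab_lab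

theorem isCommonEdge_lab (v : ZMod 2 × ZMod 2) :
    IsCommonEdge (lab (v + (1, 0))) (lab (v + (0, 1))) (lab v) (lab (v + (1, 1))) ∧
      IsCommonEdge (lab (v + (1, 0))) (lab (v + (1, 1))) (lab v) (lab (v + (0, 1))) ∧
      IsCommonEdge (lab (v + (1, 0))) (lab v) (lab (v + (0, 1))) (lab (v + (1, 1))) ∧
      IsCommonEdge (lab v) (lab (v + (1, 1))) (lab (v + (1, 0))) (lab (v + (0, 1))) ∧
      IsCommonEdge (lab v) (lab (v + (0, 1))) (lab (v + (1, 0))) (lab (v + (1, 1))) := by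
  revert v; unfold IsCommonEdge; decide

/-- The functional with the index `x` on the face opposite to the vertex with the label of `v`. -/
noncomputable def faceFunctional (p q : ℕ) (y : ℤ → ℝ) (v : ZMod 2 × ZMod 2) (x : ℤ) (k : Fin 4) : ℝ :=
  -- The vertices of the triangle have the levels x, x - (p + q), x - q of the function p a - q b;
  -- the line runs between the levels -1 and 0.
  if unlab k = v + (1, 0) then y x else if unlab k = v + (0, 1) then y (x - (p + q : ℕ)) else
    if unlab k = v + (1, 1) then y (x - q) else 0

theorem faceFunctional_one_zero (p q : ℕ) (y : ℤ → ℝ) {v z : ZMod 2 × ZMod 2} {x k : ℤ}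
    (hz : z = v + (1, 0)) (hk : x = k) : faceFunctional p q y v x (lab z) = y k := by
  simp [faceFunctional, unlab_lab, hz, hk]

theorem faceFunctional_zero_one (p q : ℕ) (y : ℤ → ℝ) {v z : ZMod 2 × ZMod 2} {x k : ℤ}
    (hz : z = v + (0, 1)) (hk : x - (p + q : ℕ) = k) :
    faceFunctional p q y v x (lab z) = y k := by
  rw [faceFunctional, unlab_lab, hz, hk]
  simp

theorem faceFunctional_one_one (p q : ℕ) (y : ℤ → ℝ) {v z : ZMod 2 × ZMod 2} {x k : ℤ}
    (hz : z = v + (1, 1)) (hk : x - q = k) : faceFunctional p q y v x (lab z) = y k := by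
  simp [faceFunctional, unlab_lab, hz, hk]

/-- The left vertex, modulo `2`, of the `u`-th diagonal edge crossed by the line. -/
def leftVertex (p q u : ℕ) : ZMod 2 × ZMod 2 :=
  -- Modulo 2 this is (u - b, b) with b = ⌊pu / (p + q)⌋, a lattice point of level pu mod (p + q).
  ((u + p * u / (p + q) : ℕ), (p * u / (p + q) : ℕ))

/-- The lattice point labelling the face that contains the `i`-th arc. -/
def facePoint (p q i : ℕ) : ZMod 2 × ZMod 2 :=
  if i % 2 = 0 then leftVertex p q (i / 2) + (1, 0) else leftVertex p q (i / 2 + 1) + (0, 1)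

/-- The index of the `i`-th arc on its face. -/
def arcIndex (p q i : ℕ) : ℕ :=
  -- Odd arcs lie in triangles of the other orientation. A half-turn replaces the level k by -1 - k
  -- and brings them to the same form.
  if i % 2 = 0 then p * (i / 2) % (p + q) else p + q - 1 - p * (i / 2 + 1) % (p + q)

section

variable {p q : ℕ}

theorem leftVertex_succ (hq : 0 < q) (u : ℕ) :
    (p * u % (p + q) < q ∧ p * (u + 1) % (p + q) = p * u % (p + q) + p ∧
        leftVertex p q (u + 1) = leftVertex p q u + (1, 0)) ∨
      (q ≤ p * u % (p + q) ∧ p * (u + 1) % (p + q) + q = p * u % (p + q) ∧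
        leftVertex p q (u + 1) = leftVertex p q u + (0, 1)) := by
  rcases rotation_succ p q u hq with ⟨h1, h2, h3⟩ | ⟨h1, h2, h3⟩
  · refine Or.inl ⟨h1, h2, ?_⟩
    rw [leftVertex, leftVertex, h3]
    ext <;> simp
    ring
  · refine Or.inr ⟨h1, h2, ?_⟩
    rw [leftVertex, leftVertex, h3]
    have : (2 : ZMod 2) = 0 := by decide
    ext <;> simp
    linear_combination this

theorem facePoint_even (p q u : ℕ) : facePoint p q (2 * u) = leftVertex p q u + (1, 0) := by
  simp [facePoint]

theorem facePoint_odd (p q u : ℕ) : facePoint p q (2 * u + 1) = leftVertex p q (u + 1) + (0, 1) := by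
  simp [facePoint, Nat.add_mod, show (2 * u + 1) / 2 = u by omega]

theorem arcIndex_even (p q u : ℕ) : arcIndex p q (2 * u) = p * u % (p + q) := by
  simp [arcIndex]

theorem arcIndex_odd (p q u : ℕ) :
    arcIndex p q (2 * u + 1) = p + q - 1 - p * (u + 1) % (p + q) := by
  simp [arcIndex, Nat.add_mod, show (2 * u + 1) / 2 = u by omega]

theorem arcIndex_lt (hq : 0 < q) (i : ℕ) : arcIndex p q i < p + q := by
  have := Nat.mod_lt (p * (i / 2)) (show p + q > 0 by omega)
  unfold arcIndex
  split_ifs <;> omega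

/-- After 2(p + q) diagonals the lattice point has moved by (2q, 2p), which is zero modulo 2; there
are two arcs per diagonal. -/
theorem index_periodic (hq : 0 < q) (i : ℕ) :
    facePoint p q (i + 4 * (p + q)) = facePoint p q i ∧
      arcIndex p q (i + 4 * (p + q)) = arcIndex p q i := by
  have hN : 0 < p + q := by omega
  have e1 : ∀ u, p * (u + 2 * (p + q)) % (p + q) = p * u % (p + q) := fun u => by
    rw [show p * (u + 2 * (p + q)) = p * u + (p + q) * (2 * p) by ring, Nat.add_mul_mod_self_left]
  have e2 : ∀ u, leftVertex p q (u + 2 * (p + q)) = leftVertex p q u := fun u => by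
    unfold leftVertex
    rw [show p * (u + 2 * (p + q)) = p * u + (p + q) * (2 * p) by ring,
      Nat.add_mul_div_left _ _ hN]
    have : (2 : ZMod 2) = 0 := by decide
    ext
    · push_cast; linear_combination (2 * p + q : ZMod 2) * this
    · push_cast; linear_combination (p : ZMod 2) * this
  unfold facePoint arcIndex
  rw [show (i + 4 * (p + q)) % 2 = i % 2 by omega,
    show (i + 4 * (p + q)) / 2 = i / 2 + 2 * (p + q) by omega, add_right_comm, e1, e2, e1, e2]
  exact ⟨rfl, rfl⟩

/-- The level p a - q b modulo 2, where signs disappear. -/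
theorem leftVertex_parity (p q u : ℕ) :
    ((p * u % (p + q) : ℕ) : ZMod 2) = p * (leftVertex p q u).1 + q * (leftVertex p q u).2 := by
  have h := congrArg (Nat.cast : ℕ → ZMod 2) (Nat.div_add_mod (p * u) (p + q))
  simp only [Nat.cast_add, Nat.cast_mul] at h
  simp only [leftVertex, Nat.cast_add]
  have : (2 : ZMod 2) = 0 := by decide
  linear_combination h - ((p * u / (p + q) : ℕ) : ZMod 2) * (p + q) * this

theorem eq_of_leftVertex_eq (hpq : Nat.Coprime p q) (hq : 0 < q) {u u' : ℕ} (h1 : u ≤ u')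
    (h2 : u' < u + 2 * (p + q)) (h3 : p * u % (p + q) = p * u' % (p + q))
    (h4 : leftVertex p q u = leftVertex p q u') : u = u' := by
  have hN : 0 < p + q := by omega
  have hc : Nat.gcd (p + q) p = 1 := by
    have : Nat.Coprime p (p + q) := by simpa using hpq
    exact this.symm
  have h5 : u ≡ u' [MOD p + q] := Nat.ModEq.cancel_left_of_coprime hc h3
  obtain ⟨m, hm⟩ := (Nat.modEq_iff_dvd' h1).1 h5
  have hm2 : m < 2 := by
    by_contra hcon
    have : (p + q) * 2 ≤ (p + q) * m := Nat.mul_le_mul_left _ (by omega)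
    omega
  interval_cases m
  · omega
  -- A shift by p + q diagonals moves the lattice point by (q, p), which is nonzero modulo 2 by
  -- coprimality.
  · exfalso
    obtain rfl : u' = u + (p + q) := by omega
    unfold leftVertex at h4
    rw [show p * (u + (p + q)) = p * u + (p + q) * p by ring, Nat.add_mul_div_left _ _ hN,
      Prod.mk.injEq] at h4
    obtain ⟨a1, a2⟩ := h4
    push_cast at a1 a2
    have two : (2 : ZMod 2) = 0 := by decide
    have b1 : (p : ZMod 2) = 0 := by linear_combination -a2
    have b2 : (q : ZMod 2) = 0 := by linear_combination -a1 - (p : ZMod 2) * two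
    rw [ZMod.natCast_eq_zero_iff] at b1 b2
    have := Nat.dvd_gcd b1 b2
    rw [hpq] at this
    omega

/-- Equal faces force the sum of the two levels to have the parity of p + q, whereas equal indices
make it p + q - 1. -/
theorem not_even_odd (hq : 0 < q) (u u' : ℕ)
    (h1 : leftVertex p q u + (1, 0) = leftVertex p q u' + (0, 1))
    (h2 : p * u % (p + q) = p + q - 1 - p * u' % (p + q)) : False := by
  have hlt := Nat.mod_lt (p * u') (show p + q > 0 by omega)
  have e1 := leftVertex_parity p q u
  have e2 := leftVertex_parity p q u'
  have e3 : leftVertex p q u = leftVertex p q u' + (1, 1) := by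
    revert h1; generalize leftVertex p q u = a; generalize leftVertex p q u' = b
    revert a b; decide
  have e4 : p * u % (p + q) + p * u' % (p + q) + 1 = p + q := by omega
  have e5 := congrArg (Nat.cast : ℕ → ZMod 2) e4
  have two : (2 : ZMod 2) = 0 := by decide
  simp only [Nat.cast_add, e1, e2, e3, Prod.fst_add, Prod.snd_add, Nat.cast_one] at e5
  have : (1 : ZMod 2) = 0 := by
    linear_combination e5 - (p * (leftVertex p q u').1 + q * (leftVertex p q u').2) * two
  exact absurd this (by decide)

theorem eq_of_index_eq (hpq : Nat.Coprime p q) (hq : 0 < q) {i j : ℕ} (hi : i < 4 * (p + q))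
    (hj : j < 4 * (p + q)) (h1 : facePoint p q i = facePoint p q j)
    (h2 : arcIndex p q i = arcIndex p q j) : i = j := by
  have m1 := fun u => Nat.mod_lt (p * u) (show p + q > 0 by omega)
  obtain ⟨u, rfl | rfl⟩ := Nat.even_or_odd' i <;> obtain ⟨v, rfl | rfl⟩ := Nat.even_or_odd' j
  · rw [facePoint_even, facePoint_even] at h1
    rw [arcIndex_even, arcIndex_even] at h2
    have h1 := add_right_cancel h1
    rcases le_total u v with h | h
    · rw [eq_of_leftVertex_eq hpq hq h (by omega) h2 h1]
    · rw [eq_of_leftVertex_eq hpq hq h (by omega) h2.symm h1.symm]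
  · rw [facePoint_even, facePoint_odd] at h1
    rw [arcIndex_even, arcIndex_odd] at h2
    exact (not_even_odd hq _ _ h1 h2).elim
  · rw [facePoint_even, facePoint_odd] at h1
    rw [arcIndex_even, arcIndex_odd] at h2
    exact (not_even_odd hq _ _ h1.symm h2.symm).elim
  · rw [facePoint_odd, facePoint_odd] at h1
    rw [arcIndex_odd, arcIndex_odd] at h2
    have h1 := add_right_cancel h1
    have a1 := m1 (u + 1)
    have a2 := m1 (v + 1)
    have h2 : p * (u + 1) % (p + q) = p * (v + 1) % (p + q) := by omega
    rcases le_total u v with h | h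
    · have := eq_of_leftVertex_eq hpq hq (by omega) (by omega) h2 h1
      omega
    · have := eq_of_leftVertex_eq hpq hq (by omega) (by omega) h2.symm h1.symm
      omega

/-- The crossing of an edge, in terms of the functionals on the two faces. -/
theorem crossing_step {κ : ℝ} {y : ℤ → ℝ} (hq : 0 < q) (hy : IsOddHalf y)
    (h11 : UnfoldRelation κ (p + q : ℕ) (-q) (-p) y)
    (h10 : UnfoldRelation κ p q (-(p + q : ℕ)) y)
    (h01 : UnfoldRelation κ q p (-(p + q : ℕ)) y)
    (hpos : ∀ x : ℤ, 0 ≤ x → x < (p + q : ℕ) → 0 < y x) (i : ℕ) (φ : ℕ → Fin 4 → ℝ)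
    (hφ : ∀ i, φ i = faceFunctional p q y (facePoint p q i) (arcIndex p q i)) :
    ∃ k l, IsCommonEdge (lab (facePoint p q i)) (lab (facePoint p q (i + 1))) k l ∧
      φ (i + 1) k = -φ i k ∧ φ (i + 1) l = -φ i l ∧ 0 < φ i k ∧ φ i l < 0 ∧
      φ i (lab (facePoint p q (i + 1))) - φ (i + 1) (lab (facePoint p q i)) =
        κ * (φ i k + φ i l) := by
  have hneg : ∀ x : ℤ, x < 0 → -(p + q : ℕ) ≤ x → y x < 0 := fun x h1 h2 => by
    have := hpos (-1 - x) (by omega) (by omega)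
    rw [hy] at this
    linarith
  have hlt := fun u => Nat.mod_lt (p * u) (show p + q > 0 by omega)
  obtain ⟨u, rfl | rfl⟩ := Nat.even_or_odd' i
  · rw [hφ, hφ, facePoint_even, facePoint_odd, arcIndex_even, arcIndex_odd]
    have hx := hlt u
    have hx' := hlt (u + 1)
    rcases leftVertex_succ hq u with ⟨h1, h2, h3⟩ | ⟨h1, h2, h3⟩
    -- The third vertex, of level x - q < 0, is below the line, so the edge from the left vertex to
    -- it is crossed.
    · rw [h3, h2] at *
      generalize leftVertex p q u = V
      generalize p * u % (p + q) = x at *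
      have a1 : V + (1, 0) + (0, 1) = V + (1, 1) := by clear * -; revert V; decide
      rw [a1]
      refine ⟨lab V, lab (V + (0, 1)), (isCommonEdge_lab V).2.1, ?_⟩
      have b1 : faceFunctional p q y (V + (1, 0)) x (lab V) = y (x) :=
        faceFunctional_one_zero p q y (by clear * -; revert V; decide) rfl
      have b2 : faceFunctional p q y (V + (1, 0)) x (lab (V + (0, 1))) = y (x - q) :=
        faceFunctional_one_one p q y (by clear * -; revert V; decide) rfl
      have b3 : faceFunctional p q y (V + (1, 0)) x (lab (V + (1, 1))) = y (x + -(p + q : ℕ)) :=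
        faceFunctional_zero_one p q y (by clear * -; revert V; decide) (by omega)
      have b4 : faceFunctional p q y (V + (1, 1)) (p + q - 1 - (x + p) : ℕ) (lab (V + (1, 0))) = y (-1 - (x + p)) :=
        faceFunctional_zero_one p q y (by clear * -; revert V; decide) (by omega)
      have b5 : faceFunctional p q y (V + (1, 1)) (p + q - 1 - (x + p) : ℕ) (lab V) = y (-1 - x) :=
        faceFunctional_one_one p q y (by clear * -; revert V; decide) (by omega)
      have b6 : faceFunctional p q y (V + (1, 1)) (p + q - 1 - (x + p) : ℕ) (lab (V + (0, 1))) = y (-1 - (x - q)) :=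
        faceFunctional_one_zero p q y (by clear * -; revert V; decide) (by omega)
      rw [hy] at b4 b5 b6
      rw [b1, b2, b3, b4, b5, b6]
      refine ⟨rfl, rfl, hpos _ (by omega) (by omega), hneg _ (by omega) (by omega), ?_⟩
      linear_combination h01 x (by omega) (by omega)
    -- Now x is the level of the next left vertex, which is the third vertex of the triangle; the
    -- current left vertex has level x + q.
    · obtain ⟨x, hx1⟩ : ∃ x, x = p * (u + 1) % (p + q) := ⟨_, rfl⟩
      rw [← hx1] at h2 hx' ⊢
      rw [← h2] at hx ⊢
      rw [h3]
      clear hx1 h1 h2 h3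
      generalize leftVertex p q u = V
      have a1 : V + (0, 1) + (0, 1) = V := by clear * -; revert V; decide
      rw [a1]
      refine ⟨lab (V + (0, 1)), lab (V + (1, 1)), (isCommonEdge_lab V).2.2.1, ?_⟩
      have b1 : faceFunctional p q y (V + (1, 0)) (x + q : ℕ) (lab V) = y (x + q) :=
        faceFunctional_one_zero p q y (by clear * -; revert V; decide) (by omega)
      have b2 : faceFunctional p q y (V + (1, 0)) (x + q : ℕ) (lab (V + (0, 1))) = y (x) :=
        faceFunctional_one_one p q y (by clear * -; revert V; decide) (by omega)
      have b3 : faceFunctional p q y (V + (1, 0)) (x + q : ℕ) (lab (V + (1, 1))) = y (x - p) :=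
        faceFunctional_zero_one p q y (by clear * -; revert V; decide) (by omega)
      have b4 : faceFunctional p q y V (p + q - 1 - x : ℕ) (lab (V + (1, 0))) = y (-1 - (x + -(p + q : ℕ))) :=
        faceFunctional_one_zero p q y (by clear * -; revert V; decide) (by omega)
      have b5 : faceFunctional p q y V (p + q - 1 - x : ℕ) (lab (V + (0, 1))) = y (-1 - x) :=
        faceFunctional_zero_one p q y (by clear * -; revert V; decide) (by omega)
      have b6 : faceFunctional p q y V (p + q - 1 - x : ℕ) (lab (V + (1, 1))) = y (-1 - (x - p)) :=
        faceFunctional_one_one p q y (by clear * -; revert V; decide) (by omega)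
      rw [hy] at b4 b5 b6
      rw [b1, b2, b3, b4, b5, b6]
      refine ⟨rfl, rfl, hpos _ (by omega) (by omega), hneg _ (by omega) (by omega), ?_⟩
      linear_combination h10 x (by omega) (by omega)
  · rw [hφ, hφ, show 2 * u + 1 + 1 = 2 * (u + 1) by ring, facePoint_even, facePoint_odd,
      arcIndex_even, arcIndex_odd]
    have hx := hlt (u + 1)
    generalize leftVertex p q (u + 1) = V
    generalize p * (u + 1) % (p + q) = x at *
    refine ⟨lab (V + (1, 1)), lab V, (isCommonEdge_lab V).1.swap_faces.swap_ends, ?_⟩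
    rw [faceFunctional_zero_one p q y (z := V + (1, 1)) (k := x - (p + q : ℕ))
        (by clear * -; revert V; decide) rfl,
      faceFunctional_one_zero p q y (z := V) (k := x) (by clear * -; revert V; decide) rfl,
      faceFunctional_one_one p q y (z := V + (0, 1)) (k := x + -q)
        (by clear * -; revert V; decide) (by omega),
      faceFunctional_one_zero p q y (z := V + (1, 1)) (k := -1 - (x - (p + q : ℕ)))
        (by clear * -; revert V; decide) (by omega),
      faceFunctional_zero_one p q y (z := V) (k := -1 - x)
        (by clear * -; revert V; decide) (by omega),
      faceFunctional_one_one p q y (z := V + (1, 0)) (k := -1 - (x + -p))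
        (by clear * -; revert V; decide) (by omega), hy, hy, hy]
    have e1 := hneg (x - (p + q : ℕ)) (by omega) (by omega)
    have e2 := hpos x (by omega) (by omega)
    refine ⟨(neg_neg _).symm, (neg_neg _).symm, by linarith, by linarith, ?_⟩
    linear_combination -h11 x (by omega) (by omega)

theorem facePoint_ne (hq : 0 < q) (i : ℕ) : facePoint p q i ≠ facePoint p q (i + 2) := by
  obtain ⟨u, rfl | rfl⟩ := Nat.even_or_odd' i
  · rw [show 2 * u + 2 = 2 * (u + 1) by ring, facePoint_even, facePoint_even]
    rcases leftVertex_succ hq u with ⟨-, -, h3⟩ | ⟨-, -, h3⟩ <;> rw [h3] <;>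
      generalize leftVertex p q u = V <;> revert V <;> decide
  · rw [show 2 * u + 1 + 2 = 2 * (u + 1) + 1 by ring, facePoint_odd, facePoint_odd]
    rcases leftVertex_succ hq (u + 1) with ⟨-, -, h3⟩ | ⟨-, -, h3⟩ <;> rw [h3] <;>
      generalize leftVertex p q (u + 1) = V <;> revert V <;> decide

end

end SphericalTetrahedron

/-! ### Existence -/

namespace SphericalTetrahedron

open Real InnerProductGeometry

theorem lab_unlab (k : Fin 4) : lab (unlab k) = k := by revert k; decide

section

variable {p q : ℕ}

/-- Since y increases, the functionals on one face are ordered by their index, which keeps the arcs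
disjoint. -/
theorem faceFunctional_lt {y : ℤ → ℝ}
    (hy : ∀ j k : ℤ, -(p + q : ℕ) ≤ j → j < k → k < (p + q : ℕ) → y j < y k)
    (v : ZMod 2 × ZMod 2) {a b : ℕ} (hab : a < b) (hb : b < p + q) {k : Fin 4} (hk : k ≠ lab v) :
    faceFunctional p q y v a k < faceFunctional p q y v b k := by
  unfold faceFunctional
  split_ifs with h1 h2 h3
  · exact hy _ _ (by omega) (by omega) (by omega)
  · exact hy _ _ (by omega) (by omega) (by omega)
  · exact hy _ _ (by omega) (by omega) (by omega)
  · rw [← lab_unlab k] at hk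
    revert hk h1 h2 h3
    generalize unlab k = z
    clear * -
    revert v z
    decide

theorem natCast_val_periodic (hq : 0 < q) (k : ℕ) :
    facePoint p q (k : ZMod (4 * (p + q))).val = facePoint p q k ∧
      arcIndex p q (k : ZMod (4 * (p + q))).val = arcIndex p q k := by
  rw [ZMod.val_natCast]
  exact ⟨Function.Periodic.map_mod_nat (fun i => (index_periodic hq i).1) k,
    Function.Periodic.map_mod_nat (fun i => (index_periodic hq i).2) k⟩

/-- On a regular tetrahedron that is close enough to a flat one, there is a simple closed geodesic
with `p`, `q` and `p + q` points on the pairs of opposite edges. -/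
theorem IsRegularFrame.exists_isSimpleClosedGeodesic {A : Fin 4 → E4} {c : ℝ}
    (hA : IsRegularFrame A c) (hpq : Nat.Coprime p q) (hq : 0 < q)
    (hsmall : 64 * (p + q : ℝ) ^ 3 * (1 - 2 * (c / (1 + c))) < 1) :
    ∃ γ, IsSimpleClosedGeodesic A γ ∧
      (∀ k l, unlab l = unlab k + (1, 0) → edgeCount A γ k l = p) ∧
      (∀ k l, unlab l = unlab k + (0, 1) → edgeCount A γ k l = q) ∧
      (∀ k l, unlab l = unlab k + (1, 1) → edgeCount A γ k l = p + q) := by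
  have hκ : 2 * (c / (1 + c)) ≤ 1 := by
    have h0 := hA.pos
    have h1 := hA.lt_one
    rw [← mul_div_assoc, div_le_one (by linarith)]
    linarith
  obtain ⟨y, hodd, h11, h10, h01, C, hC, hyC⟩ := exists_profile hpq hq hκ hsmall
  have hmono : ∀ j k : ℤ, -(p + q : ℕ) ≤ j → j < k → k < (p + q : ℕ) → y j < y k := by
    intro j k h1 h2 h3
    have e1 := (abs_lt.1 (hyC j h1 (by omega))).2
    have e2 := (abs_lt.1 (hyC k (by omega) h3)).1
    have e3 : (j : ℝ) + 1 ≤ k := by exact_mod_cast h2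
    nlinarith
  have hpos : ∀ x : ℤ, 0 ≤ x → x < (p + q : ℕ) → 0 < y x := by
    intro x h1 h2
    have e2 := (abs_lt.1 (hyC x (by omega) h2)).1
    have e3 : (0 : ℝ) ≤ x := by exact_mod_cast h1
    nlinarith
  have hneg : ∀ x : ℤ, x < 0 → -(p + q : ℕ) ≤ x → y x < 0 := fun x h1 h2 => by
    have := hpos (-1 - x) (by omega) (by omega)
    rw [hodd] at this
    linarith
  have : NeZero (4 * (p + q)) := ⟨by omega⟩
  let F : ZMod (4 * (p + q)) → Fin 4 := fun i => lab (facePoint p q i.val)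
  let φ : ZMod (4 * (p + q)) → Fin 4 → ℝ := fun i =>
    faceFunctional p q y (facePoint p q i.val) (arcIndex p q i.val)
  have hF : ∀ k : ℕ, F k = lab (facePoint p q k) := fun k => by
    simp only [F]; rw [(natCast_val_periodic hq k).1]
  have hφ : ∀ k : ℕ, φ k = faceFunctional p q y (facePoint p q k) (arcIndex p q k) := fun k => by
    simp only [φ]; rw [(natCast_val_periodic hq k).1, (natCast_val_periodic hq k).2]
  have hcast : ∀ i : ZMod (4 * (p + q)), ∃ k : ℕ, i - 1 = k ∧ i = (k + 1 : ℕ) ∧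
      i + 1 = (k + 2 : ℕ) := fun i => by
    refine ⟨(i - 1).val, by simp, by simp, ?_⟩
    push_cast
    rw [ZMod.natCast_zmod_val]
    ring
  have hfun : IsGeodesicFunctional c F φ := by
    have hcross : ∀ i, ∃ k l, IsCommonEdge (F (i - 1)) (F i) k l ∧
        φ i k = -φ (i - 1) k ∧ φ i l = -φ (i - 1) l ∧ 0 < φ (i - 1) k ∧ φ (i - 1) l < 0 ∧
        φ (i - 1) (F i) - φ i (F (i - 1)) = 2 * (c / (1 + c)) * (φ (i - 1) k + φ (i - 1) l) := by
      intro i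
      obtain ⟨k, h1, h2, -⟩ := hcast i
      rw [h1, h2, hF, hF, hφ, hφ]
      exact crossing_step hq hodd h11 h10 h01 hpos k _ (fun _ => rfl)
    refine ⟨fun i => ?_, fun i => ?_, hcross⟩
    · obtain ⟨k, l, h, -⟩ := hcross i
      exact h.1
    · obtain ⟨k, h1, -, h3⟩ := hcast i
      rw [h1, h3, hF, hF]
      exact fun h => facePoint_ne hq k (lab_injective h)
  obtain ⟨w, hw, hφw⟩ := hfun.exists_weights hA
  have hinj : ∀ i j : ZMod (4 * (p + q)), F i = F j →
      arcIndex p q i.val = arcIndex p q j.val → i = j := fun i j h1 h2 =>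
    ZMod.val_injective _ (eq_of_index_eq hpq hq (ZMod.val_lt i) (ZMod.val_lt j)
      (lab_injective h1) h2)
  have hs : IsSimpleWeights A c F w := by
    refine hw.isSimpleWeights hφw fun i j hij h => ?_
    have hv : facePoint p q i.val = facePoint p q j.val := lab_injective h
    rcases lt_or_gt_of_ne (fun h' => hij (hinj i j h h')) with h' | h'
    · left
      intro v hv'
      simp only [φ, ← hv]
      exact faceFunctional_lt hmono _ h' (arcIndex_lt hq _) hv'
    · right
      intro v hv'
      simp only [φ, ← hv]
      exact faceFunctional_lt hmono _ h' (arcIndex_lt hq _) hv'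
  have hval : ∀ (i : ZMod (4 * (p + q))) (V : ZMod 2 × ZMod 2), F i = lab V →
      φ i = faceFunctional p q y V (arcIndex p q i.val) := fun i V h => by
    simp only [φ]; rw [lab_injective h]
  have hlt : ∀ i : ZMod (4 * (p + q)), arcIndex p q i.val < p + q := fun i => arcIndex_lt hq _
  -- For an index of at least `q` the functional is positive at both ends of this edge, so the arc
  -- misses it.
  have cq : ∀ V, (edgePoints w (lab (V + (1, 0))) (lab (V + (1, 1)))).card ≤ q := by
    intro V
    refine (hw.card_edgePoints_le hφw hinj (isCommonEdge_lab V).2.2.2.2.swap_faces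
      (S := Finset.range q) fun i hi s t h1 h2 h3 => ?_).trans_eq (Finset.card_range q)
    rw [hval i V hi, faceFunctional_one_zero p q y rfl rfl,
      faceFunctional_one_one p q y rfl rfl] at h3
    by_contra h
    rw [Finset.mem_range, not_lt] at h
    have := hlt i
    have := mul_pos h1 (hpos (arcIndex p q i.val) (by omega) (by omega))
    have := mul_pos h2 (hpos (arcIndex p q i.val - q) (by omega) (by omega))
    linarith
  have cp : ∀ V, (edgePoints w (lab (V + (0, 1))) (lab (V + (1, 1)))).card ≤ p := by
    intro V
    refine (hw.card_edgePoints_le hφw hinj (isCommonEdge_lab V).2.2.1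
      (S := Finset.Ico q (p + q)) fun i hi s t h1 h2 h3 => ?_).trans_eq (by simp)
    rw [hval i V hi, faceFunctional_zero_one p q y rfl rfl,
      faceFunctional_one_one p q y rfl rfl] at h3
    have := hlt i
    by_contra h
    rw [Finset.mem_Ico] at h
    have := mul_neg_of_pos_of_neg h1 (hneg (arcIndex p q i.val - (p + q : ℕ)) (by omega) (by omega))
    have := mul_neg_of_pos_of_neg h2 (hneg (arcIndex p q i.val - q) (by omega) (by omega))
    linarith
  have cN : ∀ V, (edgePoints w (lab (V + (1, 0))) (lab (V + (0, 1)))).card ≤ p + q := by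
    intro V
    refine (hw.card_edgePoints_le hφw hinj (isCommonEdge_lab V).2.2.2.1.swap_faces
      (S := Finset.range (p + q)) fun i hi s t h1 h2 h3 => ?_).trans_eq (Finset.card_range _)
    exact Finset.mem_range.2 (hlt i)
  have bq : ∀ k l, unlab l = unlab k + (0, 1) → (edgePoints w k l).card ≤ q := by
    intro k l h
    have := cq (unlab k + (1, 0))
    rwa [show unlab k + (1, 0) + (1, 0) = unlab k by clear * -; revert k; decide,
      show unlab k + (1, 0) + (1, 1) = unlab l by rw [h]; clear * -; revert k; decide,
      lab_unlab, lab_unlab] at this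
  have bp : ∀ k l, unlab l = unlab k + (1, 0) → (edgePoints w k l).card ≤ p := by
    intro k l h
    have := cp (unlab k + (0, 1))
    rwa [show unlab k + (0, 1) + (0, 1) = unlab k by clear * -; revert k; decide,
      show unlab k + (0, 1) + (1, 1) = unlab l by rw [h]; clear * -; revert k; decide,
      lab_unlab, lab_unlab] at this
  have bN : ∀ k l, unlab l = unlab k + (1, 1) → (edgePoints w k l).card ≤ p + q := by
    intro k l h
    have := cN (unlab k + (1, 0))
    rwa [show unlab k + (1, 0) + (1, 0) = unlab k by clear * -; revert k; decide,
      show unlab k + (1, 0) + (0, 1) = unlab l by rw [h]; clear * -; revert k; decide,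
      lab_unlab, lab_unlab] at this
  -- Over ordered pairs the upper bounds add up to 8(p + q), twice the number of vertices, so all of
  -- them are equalities.
  have hsum := hw.sum_card_edgePoints
  simp only [Fin.sum_univ_four] at hsum
  simp at hsum
  have p1 := bp 0 1 (by decide)
  have p2 := bp 1 0 (by decide)
  have p3 := bp 2 3 (by decide)
  have p4 := bp 3 2 (by decide)
  have q1 := bq 0 2 (by decide)
  have q2 := bq 2 0 (by decide)
  have q3 := bq 1 3 (by decide)
  have q4 := bq 3 1 (by decide)
  have r1 := bN 0 3 (by decide)
  have r2 := bN 3 0 (by decide)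
  have r3 := bN 1 2 (by decide)
  have r4 := bN 2 1 (by decide)
  refine ⟨trace A w, hs.isSimpleClosedGeodesic hA (by omega), fun k l h => ?_, fun k l h => ?_,
    fun k l h => ?_⟩ <;>
  · rw [hs.edgeCount_trace hA (by rintro rfl; revert h; clear * -; revert k; decide)]
    revert h
    fin_cases k <;> fin_cases l <;> first
      | exact fun h => absurd h (by decide)
      | (intro _; simp only [Fin.reduceFinMk, Fin.zero_eta, Fin.mk_one, Fin.isValue]; omega)

end

end SphericalTetrahedron

/-! ### The bound on the angle -/

namespace SphericalTetrahedron

open Real InnerProductGeometry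

theorem nine_tenths_le_cos : 9 / 10 ≤ cos (π / 12) := by
  have h := one_sub_sq_div_two_le_cos (x := π / 12)
  have h1 := pi_lt_d2
  have h2 := pi_pos
  nlinarith

/-- The left side is 1 - cos ε + √3 sin ε ≤ ε²/2 + 7ε/4, and ε²/2 ≤ ε/4. -/
theorem one_sub_two_mul_cos_le {ε : ℝ} (h0 : 0 ≤ ε) (h1 : ε ≤ 1 / 2) :
    1 - 2 * cos (π / 3 + ε) ≤ 2 * ε := by
  rw [cos_add, cos_pi_div_three, sin_pi_div_three]
  have h2 := one_sub_sq_div_two_le_cos (x := ε)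
  have h3 := sin_le h0
  have h4 : √3 ≤ 7 / 4 := by rw [sqrt_le_left (by norm_num)]; norm_num
  have h5 : √3 * sin ε ≤ 7 / 4 * ε := by
    calc √3 * sin ε ≤ √3 * ε := by gcongr
      _ ≤ _ := by gcongr
  nlinarith

section

variable {p q : ℕ}

theorem add_eq_one_or_three_le (hpq : Nat.Coprime p q) (hlt : p < q) :
    (p = 0 ∧ q = 1) ∨ 3 ≤ p + q := by
  by_cases h : 3 ≤ p + q
  · exact Or.inr h
  · left
    obtain rfl : p = 0 := by omega
    simpa using hpq

/-- The quotient is 2 + 1/d with d the denominator. If p + q ≥ 3, then d ≤ -7, since the tangents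
contribute at least 1. For (0, 1) they contribute 0, by the convention at π/2, and d > 0. -/
theorem le_cZero (hpq : Nat.Coprime p q) (hlt : p < q) : 13 / 7 ≤ cZero p q := by
  have hc := nine_tenths_le_cos
  have hpi := pi_gt_d2
  have hN : (0 : ℝ) < p + q := by exact_mod_cast (show 0 < p + q by omega)
  have hX : (p + q + 2 : ℝ) / (π * cos (π / 12) * (p + q) ^ 2) =
      2 * ((p + q + 2) / (2 * π * cos (π / 12) * (p + q) ^ 2)) := by
    field_simp
  have hX0 : (0 : ℝ) ≤ (p + q + 2) / (2 * π * cos (π / 12) * (p + q) ^ 2) := by positivity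
  have hD : ∀ x S : ℝ, 1 - x - 8 * S ≠ 0 →
      (3 - 2 * x - 16 * S) / (1 - x - 8 * S) = 2 + 1 / (1 - x - 8 * S) := by
    intro x S h
    rw [div_eq_iff h, add_mul, one_div, inv_mul_cancel₀ h]
    ring
  unfold cZero
  rw [hX]
  rcases add_eq_one_or_three_le hpq hlt with ⟨rfl, rfl⟩ | h
  · have hS : tanSum 0 1 = 0 := by
      simp [tanSum, Finset.sum_range_succ]
    rw [hS]
    have : ((0 : ℕ) + (1 : ℕ) + 2 : ℝ) / (2 * π * cos (π / 12) * ((0 : ℕ) + (1 : ℕ)) ^ 2) < 1 := by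
      rw [div_lt_one (by positivity)]
      norm_num
      nlinarith
    rw [hD _ _ (by linarith)]
    have := one_div_pos.2 (sub_pos.2 this)
    rw [mul_zero, sub_zero]
    linarith
  · have hS : 1 ≤ tanSum p q := by
      -- For this index the angle lies in [π/4, π/2).
      have hmem : (p + q) / 2 + 1 ∈ Finset.range ((p + q) / 2 + 3) := by simp
      refine le_trans ?_ (Finset.single_le_sum (fun i _ => sq_nonneg _) hmem)
      refine one_le_pow₀ ?_
      rw [← tan_pi_div_four]
      have e1 : (p + q : ℝ) ≤ 2 * ((p + q) / 2 + 1 : ℕ) := by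
        exact_mod_cast (show p + q ≤ 2 * ((p + q) / 2 + 1) by omega)
      have e2 : (((p + q) / 2 + 1 : ℕ) : ℝ) < p + q := by
        exact_mod_cast (show (p + q) / 2 + 1 < p + q by omega)
      refine strictMonoOn_tan.monotoneOn ⟨by linarith, by linarith⟩ ⟨?_, ?_⟩ ?_
      · have : (0 : ℝ) ≤ π * ((p + q) / 2 + 1 : ℕ) / (2 * (p + q)) := by positivity
        linarith
      · rw [div_lt_div_iff₀ (by positivity) (by norm_num)]
        nlinarith
      · rw [div_le_div_iff₀ (by norm_num) (by positivity)]
        nlinarith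
    set x := (p + q + 2 : ℝ) / (2 * π * cos (π / 12) * (p + q) ^ 2)
    have h7 : 1 - x - 8 * tanSum p q ≤ -7 := by linarith
    rw [hD _ _ (by linarith)]
    have : 1 / (-7 : ℝ) ≤ 1 / (1 - x - 8 * tanSum p q) :=
      one_div_le_one_div_of_neg_of_le (by norm_num) h7
    linarith

theorem cAngle_pos (p q j : ℕ) : 0 < cAngle p q j := by
  have hc := nine_tenths_le_cos
  unfold cAngle
  positivity

theorem cLen_nonneg (p q i : ℕ) : 0 ≤ cLen p q i := by
  have hc := nine_tenths_le_cos
  unfold cLen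
  positivity

/-- One term is enough: the index ⌊(p + q)/2⌋ gives the factor 4 · (9/10) · (49/5) > 35. For p + q =
1 that term has denominator zero, and the index 1 is taken. -/
theorem le_sum_cLen_add (hpq : Nat.Coprime p q) (hlt : p < q) :
    35 * (p + q : ℝ) ^ 2 ≤ ∑ i ∈ Finset.range ((p + q) / 2 + 3),
        (cLen p q i + ∑ j ∈ Finset.range (i + 1), cAngle p q j) := by
  have hc := nine_tenths_le_cos
  have hpi := pi_gt_d2
  have key : ∀ i, i < (p + q) / 2 + 3 → cLen p q i ≤ ∑ i ∈ Finset.range ((p + q) / 2 + 3),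
        (cLen p q i + ∑ j ∈ Finset.range (i + 1), cAngle p q j) := by
    intro i hi
    have hs : ∀ i, 0 ≤ ∑ j ∈ Finset.range (i + 1), cAngle p q j := fun i =>
      Finset.sum_nonneg fun j _ => (cAngle_pos p q j).le
    refine le_trans ?_ (Finset.single_le_sum (fun i _ => add_nonneg (cLen_nonneg p q i) (hs i))
      (Finset.mem_range.2 hi))
    linarith [hs i]
  have hpi2 : 49 / 5 ≤ π ^ 2 := by nlinarith
  rcases add_eq_one_or_three_le hpq hlt with ⟨rfl, rfl⟩ | h
  · refine le_trans ?_ (key 1 (by norm_num))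
    norm_num [cLen]
    nlinarith
  · refine le_trans ?_ (key ((p + q) / 2) (by omega))
    unfold cLen
    set i : ℕ := (p + q) / 2
    have e1 : (p + q : ℝ) ≤ 2 * i + 1 := by
      exact_mod_cast (show p + q ≤ 2 * i + 1 by omega)
    have e2 : (i : ℝ) + 2 ≤ p + q := by exact_mod_cast (show i + 2 ≤ p + q by omega)
    have e3 : (0 : ℝ) < p + q - i - 1 := by linarith
    have e4 : (p + q - i - 1 : ℝ) ^ 2 ≤ ((p + q) / 2) ^ 2 := by
      refine pow_le_pow_left₀ e3.le (by linarith) 2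
    rw [le_div_iff₀ (by positivity)]
    have e5 : (p + q : ℝ) ^ 2 ≤ (2 * i + 1) ^ 2 := pow_le_pow_left₀ (by positivity) e1 2
    calc 35 * (p + q : ℝ) ^ 2 * (p + q - i - 1) ^ 2
        ≤ 35 * (p + q : ℝ) ^ 2 * ((p + q) / 2) ^ 2 := by gcongr
      _ ≤ 9 / 10 * (p + q : ℝ) ^ 2 * (49 / 5 * (p + q) ^ 2) := by
          have : 0 ≤ (p + q : ℝ) ^ 4 := by positivity
          nlinarith
      _ ≤ cos (π / 12) * (p + q) ^ 2 * (4 + π ^ 2 * (2 * i + 1) ^ 2) := by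
          have : 49 / 5 * (p + q : ℝ) ^ 2 ≤ π ^ 2 * (2 * i + 1) ^ 2 := by gcongr
          have : 49 / 5 * (p + q : ℝ) ^ 2 ≤ 4 + π ^ 2 * (2 * i + 1) ^ 2 := by linarith
          gcongr

/-- The bound on `ε` makes the tetrahedron close to a flat one. -/
theorem small_of_lt_epsBound (hpq : Nat.Coprime p q) (hlt : p < q) {ε : ℝ} (h0 : 0 < ε)
    (hε : ε < epsBound p q) : 64 * (p + q : ℝ) ^ 3 * (1 - 2 * cos (π / 3 + ε)) < 1 := by
  have hc := nine_tenths_le_cos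
  have hN : (1 : ℝ) ≤ p + q := by exact_mod_cast (show 1 ≤ p + q by omega)
  have hN2 : (1 : ℝ) ≤ (p + q) ^ 2 := one_le_pow₀ hN
  obtain ⟨h1, h2⟩ := lt_min_iff.1 hε
  have h3 : ε ≤ 1 / 2 := by
    refine h2.le.trans ?_
    rw [div_le_div_iff₀ (by positivity) (by norm_num)]
    nlinarith
  have hR : √3 / 2 * (p + q) ≤ √(p ^ 2 + q ^ 2 + p * q) := by
    refine le_sqrt_of_sq_le ?_
    rw [mul_pow, div_pow, sq_sqrt (by norm_num)]
    nlinarith [sq_nonneg (p - q : ℝ)]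
  have hc0 := le_cZero hpq hlt
  have hS := le_sum_cLen_add hpq hlt
  set S := ∑ i ∈ Finset.range ((p + q) / 2 + 3),
        (cLen p q i + ∑ j ∈ Finset.range (i + 1), cAngle p q j)
  -- 130 = 4 · (13/7) · (1/2) · 35, just above the 128 = 64 · 2 needed at the end.
  have hden : 130 * √3 * (p + q : ℝ) ^ 3 ≤ 4 * cZero p q * √(p ^ 2 + q ^ 2 + p * q) * S :=
    calc 130 * √3 * (p + q : ℝ) ^ 3
        = 4 * (13 / 7) * (√3 / 2 * (p + q)) * (35 * (p + q : ℝ) ^ 2) := by ring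
      _ ≤ _ := by gcongr
  have h4 : ε * (130 * √3 * (p + q : ℝ) ^ 3) < √3 := by
    refine (mul_le_mul_of_nonneg_left hden h0.le).trans_lt ?_
    rwa [lt_div_iff₀ (lt_of_lt_of_le (by positivity) hden)] at h1
  have h5 : ε * (130 * (p + q : ℝ) ^ 3) < 1 := by
    have : (0 : ℝ) < √3 := by positivity
    by_contra hcon
    nlinarith [not_lt.1 hcon]
  have h6 := one_sub_two_mul_cos_le h0.le h3
  have h7 : (0 : ℝ) < (p + q) ^ 3 := by positivity
  nlinarith [mul_le_mul_of_nonneg_left h6 h7.le, mul_pos h0 h7]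

end

end SphericalTetrahedron

/-! ### Symmetries of the tetrahedron -/

namespace SphericalTetrahedron

open Real InnerProductGeometry

theorem _root_.IsRegularTetrahedron.exists_isRegularFrame {A : Fin 4 → E4} {α : ℝ}
    (hA : IsRegularTetrahedron A α) (hα : 0 < cos α) :
    ∃ c, IsRegularFrame A c ∧ cos α = c / (1 + c) := by
  obtain ⟨c, hc⟩ : ∃ c, c = inner ℝ (A 0) (A 1) := ⟨_, rfl⟩
  have hself : ∀ i, inner ℝ (A i) (A i) = 1 := fun i => by
    rw [real_inner_self_eq_norm_sq, hA.norm_eq_one, one_pow]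
  have hne : ∀ i j, i ≠ j → inner ℝ (A i) (A j) = c := fun i j hij => by
    rw [hc, ← mul_one (inner ℝ (A i) (A j)), ← mul_one (inner ℝ (A 0) (A 1))]
    have := congrArg cos (hA.edges_equal i j 0 1 hij (by decide))
    simpa [cos_angle, hA.norm_eq_one] using this
  have h1 : c < 1 := by
    have h : 0 < inner ℝ (A 0 - A 1) (A 0 - A 1) :=
      real_inner_self_pos.2 (sub_ne_zero.2 (hA.linearIndependent.injective.ne (by decide)))
    rw [real_inner_sub_sub_self, hself, hself, hne _ _ (by decide)] at h
    linarith
  -- Nonnegativity of the square of A 0 + A 1 + A 2 gives c ≥ -1/2.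
  have h2 : -1 < c := by
    have h : 0 ≤ inner ℝ (A 0 + A 1 + A 2) (A 0 + A 1 + A 2) := real_inner_self_nonneg
    simp only [inner_add_left, inner_add_right, hself] at h
    rw [hne 0 1 (by decide), hne 0 2 (by decide), hne 1 0 (by decide), hne 1 2 (by decide),
      hne 2 0 (by decide), hne 2 1 (by decide)] at h
    linarith
  have hinner : ∀ i j k, i ≠ j → i ≠ k → inner ℝ (tangentTowards (A i) (A j))
      (tangentTowards (A i) (A k)) = inner ℝ (A j) (A k) - c ^ 2 := fun i j k h h' => by
    simp only [tangentTowards, inner_sub_left, inner_sub_right, real_inner_smul_left,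
      real_inner_smul_right, hself, hne i j h, hne i k h', hne j i h.symm]
    ring
  have hcos : cos α = c / (1 + c) := by
    have hnorm : ∀ j, 0 ≠ j → ‖tangentTowards (A 0) (A j)‖ = √(1 - c ^ 2) := fun j h => by
      rw [norm_eq_sqrt_real_inner, hinner 0 j j h h, hself]
    rw [← hA.planar_angle 0 1 2 (by decide) (by decide) (by decide), sphericalAngle, cos_angle,
      hinner 0 1 2 (by decide) (by decide), hne 1 2 (by decide), hnorm 1 (by decide),
      hnorm 2 (by decide), mul_self_sqrt (by nlinarith), div_eq_div_iff (by nlinarith) (by linarith)]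
    ring
  refine ⟨c, ⟨hA.linearIndependent, hself, hne, ?_, h1⟩, hcos⟩
  rw [hcos] at hα
  exact (div_pos_iff_of_pos_right (by linarith)).1 hα

/-- The inequality cos t ≤ 1 - 2t²/π² bounds arccos c by means of 1 - c. This is the length
condition for 4N arcs. -/
theorem arccos_lt_of_small {c N : ℝ} (h0 : 0 < c) (h1 : c < 1) (hN : 1 ≤ N)
    (h : 64 * N ^ 3 * (1 - 2 * (c / (1 + c))) < 1) : 4 * N * arccos c < π := by
  have h2 : 1 - 2 * (c / (1 + c)) = (1 - c) / (1 + c) := by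
    field_simp
    ring
  have h3 : 32 * N ^ 2 * (1 - c) < 1 := by
    have h4 : (1 - c) / 2 ≤ (1 - c) / (1 + c) :=
      div_le_div_of_nonneg_left (by linarith) (by linarith) (by linarith)
    have h5 : N ^ 2 ≤ N ^ 3 := pow_le_pow_right₀ hN (by norm_num)
    rw [h2] at h
    calc 32 * N ^ 2 * (1 - c) = 64 * N ^ 2 * ((1 - c) / 2) := by ring
      _ ≤ 64 * N ^ 3 * ((1 - c) / (1 + c)) := by
          have : 0 ≤ (1 - c) / 2 := by linarith
          gcongr
      _ < 1 := h
  have h6 := cos_le_one_sub_mul_cos_sq (x := arccos c)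
    (by rw [abs_of_nonneg (arccos_nonneg c)]; exact arccos_le_pi c)
  rw [cos_arccos (by linarith) h1.le] at h6
  have hpi := pi_pos
  refine lt_of_pow_lt_pow_left₀ 2 hpi.le ?_
  have h7 : 2 / π ^ 2 * arccos c ^ 2 ≤ 1 - c := by linarith
  rw [div_mul_eq_mul_div, div_le_iff₀ (by positivity)] at h7
  nlinarith [mul_le_mul_of_nonneg_left h7 (show 0 ≤ 8 * N ^ 2 by positivity),
    mul_lt_mul_of_pos_left h3 (show 0 < π ^ 2 by positivity)]

section

variable {A : Fin 4 → E4} {γ : Set E4}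

/-! ### Relabellings and isometries. -/

theorem edgeCount_comm (A : Fin 4 → E4) (γ : Set E4) (k l : Fin 4) :
    edgeCount A γ k l = edgeCount A γ l k := by
  rw [edgeCount, edgeCount, greatArc_comm]

theorem _root_.IsSimpleClosedGeodesic.comp_perm (h : IsSimpleClosedGeodesic A γ)
    (σ : Equiv.Perm (Fin 4)) : IsSimpleClosedGeodesic (A ∘ σ) γ := by
  obtain ⟨n, X, F, hn, hF, hd, rfl⟩ := h
  have key : ∀ f g k l, IsCommonEdge (σ.symm f) (σ.symm g) k l → IsCommonEdge f g (σ k) (σ l) := by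
    rintro f g k l ⟨h1, h2, h3, h4, h5, h6⟩
    refine ⟨fun h => h1 (congrArg _ h), fun h => h2 (σ.injective h), ?_, ?_, ?_, ?_⟩ <;>
    · rintro rfl
      simp at *
  refine ⟨n, X, fun i => σ.symm (F i), hn, ⟨fun i => ?_, fun i => ?_, fun i k l h => ?_,
    fun i k l h => ?_⟩, hd, rfl⟩
  · exact fun h => hF.face_ne i (σ.symm.injective h)
  · exact fun h => hF.edge_ne i (σ.symm.injective h)
  · exact hF.mem_edge i _ _ (key _ _ _ _ h)
  · exact hF.equal_angles i _ _ (key _ _ _ _ h)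

theorem image_greatArc (g : E4 ≃ₗᵢ[ℝ] E4) (x y : E4) :
    g '' greatArc x y = greatArc (g x) (g y) := by
  ext z
  constructor
  · rintro ⟨z, ⟨h1, s, t, hs, ht, rfl⟩, rfl⟩
    exact ⟨by rwa [g.norm_map], s, t, hs, ht, by simp⟩
  · rintro ⟨h1, s, t, hs, ht, rfl⟩
    have e : s • g x + t • g y = g (s • x + t • y) := by simp
    rw [e] at h1 ⊢
    exact ⟨_, ⟨by rwa [g.norm_map] at h1, s, t, hs, ht, rfl⟩, rfl⟩

theorem sphericalAngle_map (g : E4 ≃ₗᵢ[ℝ] E4) (x y z : E4) :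
    sphericalAngle (g x) (g y) (g z) = sphericalAngle x y z := by
  have e : ∀ x y, tangentTowards (g x) (g y) = g (tangentTowards x y) := fun x y => by
    simp [tangentTowards]
  rw [sphericalAngle, e, e]
  exact g.toLinearIsometry.angle_map _ _

theorem _root_.IsSimpleClosedGeodesic.image (h : IsSimpleClosedGeodesic A γ) (g : E4 ≃ₗᵢ[ℝ] E4) :
    IsSimpleClosedGeodesic (g ∘ A) (g '' γ) := by
  obtain ⟨n, X, F, hn, hF, hd, rfl⟩ := h
  refine ⟨n, g ∘ X, F, hn, ⟨hF.face_ne, hF.edge_ne, fun i k l h => ?_, fun i k l h => ?_⟩,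
    fun i j hij => ?_, ?_⟩
  · obtain ⟨h1, s, t, hs, ht, h2⟩ := hF.mem_edge i k l h
    exact ⟨by simpa using h1, s, t, hs, ht, by simp [h2]⟩
  · simpa [sphericalAngle_map] using hF.equal_angles i k l h
  · have e : ∀ i, greatArc ((g ∘ X) i) ((g ∘ X) (i + 1)) \ {(g ∘ X) (i + 1)} =
        g '' (greatArc (X i) (X (i + 1)) \ {X (i + 1)}) := fun i => by
      rw [Set.image_sdiff g.injective, Set.image_singleton, image_greatArc]; rfl
    rw [e, e, Set.disjoint_image_iff g.injective]
    exact hd i j hij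
  · rw [Set.image_iUnion]
    exact Set.iUnion_congr fun i => image_greatArc g _ _

theorem edgeCount_image (g : E4 ≃ₗᵢ[ℝ] E4) (k l : Fin 4) :
    edgeCount (g ∘ A) (g '' γ) k l = edgeCount A γ k l := by
  rw [edgeCount, Function.comp_apply, Function.comp_apply, ← image_greatArc,
    ← Set.image_inter g.injective, Set.ncard_image_of_injective _ g.injective, edgeCount]

theorem image_tetraSurface (g : E4 ≃ₗᵢ[ℝ] E4) :
    g '' tetraSurface A = tetraSurface (g ∘ A) := by
  rw [tetraSurface, Set.image_iUnion]
  refine Set.iUnion_congr fun k => ?_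
  ext z
  constructor
  · rintro ⟨z, ⟨h1, w, hw, hk, rfl⟩, rfl⟩
    exact ⟨by rwa [g.norm_map], w, hw, hk, by simp⟩
  · rintro ⟨h1, w, hw, hk, rfl⟩
    have e : ∑ i, w i • (g ∘ A) i = g (∑ i, w i • A i) := by simp
    rw [e] at h1 ⊢
    exact ⟨_, ⟨by rwa [g.norm_map] at h1, w, hw, hk, rfl⟩, rfl⟩

theorem tetraSurface_comp_perm (σ : Equiv.Perm (Fin 4)) :
    tetraSurface (A ∘ σ) = tetraSurface A := by
  have key : ∀ (σ : Equiv.Perm (Fin 4)) (A : Fin 4 → E4), tetraSurface (A ∘ σ) ⊆ tetraSurface A := by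
    intro σ A z hz
    obtain ⟨k, h1, w, hw, hk, rfl⟩ := Set.mem_iUnion.1 hz
    refine Set.mem_iUnion.2 ⟨σ k, h1, w ∘ σ.symm, fun i => hw _, by simpa using hk, ?_⟩
    rw [← Equiv.sum_comp σ (fun i => (w ∘ σ.symm) i • A i)]
    simp
  refine (key σ A).antisymm ?_
  have := key σ.symm (A ∘ σ)
  rwa [Function.comp_assoc, Equiv.self_comp_symm, Function.comp_id] at this

theorem IsRegularFrame.comp_perm {c : ℝ} (hA : IsRegularFrame A c) (σ : Equiv.Perm (Fin 4)) :
    IsRegularFrame (A ∘ σ) c :=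
  ⟨hA.linearIndependent.comp _ σ.injective, fun _ => hA.inner_self _,
    fun _ _ h => hA.inner_of_ne _ _ (σ.injective.ne h), hA.pos, hA.lt_one⟩

/-- The linear map that matches the two bases is isometric because their Gram matrices coincide. -/
theorem IsRegularFrame.exists_isometry {c : ℝ} {B : Fin 4 → E4} (hA : IsRegularFrame A c)
    (hB : IsRegularFrame B c) : ∃ g : E4 ≃ₗᵢ[ℝ] E4, g ∘ A = B := by
  have hcard : Fintype.card (Fin 4) = Module.finrank ℝ E4 := by simp
  let a := basisOfLinearIndependentOfCardEqFinrank hA.linearIndependent hcard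
  let b := basisOfLinearIndependentOfCardEqFinrank hB.linearIndependent hcard
  have ha : ∀ i, a i = A i := fun i => by simp [a]
  have hb : ∀ i, b i = B i := fun i => by simp [b]
  let f : E4 ≃ₗ[ℝ] E4 := a.equiv b (Equiv.refl _)
  have hf : ∀ i, f (A i) = B i := fun i => by
    rw [← ha, ← hb]
    exact a.equiv_apply i b (Equiv.refl _)
  have hx : ∀ x, x = comb A (a.repr x) := fun x => by
    conv_lhs => rw [← a.sum_repr x]
    simp [comb, ha]
  have hcomb : ∀ w, f (comb A w) = comb B w := fun w => by simp [comb, hf]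
  refine ⟨f.isometryOfInner fun x y => ?_, funext hf⟩
  rw [hx x, hx y, hcomb, hcomb, hA.inner_comb, hB.inner_comb]

end

end SphericalTetrahedron

open SphericalTetrahedron

theorem mainTheorem5 (p q : ℕ) (hpq : Nat.Coprime p q) (hlt : p < q) (ε : ℝ) (hε0 : 0 < ε)
    (hε : ε < epsBound p q) (A : Fin 4 → E4) (hA : IsRegularTetrahedron A (Real.pi / 3 + ε)) :
    ∃ γ : Set E4, IsSimpleClosedGeodesic A γ ∧ HasType A γ p q ∧
      ∀ γ' : Set E4, IsSimpleClosedGeodesic A γ' → HasType A γ' p q →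
        ∃ g : E4 ≃ₗᵢ[ℝ] E4, g '' tetraSurface A = tetraSurface A ∧ g '' γ = γ' := by
  have hN : (1 : ℝ) ≤ p + q := by exact_mod_cast (show 1 ≤ p + q by omega)
  have hsmall := small_of_lt_epsBound hpq hlt hε0 hε
  have hcos : 0 < Real.cos (Real.pi / 3 + ε) := by
    have : (1 : ℝ) ≤ (p + q) ^ 3 := one_le_pow₀ hN
    by_contra hcon
    nlinarith
  obtain ⟨c, hc, hcα⟩ := hA.exists_isRegularFrame hcos
  rw [hcα] at hsmall
  obtain ⟨γ, hγ, h1, h2, h3⟩ :=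
    hc.exists_isSimpleClosedGeodesic hpq (Nat.zero_lt_of_lt hlt) hsmall
  have a1 := h1 0 1 (by decide)
  have a2 := h1 2 3 (by decide)
  have a3 := h2 0 2 (by decide)
  have a4 := h2 1 3 (by decide)
  have a5 := h3 0 3 (by decide)
  have a6 := h3 1 2 (by decide)
  refine ⟨γ, hγ, ⟨1, a1, a2, a3, a4, a5, a6⟩, ?_⟩
  rintro γ' hγ' ⟨σ, b1, b2, b3, b4, b5, b6⟩
  -- The relabelling `σ` in the type of `γ'` is realised by an isometry, and `g '' γ` and `γ'` are
  -- compared on the same frame `A ∘ σ`.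
  obtain ⟨g, hg⟩ := hc.exists_isometry (hc.comp_perm σ)
  have hgγ := hγ.image g
  have hcount := fun k l => edgeCount_image (A := A) (γ := γ) g k l
  rw [hg] at hgγ hcount
  refine ⟨g, by rw [image_tetraSurface, hg, tetraSurface_comp_perm], ?_⟩
  have hcomp : ∀ k l, edgeCount (A ∘ σ) γ' k l = edgeCount A γ' (σ k) (σ l) := fun _ _ => rfl
  refine (hc.comp_perm σ).eq_of_edgeCount_eq hgγ (hγ'.comp_perm σ) (M := 4 * (p + q)) ?_ ?_ ?_
  · have key : ∀ k l, k < l → edgeCount A γ k l = edgeCount A γ' (σ k) (σ l) := by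
      intro k l hkl
      fin_cases k <;> fin_cases l <;> first
        | exact absurd hkl (by decide)
        | simp_all
    intro k l hkl
    rw [hcount, hcomp]
    rcases lt_or_gt_of_ne hkl with h | h
    · exact key k l h
    · rw [edgeCount_comm, key l k h, edgeCount_comm]
  · simp only [hcount, Fin.sum_univ_four]
    simp [a1, a2, a3, a4, a5, a6, edgeCount_comm A γ 1 0, edgeCount_comm A γ 2 0,
      edgeCount_comm A γ 3 0, edgeCount_comm A γ 2 1, edgeCount_comm A γ 3 1,
      edgeCount_comm A γ 3 2]
    ring
  · push_cast
    exact arccos_lt_of_small hc.pos hc.lt_one hN hsmall
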